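/- Let $\mathcal{A}$ be a bicomplete abelian category with enough projective and enough injective objects; $\mathcal{P}$ and $\mathcal{I}$ denote the classes of projective and injective objects. Let $(\mathcal{X},\mathcal{Z},\mathcal{Y})$ be a complete and hereditary cotorsion triple in $\mathcal{A}$: $(\mathcal{X},\mathcal{Z})$ and $(\mathcal{Z},\mathcal{Y})$ are cotorsion pairs (i.e. $\mathcal{X}={}^{\perp}\mathcal{Z}$, $\mathcal{Z}=\mathcal{X}^{\perp}$, $\mathcal{Z}={}^{\perp}\mathcal{Y}$, $\mathcal{Y}=\mathcal{Z}^{\perp}$ with respect to $\mathrm{Ext}^1_{\mathcal{A}}$), each of them is complete (for a pair $(\mathcal{U},\mathcal{V})$: every object $M$ has short exact sequences $0\to V\to U\to M\to 0$ and $0\to M\to V'\to U'\to 0$ with $U,U'\in\mathcal{U}$, $V,V'\in\mathcal{V}$) and hereditary ($\mathcal{U}$ contains $\mathcal{P}$, and for every short exact sequence $0\to U_1\to U_2\to U_3\to 0$ with $U_3\in\mathcal{U}$ one has $U_2\in\mathcal{U}$ if and only if $U_1\in\mathcal{U}$). For an additive subcategory $\mathcal{C}$, a right $\mathcal{C}$-approximation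 of $M$ is a morphism $C\to M$ with $C\in\mathcal{C}$ through which every morphism from an object of $\mathcal{C}$ to $M$ factors; $\mathcal{C}$ is contravariantly finite if every object of $\mathcal{A}$ has one. Left $\mathcal{C}$-approximations and covariantly finite subcategories are defined dually. The stable category $\mathcal{A}/\mathcal{C}$ has the objects of $\mathcal{A}$, and its morphisms are those of $\mathcal{A}$ modulo the morphisms that factor through an object of $\mathcal{C}$; for $\mathcal{D}\supseteq\mathcal{C}$, $\mathcal{D}/\mathcal{C}$ is its full subcategory on the objects of $\mathcal{D}$. When $\mathcal{C}$ is contravariantly (covariantly) finite, $\Omega$ (resp. $\Sigma$) is the endofunctor of $\mathcal{A}/\mathcal{C}$ given by kernels of right (resp. cokernels of left) $\mathcal{C}$-approximations. The left triangles $\Omega N\to K\to M\to N$ of $\mathcal{A}/\mathcal{C}$ are, up to isomorphism, those given by a morphism $M\to N$ through which all morphisms from $\mathcal{C}$ to $N$ factor, its kernel $K\to M$, and the morphism $\Omega N\to K$ induced by a lift to $M$ of the right $\mathcal{C}$-approximation of $N$; right triangles $K\to M\to N\to\Sigma K$ are defined dually. Assume that $\mathcal{P}$ is covariantly finite and $\mathcal{I}$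 is contravariantly finite. Then: (1) The stable categories $\mathcal{X}/\mathcal{P}$ and $\mathcal{Y}/\mathcal{I}$ are triangulated categories; their suspension is the restriction of $\Sigma$ from $\mathcal{A}/\mathcal{P}$, respectively $\mathcal{A}/\mathcal{I}$, and their distinguished triangles are the right triangles of $\mathcal{A}/\mathcal{P}$, respectively $\mathcal{A}/\mathcal{I}$, with all objects in $\mathcal{X}$, respectively $\mathcal{Y}$. Moreover, consider on $\mathcal{A}$ the projective model structure (cofibrant objects $\mathcal{X}$, trivial objects $\mathcal{Z}$, all objects fibrant) and the injective model structure (all objects cofibrant, trivial objects $\mathcal{Z}$, fibrant objects $\mathcal{Y}$), in which the (trivial) cofibrations are the monomorphisms with (trivial) cofibrant cokernel, the (trivial) fibrations are the epimorphisms with (trivial) fibrant kernel, and the weak equivalences are the composites of a trivial cofibration followed by a trivial fibration. These are model structures, and both are stable, i.e. the suspension functor on the homotopy category, which sends a cofibrant object $M$ to $CM/M$ for a cofibration $M\to CM$ with $CM\to 0$ a weak equivalence, is an equivalence of categories. (2) With the functors and the triangles above, $\mathcal{A}/\mathcal{P}$ and $\mathcal{A}/\mathcal{I}$ are pretriangulated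 categories (an adjunction $\Sigma\dashv\Omega$, a left and a right triangulation, and the two gluing conditions between right and left triangles), $(\mathcal{X}/\mathcal{P},\mathcal{Z}/\mathcal{P})$ is a torsion pair in $\mathcal{A}/\mathcal{P}$, and $(\mathcal{Z}/\mathcal{I},\mathcal{Y}/\mathcal{I})$ is a torsion pair in $\mathcal{A}/\mathcal{I}$. Here $(\mathcal{T},\mathcal{F})$ is a torsion pair if $\mathrm{Hom}(T,F)=0$ for all $T\in\mathcal{T}$ and $F\in\mathcal{F}$, $\Sigma(\mathcal{T})\subseteq\mathcal{T}$, $\Omega(\mathcal{F})\subseteq\mathcal{F}$, and every object $M$ has morphisms $T\to M\to F$ with $T\in\mathcal{T}$ and $F\in\mathcal{F}$ that are part both of a left triangle $\Omega F\to T\to M\to F$ and of a right triangle $T\to M\to F\to\Sigma T$. -/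

import Mathlib

open CategoryTheory CategoryTheory.Limits CategoryTheory.Abelian HomotopicalAlgebra
open scoped ZeroObject

universe w v u

noncomputable section

namespace CotorsionTriples

/-! ### Cotorsion pairs and cotorsion triples -/

section Cotorsion

variable {A : Type u} [Category.{v} A] [Abelian A]

/-- `(X, Y)` is a cotorsion pair: `X = ⊥Y` and `Y = X⊥` with respect to `Ext¹`. -/
structure IsCotorsionPair [HasExt.{w} A] (X Y : ObjectProperty A) : Prop where
  left_iff : ∀ M : A, X M ↔ ∀ N : A, Y N → ∀ e : Ext.{w} M N 1, e = 0
  right_iff : ∀ N : A, Y N ↔ ∀ M : A, X M → ∀ e : Ext.{w} M N 1, e = 0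

/-- Completeness of a pair `(X, Y)`: every object `M` admits short exact sequences
`0 ⟶ Y ⟶ X ⟶ M ⟶ 0` and `0 ⟶ M ⟶ Y' ⟶ X' ⟶ 0`. -/
structure IsCompletePair (X Y : ObjectProperty A) : Prop where
  right_approx : ∀ M : A, ∃ (K E : A) (i : K ⟶ E) (p : E ⟶ M) (zero : i ≫ p = 0),
    (ShortComplex.mk i p zero).ShortExact ∧ Y K ∧ X E
  left_approx : ∀ M : A, ∃ (E L : A) (i : M ⟶ E) (p : E ⟶ L) (zero : i ≫ p = 0),
    (ShortComplex.mk i p zero).ShortExact ∧ Y E ∧ X L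

/-- `X` is resolving: it contains the projective objects, and for every short exact sequence
`0 ⟶ X₁ ⟶ X₂ ⟶ X₃ ⟶ 0` with `X₃` in `X`, `X₂` is in `X` if and only if `X₁` is. -/
structure IsResolving (X : ObjectProperty A) : Prop where
  projective : ∀ P : A, Projective P → X P
  iff_of_shortExact : ∀ S : ShortComplex A, S.ShortExact → X S.X₃ → (X S.X₂ ↔ X S.X₁)

/-- `(X, Z, Y)` is a cotorsion triple which is complete and hereditary (a cotorsion pair is
hereditary if its left class is resolving). -/
structure IsCompleteHereditaryCotorsionTriple [HasExt.{w} A] (X Z Y : ObjectProperty A) :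
    Prop where
  cotorsion_left : IsCotorsionPair.{w} X Z
  cotorsion_right : IsCotorsionPair.{w} Z Y
  complete_left : IsCompletePair X Z
  complete_right : IsCompletePair Z Y
  hereditary_left : IsResolving X
  hereditary_right : IsResolving Z

end Cotorsion

/-! ### Approximations, and stable categories -/

section Stable

variable {A : Type u} [Category.{v} A] [Abelian A] (C : ObjectProperty A)

/-- A morphism through which all morphisms from objects of `C` factor. -/
def IsRelEpi {M N : A} (p : M ⟶ N) : Prop :=
  ∀ ⦃P : A⦄, C P → ∀ g : P ⟶ N, ∃ h : P ⟶ M, h ≫ p = g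

/-- A morphism through which all morphisms to objects of `C` factor. -/
def IsRelMono {M N : A} (i : M ⟶ N) : Prop :=
  ∀ ⦃P : A⦄, C P → ∀ g : M ⟶ P, ∃ h : N ⟶ P, i ≫ h = g

/-- `C` is contravariantly finite: each object has a right `C`-approximation. -/
class IsContravariantlyFinite : Prop where
  exists_approx : ∀ M : A, ∃ (P : A) (p : P ⟶ M), C P ∧ IsRelEpi C p

/-- `C` is covariantly finite: each object has a left `C`-approximation. -/
class IsCovariantlyFinite : Prop where
  exists_approx : ∀ M : A, ∃ (P : A) (i : M ⟶ P), C P ∧ IsRelMono C i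

/-- `C` is (the class of objects of) an additive subcategory. -/
class IsAdditiveSubcategory : Prop where
  zero : C 0
  biprod : ∀ ⦃M N : A⦄, C M → C N → C (M ⊞ N)

instance : IsAdditiveSubcategory (isProjective A) where
  zero := (inferInstance : Projective (0 : A))
  biprod _ _ hM hN := by
    have hM' : Projective _ := hM
    have hN' : Projective _ := hN
    change Projective _
    infer_instance

instance : IsAdditiveSubcategory (isInjective A) where
  zero := (inferInstance : Injective (0 : A))
  biprod _ _ hM hN := by
    have hM' : Injective _ := hM
    have hN' : Injective _ := hN
    change Injective _
    infer_instance

instance [EnoughProjectives A] : IsContravariantlyFinite (isProjective A) where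
  exists_approx M := ⟨Projective.over M, Projective.π M,
    (inferInstance : Projective (Projective.over M)), fun P hP g => by
      have : Projective P := hP
      exact ⟨Projective.factorThru g _, Projective.factorThru_comp _ _⟩⟩

instance [EnoughInjectives A] : IsCovariantlyFinite (isInjective A) where
  exists_approx M := ⟨Injective.under M, Injective.ι M,
    (inferInstance : Injective (Injective.under M)), fun P hP g => by
      have : Injective P := hP
      exact ⟨Injective.factorThru g _, Injective.comp_factorThru _ _⟩⟩

/-- Two parallel morphisms are stably equivalent if their difference factors through an
object of `C`. -/
def stableRel : HomRel A := fun M N f g =>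
  ∃ (P : A) (_ : C P) (a : M ⟶ P) (b : P ⟶ N), f - g = a ≫ b

variable [IsAdditiveSubcategory C]

variable {C} in
lemma stableRel_add {M N : A} {f₁ f₂ g₁ g₂ : M ⟶ N} (hf : stableRel C f₁ f₂)
    (hg : stableRel C g₁ g₂) : stableRel C (f₁ + g₁) (f₂ + g₂) := by
  obtain ⟨P, hP, a, b, h⟩ := hf
  obtain ⟨Q, hQ, c, d, h'⟩ := hg
  refine ⟨P ⊞ Q, IsAdditiveSubcategory.biprod hP hQ, biprod.lift a c, biprod.desc b d, ?_⟩
  rw [biprod.lift_desc, ← h, ← h']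
  abel

instance : Congruence (stableRel C) where
  comp_left := by
    rintro _ _ _ f g g' ⟨P, hP, a, b, h⟩
    exact ⟨P, hP, f ≫ a, b, by rw [← Preadditive.comp_sub, h, Category.assoc]⟩
  comp_right := by
    rintro _ _ _ f f' g ⟨P, hP, a, b, h⟩
    exact ⟨P, hP, a, b ≫ g, by rw [← Preadditive.sub_comp, h, Category.assoc]⟩
  equivalence := by
    intro M N
    refine ⟨fun f => ⟨0, IsAdditiveSubcategory.zero, 0, 0, by simp⟩, ?_, ?_⟩
    · rintro f g ⟨P, hP, a, b, h⟩
      exact ⟨P, hP, -a, b, by rw [Preadditive.neg_comp, ← h, neg_sub]⟩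
    · rintro f g k ⟨P, hP, a, b, h⟩ ⟨Q, hQ, c, d, h'⟩
      refine ⟨P ⊞ Q, IsAdditiveSubcategory.biprod hP hQ, biprod.lift a c, biprod.desc b d, ?_⟩
      rw [biprod.lift_desc, ← h, ← h']
      abel

/-- The stable category `A/C`: same objects as `A`, and stable equivalence classes of morphisms. -/
abbrev StableCategory : Type u := CategoryTheory.Quotient (stableRel C)

instance : Preadditive (StableCategory C) :=
  CategoryTheory.Quotient.preadditive _ fun _ _ _ _ _ _ hf hg => stableRel_add hf hg

/-- The projection functor from `A` to `A/C`. -/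
abbrev toStable : A ⥤ StableCategory C := CategoryTheory.Quotient.functor (stableRel C)

instance : (toStable C).Additive := ⟨rfl⟩

instance : HasZeroObject (StableCategory C) :=
  ⟨(toStable C).obj 0, by
    rw [IsZero.iff_id_eq_zero, ← (toStable C).map_id, id_zero, Functor.map_zero]⟩

variable {C} in
lemma toStable_map_eq {M N : A} {f g : M ⟶ N} (P : A) (hP : C P) (a : M ⟶ P) (b : P ⟶ N)
    (h : f - g = a ≫ b) : (toStable C).map f = (toStable C).map g :=
  CategoryTheory.Quotient.sound _ ⟨P, hP, a, b, h⟩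

/-- The full subcategory `D/C` of `A/C` given by the objects of a class `D`. If `C` is contained
in `D`, it is the stable category of `D` modulo `C`. -/
def stableSubcategory (D : ObjectProperty A) : ObjectProperty (StableCategory C) := fun M => D M.as

/-! #### The loop functor of the stable category -/

section Loop

variable [IsContravariantlyFinite C]

/-- The source of a chosen right `C`-approximation. -/
def rightApproxObj (M : A) : A := (IsContravariantlyFinite.exists_approx (C := C) M).choose

/-- A chosen right `C`-approximation. -/
def rightApprox (M : A) : rightApproxObj C M ⟶ M :=
  (IsContravariantlyFinite.exists_approx (C := C) M).choose_spec.choose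

lemma rightApproxObj_mem (M : A) : C (rightApproxObj C M) :=
  (IsContravariantlyFinite.exists_approx (C := C) M).choose_spec.choose_spec.1

lemma rightApprox_isRelEpi (M : A) : IsRelEpi C (rightApprox C M) :=
  (IsContravariantlyFinite.exists_approx (C := C) M).choose_spec.choose_spec.2

/-- The kernel of the chosen right `C`-approximation. -/
def syzygyObj (M : A) : A := kernel (rightApprox C M)

/-- The inclusion of the kernel of the chosen right `C`-approximation. -/
def syzygyι (M : A) : syzygyObj C M ⟶ rightApproxObj C M := kernel.ι _

@[simp]
lemma syzygyι_comp (M : A) : syzygyι C M ≫ rightApprox C M = 0 := kernel.condition _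

/-- `k` is induced on kernels of right approximations by a lift of `f`. -/
def IsSyzygyMap {M N : A} (f : M ⟶ N) (k : syzygyObj C M ⟶ syzygyObj C N) : Prop :=
  ∃ t : rightApproxObj C M ⟶ rightApproxObj C N,
    t ≫ rightApprox C N = rightApprox C M ≫ f ∧ k ≫ syzygyι C N = syzygyι C M ≫ t

lemma exists_isSyzygyMap {M N : A} (f : M ⟶ N) : ∃ k, IsSyzygyMap C f k := by
  obtain ⟨t, ht⟩ := rightApprox_isRelEpi C N (rightApproxObj_mem C M) (rightApprox C M ≫ f)
  refine ⟨kernel.lift _ (syzygyι C M ≫ t) ?_, t, ht, kernel.lift_ι _ _ _⟩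
  rw [Category.assoc, ht, ← Category.assoc, syzygyι_comp, zero_comp]

variable {C} in
lemma IsSyzygyMap.map_eq {M N : A} {f f' : M ⟶ N} {k k' : syzygyObj C M ⟶ syzygyObj C N}
    (hk : IsSyzygyMap C f k) (hk' : IsSyzygyMap C f' k') (hf : stableRel C f f') :
    (toStable C).map k = (toStable C).map k' := by
  obtain ⟨t, ht, htk⟩ := hk
  obtain ⟨t', ht', htk'⟩ := hk'
  obtain ⟨P, hP, a, b, hab⟩ := hf
  obtain ⟨b', rfl⟩ := rightApprox_isRelEpi C N hP b
  have h0 : (t - t' - rightApprox C M ≫ a ≫ b') ≫ rightApprox C N = 0 := by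
    simp only [Preadditive.sub_comp, Category.assoc, ht, ht', ← hab, Preadditive.comp_sub]
    abel
  obtain ⟨u, hu⟩ : ∃ u : rightApproxObj C M ⟶ syzygyObj C N, u ≫ syzygyι C N = _ :=
    ⟨kernel.lift _ _ h0, kernel.lift_ι _ _ h0⟩
  refine toStable_map_eq _ (rightApproxObj_mem C M) (syzygyι C M) u ?_
  have : Mono (syzygyι C N) := inferInstanceAs (Mono (kernel.ι _))
  rw [← cancel_mono (syzygyι C N), Preadditive.sub_comp, htk, htk', Category.assoc, hu]
  simp only [Preadditive.comp_sub]
  rw [← Category.assoc (syzygyι C M) (rightApprox C M), syzygyι_comp, zero_comp, sub_zero]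

/-- The functor `Ω : A/C ⥤ A/C`, sending `M` to the kernel of a right `C`-approximation of `M`. -/
def syzygy : StableCategory C ⥤ StableCategory C :=
  CategoryTheory.Quotient.lift _
    { obj := fun M => (toStable C).obj (syzygyObj C M)
      map := fun f => (toStable C).map (exists_isSyzygyMap C f).choose
      map_id := fun M => by
        rw [← (toStable C).map_id]
        exact (exists_isSyzygyMap C (𝟙 M)).choose_spec.map_eq ⟨𝟙 _, by simp, by simp⟩
          (Congruence.equivalence.refl _)
      map_comp := fun {M N L} f g => by
        rw [← (toStable C).map_comp]
        obtain ⟨t, ht, htk⟩ := (exists_isSyzygyMap C f).choose_spec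
        obtain ⟨s, hs, hsk⟩ := (exists_isSyzygyMap C g).choose_spec
        refine (exists_isSyzygyMap C (f ≫ g)).choose_spec.map_eq ⟨t ≫ s, ?_, ?_⟩
          (Congruence.equivalence.refl _)
        · rw [Category.assoc, hs, ← Category.assoc, ht, Category.assoc]
        · rw [Category.assoc, hsk, ← Category.assoc, htk, Category.assoc] }
    fun _ _ f g h =>
      (exists_isSyzygyMap C f).choose_spec.map_eq (exists_isSyzygyMap C g).choose_spec h

/-- The functor `Ω` may be computed on morphisms using any lift to right approximations. -/
lemma syzygy_map_eq {M N : A} {f : M ⟶ N} {k : syzygyObj C M ⟶ syzygyObj C N}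
    (hk : IsSyzygyMap C f k) : (syzygy C).map ((toStable C).map f) = (toStable C).map k :=
  (exists_isSyzygyMap C f).choose_spec.map_eq hk (Congruence.equivalence.refl _)

end Loop

/-! #### The suspension functor of the stable category -/

section Suspension

variable [IsCovariantlyFinite C]

/-- The target of a chosen left `C`-approximation. -/
def leftApproxObj (M : A) : A := (IsCovariantlyFinite.exists_approx (C := C) M).choose

/-- A chosen left `C`-approximation. -/
def leftApprox (M : A) : M ⟶ leftApproxObj C M :=
  (IsCovariantlyFinite.exists_approx (C := C) M).choose_spec.choose

lemma leftApproxObj_mem (M : A) : C (leftApproxObj C M) :=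
  (IsCovariantlyFinite.exists_approx (C := C) M).choose_spec.choose_spec.1

lemma leftApprox_isRelMono (M : A) : IsRelMono C (leftApprox C M) :=
  (IsCovariantlyFinite.exists_approx (C := C) M).choose_spec.choose_spec.2

/-- The cokernel of the chosen left `C`-approximation. -/
def cosyzygyObj (M : A) : A := cokernel (leftApprox C M)

/-- The projection to the cokernel of the chosen left `C`-approximation. -/
def cosyzygyπ (M : A) : leftApproxObj C M ⟶ cosyzygyObj C M := cokernel.π _

@[simp]
lemma comp_cosyzygyπ (M : A) : leftApprox C M ≫ cosyzygyπ C M = 0 := cokernel.condition _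

/-- `k` is induced on cokernels of left approximations by an extension of `f`. -/
def IsCosyzygyMap {M N : A} (f : M ⟶ N) (k : cosyzygyObj C M ⟶ cosyzygyObj C N) : Prop :=
  ∃ t : leftApproxObj C M ⟶ leftApproxObj C N,
    leftApprox C M ≫ t = f ≫ leftApprox C N ∧ cosyzygyπ C M ≫ k = t ≫ cosyzygyπ C N

lemma exists_isCosyzygyMap {M N : A} (f : M ⟶ N) : ∃ k, IsCosyzygyMap C f k := by
  obtain ⟨t, ht⟩ := leftApprox_isRelMono C M (leftApproxObj_mem C N) (f ≫ leftApprox C N)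
  refine ⟨cokernel.desc _ (t ≫ cosyzygyπ C N) ?_, t, ht, cokernel.π_desc _ _ _⟩
  rw [← Category.assoc, ht, Category.assoc, comp_cosyzygyπ, comp_zero]

variable {C} in
lemma IsCosyzygyMap.map_eq {M N : A} {f f' : M ⟶ N} {k k' : cosyzygyObj C M ⟶ cosyzygyObj C N}
    (hk : IsCosyzygyMap C f k) (hk' : IsCosyzygyMap C f' k') (hf : stableRel C f f') :
    (toStable C).map k = (toStable C).map k' := by
  obtain ⟨t, ht, htk⟩ := hk
  obtain ⟨t', ht', htk'⟩ := hk'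
  obtain ⟨P, hP, a, b, hab⟩ := hf
  obtain ⟨a', rfl⟩ := leftApprox_isRelMono C M hP a
  have h0 : leftApprox C M ≫ (t - t' - a' ≫ b ≫ leftApprox C N) = 0 := by
    have h2 : leftApprox C M ≫ a' ≫ b ≫ leftApprox C N = (f - f') ≫ leftApprox C N := by
      rw [hab]; simp only [Category.assoc]
    rw [Preadditive.comp_sub, Preadditive.comp_sub, ht, ht', h2, Preadditive.sub_comp, sub_self]
  obtain ⟨u, hu⟩ : ∃ u : cosyzygyObj C M ⟶ leftApproxObj C N, cosyzygyπ C M ≫ u = _ :=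
    ⟨cokernel.desc _ _ h0, cokernel.π_desc _ _ h0⟩
  refine toStable_map_eq _ (leftApproxObj_mem C N) u (cosyzygyπ C N) ?_
  have : Epi (cosyzygyπ C M) := inferInstanceAs (Epi (cokernel.π _))
  rw [← cancel_epi (cosyzygyπ C M), Preadditive.comp_sub, htk, htk', ← Category.assoc, hu]
  simp only [Preadditive.sub_comp, Category.assoc, comp_cosyzygyπ, comp_zero, sub_zero]

/-- The functor `Σ : A/C ⥤ A/C`, sending `M` to the cokernel of a left `C`-approximation of `M`. -/
def cosyzygy : StableCategory C ⥤ StableCategory C :=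
  CategoryTheory.Quotient.lift _
    { obj := fun M => (toStable C).obj (cosyzygyObj C M)
      map := fun f => (toStable C).map (exists_isCosyzygyMap C f).choose
      map_id := fun M => by
        rw [← (toStable C).map_id]
        exact (exists_isCosyzygyMap C (𝟙 M)).choose_spec.map_eq ⟨𝟙 _, by simp, by simp⟩
          (Congruence.equivalence.refl _)
      map_comp := fun {M N L} f g => by
        rw [← (toStable C).map_comp]
        obtain ⟨t, ht, htk⟩ := (exists_isCosyzygyMap C f).choose_spec
        obtain ⟨s, hs, hsk⟩ := (exists_isCosyzygyMap C g).choose_spec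
        refine (exists_isCosyzygyMap C (f ≫ g)).choose_spec.map_eq ⟨t ≫ s, ?_, ?_⟩
          (Congruence.equivalence.refl _)
        · rw [← Category.assoc, ht, Category.assoc, hs, Category.assoc]
        · rw [← Category.assoc, htk, Category.assoc, hsk, Category.assoc] }
    fun _ _ f g h =>
      (exists_isCosyzygyMap C f).choose_spec.map_eq (exists_isCosyzygyMap C g).choose_spec h

/-- The functor `Σ` may be computed on morphisms using any extension to left approximations. -/
lemma cosyzygy_map_eq {M N : A} {f : M ⟶ N} {k : cosyzygyObj C M ⟶ cosyzygyObj C N}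
    (hk : IsCosyzygyMap C f k) : (cosyzygy C).map ((toStable C).map f) = (toStable C).map k :=
  (exists_isCosyzygyMap C f).choose_spec.map_eq hk (Congruence.equivalence.refl _)

end Suspension

end Stable

/-! ### Left triangulated, right triangulated and pretriangulated categories -/

section Triangulated

variable {T : Type u} [Category.{v} T]

/-- A diagram `Ω X₃ ⟶ X₁ ⟶ X₂ ⟶ X₃`. -/
structure LeftTriangle (Om : T ⥤ T) where
  mk ::
  {obj₁ obj₂ obj₃ : T}
  h : Om.obj obj₃ ⟶ obj₁
  g : obj₁ ⟶ obj₂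
  f : obj₂ ⟶ obj₃

/-- A diagram `X₁ ⟶ X₂ ⟶ X₃ ⟶ Σ X₁`. -/
structure RightTriangle (Si : T ⥤ T) where
  mk ::
  {obj₁ obj₂ obj₃ : T}
  f : obj₁ ⟶ obj₂
  g : obj₂ ⟶ obj₃
  h : obj₃ ⟶ Si.obj obj₁

/-- Isomorphic diagrams `Ω X₃ ⟶ X₁ ⟶ X₂ ⟶ X₃`. -/
def LeftTriangle.IsIsomorphic {Om : T ⥤ T} (S S' : LeftTriangle Om) : Prop :=
  ∃ (e₁ : S.obj₁ ≅ S'.obj₁) (e₂ : S.obj₂ ≅ S'.obj₂) (e₃ : S.obj₃ ≅ S'.obj₃),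
    S.h ≫ e₁.hom = Om.map e₃.hom ≫ S'.h ∧ S.g ≫ e₂.hom = e₁.hom ≫ S'.g ∧
      S.f ≫ e₃.hom = e₂.hom ≫ S'.f

/-- Isomorphic diagrams `X₁ ⟶ X₂ ⟶ X₃ ⟶ Σ X₁`. -/
def RightTriangle.IsIsomorphic {Si : T ⥤ T} (S S' : RightTriangle Si) : Prop :=
  ∃ (e₁ : S.obj₁ ≅ S'.obj₁) (e₂ : S.obj₂ ≅ S'.obj₂) (e₃ : S.obj₃ ≅ S'.obj₃),
    S.f ≫ e₂.hom = e₁.hom ≫ S'.f ∧ S.g ≫ e₃.hom = e₂.hom ≫ S'.g ∧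
      S.h ≫ Si.map e₁.hom = e₃.hom ≫ S'.h

variable [Preadditive T] [HasZeroObject T]

/-- `(T, Ω, Δ)` is a left triangulated category. -/
structure IsLeftTriangulated (Om : T ⥤ T) (Del : Set (LeftTriangle Om)) : Prop where
  additive : Om.Additive
  isomorphic : ∀ S S' : LeftTriangle Om, S.IsIsomorphic S' → S ∈ Del → S' ∈ Del
  contractible : ∀ M : T,
    LeftTriangle.mk (0 : Om.obj 0 ⟶ M) (𝟙 M) (0 : M ⟶ 0) ∈ Del
  exists_triangle : ∀ {Y Z : T} (f : Y ⟶ Z), ∃ (X : T) (h : Om.obj Z ⟶ X) (g : X ⟶ Y),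
    LeftTriangle.mk h g f ∈ Del
  rotate : ∀ {X Y Z : T} (h : Om.obj Z ⟶ X) (g : X ⟶ Y) (f : Y ⟶ Z),
    LeftTriangle.mk h g f ∈ Del → LeftTriangle.mk (-Om.map f) h g ∈ Del
  complete_morphism : ∀ {X Y Z X' Y' Z' : T}
    (h : Om.obj Z ⟶ X) (g : X ⟶ Y) (f : Y ⟶ Z)
    (h' : Om.obj Z' ⟶ X') (g' : X' ⟶ Y') (f' : Y' ⟶ Z'),
    LeftTriangle.mk h g f ∈ Del → LeftTriangle.mk h' g' f' ∈ Del →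
    ∀ (b : Y ⟶ Y') (c : Z ⟶ Z'), f ≫ c = b ≫ f' →
      ∃ a : X ⟶ X', g ≫ b = a ≫ g' ∧ h ≫ a = Om.map c ≫ h'
  octahedron : ∀ {X Y Z F G H : T} (f : X ⟶ Y) (g : Y ⟶ Z)
    (h₁ : Om.obj Y ⟶ F) (a : F ⟶ X) (h₂ : Om.obj Z ⟶ G) (b : G ⟶ Y)
    (h₃ : Om.obj Z ⟶ H) (c : H ⟶ X),
    LeftTriangle.mk h₁ a f ∈ Del → LeftTriangle.mk h₂ b g ∈ Del →
    LeftTriangle.mk h₃ c (f ≫ g) ∈ Del →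
      ∃ (m : F ⟶ H) (n : H ⟶ G), LeftTriangle.mk (Om.map b ≫ h₁) m n ∈ Del ∧
        m ≫ c = a ∧ n ≫ b = c ≫ f ∧ h₃ ≫ n = h₂ ∧ h₁ ≫ m = Om.map g ≫ h₃

/-- `(T, Σ, ∇)` is a right triangulated category. -/
structure IsRightTriangulated (Si : T ⥤ T) (Nab : Set (RightTriangle Si)) : Prop where
  additive : Si.Additive
  isomorphic : ∀ S S' : RightTriangle Si, S.IsIsomorphic S' → S ∈ Nab → S' ∈ Nab
  contractible : ∀ M : T,
    RightTriangle.mk (0 : 0 ⟶ M) (𝟙 M) (0 : M ⟶ Si.obj 0) ∈ Nab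
  exists_triangle : ∀ {X Y : T} (f : X ⟶ Y), ∃ (Z : T) (g : Y ⟶ Z) (h : Z ⟶ Si.obj X),
    RightTriangle.mk f g h ∈ Nab
  rotate : ∀ {X Y Z : T} (f : X ⟶ Y) (g : Y ⟶ Z) (h : Z ⟶ Si.obj X),
    RightTriangle.mk f g h ∈ Nab → RightTriangle.mk g h (-Si.map f) ∈ Nab
  complete_morphism : ∀ {X Y Z X' Y' Z' : T}
    (f : X ⟶ Y) (g : Y ⟶ Z) (h : Z ⟶ Si.obj X)
    (f' : X' ⟶ Y') (g' : Y' ⟶ Z') (h' : Z' ⟶ Si.obj X'),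
    RightTriangle.mk f g h ∈ Nab → RightTriangle.mk f' g' h' ∈ Nab →
    ∀ (a : X ⟶ X') (b : Y ⟶ Y'), f ≫ b = a ≫ f' →
      ∃ c : Z ⟶ Z', g ≫ c = b ≫ g' ∧ h ≫ Si.map a = c ≫ h'
  octahedron : ∀ {X Y Z F G H : T} (f : X ⟶ Y) (g : Y ⟶ Z)
    (a : Y ⟶ F) (h₁ : F ⟶ Si.obj X) (b : Z ⟶ G) (h₂ : G ⟶ Si.obj Y)
    (c : Z ⟶ H) (h₃ : H ⟶ Si.obj X),
    RightTriangle.mk f a h₁ ∈ Nab → RightTriangle.mk g b h₂ ∈ Nab →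
    RightTriangle.mk (f ≫ g) c h₃ ∈ Nab →
      ∃ (m : F ⟶ H) (n : H ⟶ G), RightTriangle.mk m n (h₂ ≫ Si.map a) ∈ Nab ∧
        a ≫ m = g ≫ c ∧ c ≫ n = b ∧ m ≫ h₃ = h₁ ∧ n ≫ h₂ = h₃ ≫ Si.map f

/-- A pretriangulated category: an adjoint pair `(Σ, Ω)`, a left triangulation for `Ω`, a right
triangulation for `Σ`, and the two gluing conditions for morphisms from right triangles to left
triangles. -/
structure IsPretriangulated {Si Om : T ⥤ T} (adj : Si ⊣ Om) (Del : Set (LeftTriangle Om))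
    (Nab : Set (RightTriangle Si)) : Prop where
  left : IsLeftTriangulated Om Del
  right : IsRightTriangulated Si Nab
  glue_right : ∀ {X Y Z X' Y' Z' : T}
    (f : X ⟶ Y) (g : Y ⟶ Z) (h : Z ⟶ Si.obj X)
    (h' : Om.obj Z' ⟶ X') (g' : X' ⟶ Y') (f' : Y' ⟶ Z'),
    RightTriangle.mk f g h ∈ Nab → LeftTriangle.mk h' g' f' ∈ Del →
    ∀ (a : X ⟶ Om.obj Z') (b : Y ⟶ X'), f ≫ b = a ≫ h' →
      ∃ c : Z ⟶ Y', g ≫ c = b ≫ g' ∧ c ≫ f' = h ≫ Si.map a ≫ adj.counit.app Z'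
  glue_left : ∀ {X Y Z X' Y' Z' : T}
    (f : X ⟶ Y) (g : Y ⟶ Z) (h : Z ⟶ Si.obj X)
    (h' : Om.obj Z' ⟶ X') (g' : X' ⟶ Y') (f' : Y' ⟶ Z'),
    RightTriangle.mk f g h ∈ Nab → LeftTriangle.mk h' g' f' ∈ Del →
    ∀ (c : Z ⟶ Y') (d : Si.obj X ⟶ Z'), h ≫ d = c ≫ f' →
      ∃ b : Y ⟶ X', b ≫ g' = g ≫ c ∧ f ≫ b = adj.unit.app X ≫ Om.map d ≫ h'

/-- A torsion pair `(U, V)` in a pretriangulated category. -/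
structure IsTorsionPair {Si Om : T ⥤ T} (Del : Set (LeftTriangle Om))
    (Nab : Set (RightTriangle Si)) (U V : ObjectProperty T) : Prop where
  hom_eq_zero : ∀ {M N : T}, U M → V N → ∀ f : M ⟶ N, f = 0
  suspension_mem : ∀ M : T, U M → U (Si.obj M)
  loop_mem : ∀ M : T, V M → V (Om.obj M)
  exists_triangles : ∀ M : T, ∃ (M₁ M₂ : T) (i : M₁ ⟶ M) (p : M ⟶ M₂)
    (h : Om.obj M₂ ⟶ M₁) (k : M₂ ⟶ Si.obj M₁), U M₁ ∧ V M₂ ∧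
      LeftTriangle.mk h i p ∈ Del ∧ RightTriangle.mk i p k ∈ Nab

end Triangulated

/-! ### The triangles of a stable category -/

section StableTriangles

variable {A : Type u} [Category.{v} A] [Abelian A] (C : ObjectProperty A)
  [IsAdditiveSubcategory C]

/-- The left triangles of `A/C`: up to isomorphism, `Ω Z ⟶ X ⟶ Y ⟶ Z` where `X ⟶ Y` is the
kernel of a `C`-epic morphism `Y ⟶ Z`, and `Ω Z ⟶ X` is induced by a lift to `Y` of the
right `C`-approximation of `Z`. -/
def stableLeftTriangles [IsContravariantlyFinite C] : Set (LeftTriangle (syzygy C)) :=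
  {S | ∃ (X Y Z : A) (g : X ⟶ Y) (f : Y ⟶ Z) (zero : g ≫ f = 0)
    (_ : Nonempty (IsLimit (KernelFork.ofι g zero))) (_ : IsRelEpi C f)
    (l : rightApproxObj C Z ⟶ Y) (h : syzygyObj C Z ⟶ X),
    l ≫ f = rightApprox C Z ∧ h ≫ g = syzygyι C Z ≫ l ∧
    LeftTriangle.IsIsomorphic (Om := syzygy C)
      (LeftTriangle.mk (Om := syzygy C) (obj₃ := (toStable C).obj Z)
        ((toStable C).map h) ((toStable C).map g) ((toStable C).map f)) S}

/-- The right triangles of `A/C`: up to isomorphism, `X ⟶ Y ⟶ Z ⟶ Σ X` where `Y ⟶ Z` is the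
cokernel of a `C`-monic morphism `X ⟶ Y`, and `Z ⟶ Σ X` is induced by an extension to `Y` of
the left `C`-approximation of `X`. -/
def stableRightTriangles [IsCovariantlyFinite C] : Set (RightTriangle (cosyzygy C)) :=
  {S | ∃ (X Y Z : A) (f : X ⟶ Y) (g : Y ⟶ Z) (zero : f ≫ g = 0)
    (_ : Nonempty (IsColimit (CokernelCofork.ofπ g zero))) (_ : IsRelMono C f)
    (l : Y ⟶ leftApproxObj C X) (h : Z ⟶ cosyzygyObj C X),
    f ≫ l = leftApprox C X ∧ g ≫ h = l ≫ cosyzygyπ C X ∧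
    RightTriangle.IsIsomorphic (Si := cosyzygy C)
      (RightTriangle.mk (Si := cosyzygy C) (obj₁ := (toStable C).obj X)
        ((toStable C).map f) ((toStable C).map g) ((toStable C).map h)) S}

/-- The pair `(D/C, E/C)` is a torsion pair in the pretriangulated category `A/C`. -/
def IsStableTorsionPair [IsContravariantlyFinite C] [IsCovariantlyFinite C]
    (D E : ObjectProperty A) : Prop :=
  (∃ adj : cosyzygy C ⊣ syzygy C,
    IsPretriangulated adj (stableLeftTriangles C) (stableRightTriangles C)) ∧
  IsTorsionPair (stableLeftTriangles C) (stableRightTriangles C)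
    (stableSubcategory C D) (stableSubcategory C E)

/-- The stable category `D/C` is a triangulated category: there is a triangulated structure
on `D/C` whose shift functor is the restriction of `Σ : A/C ⥤ A/C`, and in which the
distinguished triangles are those that are right triangles in `A/C`. -/
def IsStableTriangulated [IsCovariantlyFinite C] (D : ObjectProperty A) : Prop :=
  ∃ (_ : HasZeroObject (stableSubcategory C D).FullSubcategory)
    (_ : HasShift (stableSubcategory C D).FullSubcategory ℤ)
    (_ : ∀ n : ℤ, (shiftFunctor (stableSubcategory C D).FullSubcategory n).Additive)
    (_ : Pretriangulated (stableSubcategory C D).FullSubcategory)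
    (_ : IsTriangulated (stableSubcategory C D).FullSubcategory)
    (e : shiftFunctor (stableSubcategory C D).FullSubcategory (1 : ℤ) ⋙
      (stableSubcategory C D).ι ≅ (stableSubcategory C D).ι ⋙ cosyzygy C),
    ∀ S : Pretriangulated.Triangle (stableSubcategory C D).FullSubcategory,
      S ∈ Pretriangulated.distinguishedTriangles ↔
        RightTriangle.mk (Si := cosyzygy C) ((stableSubcategory C D).ι.map S.mor₁)
          ((stableSubcategory C D).ι.map S.mor₂)
          ((stableSubcategory C D).ι.map S.mor₃ ≫ e.hom.app S.obj₁) ∈ stableRightTriangles C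

end StableTriangles

/-! ### Model structures -/

section Model

/-- The model structure on an abelian category in which the (trivial) cofibrations are the
monomorphisms with (trivial) cofibrant cokernel, the (trivial) fibrations are the epimorphisms
with (trivial) fibrant kernel, and the weak equivalences are the composites of a trivial
cofibration followed by a trivial fibration; here `Cof`, `Triv` and `Fib` are the classes of
cofibrant, trivial and fibrant objects. -/
structure IsAbelianModelStructure {A : Type u} [Category.{v} A] [Abelian A]
    (_ : ModelCategory A) (Cof Triv Fib : ObjectProperty A) : Prop where
  cofibrations_iff : ∀ {M N : A} (f : M ⟶ N), cofibrations A f ↔ Mono f ∧ Cof (cokernel f)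
  fibrations_iff : ∀ {M N : A} (f : M ⟶ N), fibrations A f ↔ Epi f ∧ Fib (kernel f)
  weakEquivalences_iff : ∀ {M N : A} (f : M ⟶ N), weakEquivalences A f ↔
    ∃ (E : A) (i : M ⟶ E) (p : E ⟶ N), i ≫ p = f ∧
      (Mono i ∧ Cof (cokernel i) ∧ Triv (cokernel i)) ∧
      (Epi p ∧ Fib (kernel p) ∧ Triv (kernel p))

variable (M : Type u) [Category.{v} M] [HasZeroMorphisms M] [HasZeroObject M] [HasCokernels M]
  [ModelCategory M]

/-- The cofibrations `X ⟶ CX` where `X` is cofibrant and `CX ⟶ 0` is a weak equivalence. -/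
def isCone : ObjectProperty (Arrow M) := fun i =>
  IsCofibrant i.left ∧ Cofibration i.hom ∧ WeakEquivalence (0 : i.right ⟶ (0 : M))

/-- `S : Ho(M) ⥤ Ho(M)` is the suspension functor of the pointed model category `M`: naturally in
the cofibration `X ⟶ CX`, where `X` is cofibrant and `CX` is weakly contractible,
`S X` is isomorphic to the quotient `CX/X` in `Ho(M)`. -/
def IsSuspensionFunctor
    (S : (weakEquivalences M).Localization ⥤ (weakEquivalences M).Localization) : Prop :=
  Nonempty (((isCone M).ι ⋙ Arrow.leftFunc) ⋙ (weakEquivalences M).Q ⋙ S ≅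
    ((isCone M).ι ⋙ coker M) ⋙ (weakEquivalences M).Q)

/-- A pointed model category is stable if its suspension functor is an equivalence of
categories. -/
def IsStableModelCategory : Prop :=
  ∃ S : (weakEquivalences M).Localization ⥤ (weakEquivalences M).Localization,
    IsSuspensionFunctor M S ∧ S.IsEquivalence

end Model

/-- The abelian model structure with classes of cofibrant, trivial and fibrant objects
`Cof`, `Triv` and `Fib` exists and is stable. -/
def HasStableAbelianModelStructure (A : Type u) [Category.{v} A] [Abelian A]
    (Cof Triv Fib : ObjectProperty A) : Prop :=
  ∃ M : ModelCategory A, IsAbelianModelStructure M Cof Triv Fib ∧ IsStableModelCategory A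

end CotorsionTriples

end

noncomputable section

namespace CotorsionTriples

/-! ### Consequences of the axioms of right triangulated categories -/

section RightTriangulated

variable {T : Type u} [Category.{v} T] [Preadditive T] [HasZeroObject T]

/-! Everything rests on the stable category `A/C` of an additive class `C`. Write `X ⟶ C^X` and `C_Z
⟶ Z` for left and right `C`-approximations. Adding `X ⟶ C^X` as a second component turns any `f : X
⟶ Y` into a `C`-monic morphism `X ⟶ Y ⊞ C^X`, and `Y ⊞ C^X` is stably isomorphic to `Y`. So cones
are cokernels of `C`-monic morphisms, and each axiom of a right triangulation becomes a computation
with cokernels in `A`, up to morphisms factoring through `C`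
(`stableRightTriangles_isRightTriangulated`). Left triangles are dual. Morphisms `Σ X ⟶ N` and `X ⟶
Ω N` correspond when one morphism `C^X ⟶ C_N` induces both, up to a sign; this yields the adjunction
and the gluing conditions (`isPretriangulated_stable`).

In a cotorsion triple, `Z` is both a right class and a left class. Hence it contains all projectives
and all injectives, and heredity closes it under kernels of epimorphisms and cokernels of
monomorphisms. An object of `X ∩ Z` is then projective: an epimorphism onto it from a projective has
kernel in `Z = X⊥`, so it splits. Dually, objects of `Z ∩ Y` are injective. So an object `M` of `X`
has a sequence `M ⟶ E ⟶ L` with `L` in `X` and `E` projective, and `X` behaves like a Frobenius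
category whose projective-injectives are the projectives of `A` (`isFrobeniusSubcategory_left`).
Consequently `Σ` restricts to an autoequivalence of `X/P`, and a right triangulated category with
invertible suspension is triangulated. The same applies to `Y/I`. For the torsion pair in `A/P`, a
sequence `M ⟶ E ⟶ L` with `E` in `Z` and `L` in `X` is rotated against `K ⟶ P ⟶ L`, `P` projective,
into `K ⟶ M ⊞ P ⟶ E`, which induces a left and a right triangle.

For the projective model structure, the weak equivalences are taken to be the morphisms that are
bijective on stable morphisms out of objects of `X`, so that two-out-of-three is automatic. The crux
is `epiWith_inf_stableEquivalences`: among epimorphisms these are exactly the ones with kernel in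
`Z`. The pairs (`X`, `Z`) and (projectives, all objects) give the weak factorization systems, and a
retract argument identifies the trivial cofibrations. As `X/P` is coreflective in `A/P`, which is
itself a localization of `A`, the homotopy category is `X/P`. A cone on a cofibrant object is a left
approximation by a projective, so its cokernel computes `Σ`, and stability is the invertibility of
`Σ` on `X/P`. In the injective case `Y/I` is reflective and a cone need only lie in `Z`; its
cokernel agrees with `Σ` after reflection, because stable morphisms from `Z` to `Y` vanish and `Σ`
is left adjoint to `Ω`. -/

/-- The axioms of right triangulated categories, without the octahedron axiom. -/
structure IsPreRightTriangulated (Si : T ⥤ T) (Nab : Set (RightTriangle Si)) : Prop where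
  additive : Si.Additive
  isomorphic : ∀ S S' : RightTriangle Si, S.IsIsomorphic S' → S ∈ Nab → S' ∈ Nab
  contractible : ∀ M : T,
    RightTriangle.mk (0 : 0 ⟶ M) (𝟙 M) (0 : M ⟶ Si.obj 0) ∈ Nab
  exists_triangle : ∀ {X Y : T} (f : X ⟶ Y), ∃ (Z : T) (g : Y ⟶ Z) (h : Z ⟶ Si.obj X),
    RightTriangle.mk f g h ∈ Nab
  rotate : ∀ {X Y Z : T} (f : X ⟶ Y) (g : Y ⟶ Z) (h : Z ⟶ Si.obj X),
    RightTriangle.mk f g h ∈ Nab → RightTriangle.mk g h (-Si.map f) ∈ Nab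
  complete_morphism : ∀ {X Y Z X' Y' Z' : T}
    (f : X ⟶ Y) (g : Y ⟶ Z) (h : Z ⟶ Si.obj X)
    (f' : X' ⟶ Y') (g' : Y' ⟶ Z') (h' : Z' ⟶ Si.obj X'),
    RightTriangle.mk f g h ∈ Nab → RightTriangle.mk f' g' h' ∈ Nab →
    ∀ (a : X ⟶ X') (b : Y ⟶ Y'), f ≫ b = a ≫ f' →
      ∃ c : Z ⟶ Z', g ≫ c = b ≫ g' ∧ h ≫ Si.map a = c ≫ h'

variable {Si : T ⥤ T} {Nab : Set (RightTriangle Si)}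

lemma IsRightTriangulated.isPreRightTriangulated (H : IsRightTriangulated Si Nab) :
    IsPreRightTriangulated Si Nab where
  additive := H.additive
  isomorphic := H.isomorphic
  contractible := H.contractible
  exists_triangle := H.exists_triangle
  rotate := H.rotate
  complete_morphism := H.complete_morphism

namespace IsPreRightTriangulated

variable (H : IsPreRightTriangulated Si Nab)
include H

lemma mem_of_iso {X Y Z X' Y' Z' : T} {f : X ⟶ Y} {g : Y ⟶ Z} {h : Z ⟶ Si.obj X}
    (hT : RightTriangle.mk f g h ∈ Nab)
    {f' : X' ⟶ Y'} {g' : Y' ⟶ Z'} {h' : Z' ⟶ Si.obj X'}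
    (e₁ : X ≅ X') (e₂ : Y ≅ Y') (e₃ : Z ≅ Z') (h₁ : f ≫ e₂.hom = e₁.hom ≫ f')
    (h₂ : g ≫ e₃.hom = e₂.hom ≫ g') (h₃ : h ≫ Si.map e₁.hom = e₃.hom ≫ h') :
    RightTriangle.mk f' g' h' ∈ Nab :=
  H.isomorphic (RightTriangle.mk f g h) _ ⟨e₁, e₂, e₃, h₁, h₂, h₃⟩ hT

lemma mem_of_iso₃ {X Y Z Z' : T} {f : X ⟶ Y} {g : Y ⟶ Z} {h : Z ⟶ Si.obj X}
    (hT : RightTriangle.mk f g h ∈ Nab) {g' : Y ⟶ Z'} {h' : Z' ⟶ Si.obj X} (e : Z ≅ Z')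
    (h₂ : g ≫ e.hom = g') (h₃ : h = e.hom ≫ h') :
    RightTriangle.mk f g' h' ∈ Nab :=
  H.mem_of_iso hT (Iso.refl _) (Iso.refl _) e (by simp) (by simp [h₂]) (by simpa using h₃)

/-- Compare with the contractible triangle on `W`, whose first object is zero: `f ≫ φ = 0` is the
commutativity that the filler axiom needs. So `g` is a weak cokernel of `f`. -/
lemma exists_desc₂ {X Y Z : T} {f : X ⟶ Y} {g : Y ⟶ Z} {h : Z ⟶ Si.obj X}
    (hT : RightTriangle.mk f g h ∈ Nab) {W : T} (φ : Y ⟶ W) (hφ : f ≫ φ = 0) :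
    ∃ ψ : Z ⟶ W, g ≫ ψ = φ := by
  obtain ⟨c, hc, -⟩ := H.complete_morphism _ _ _ _ _ _ hT (H.contractible W) 0 φ (by simp [hφ])
  exact ⟨c, by simpa using hc⟩

lemma exists_desc₃ {X Y Z : T} {f : X ⟶ Y} {g : Y ⟶ Z} {h : Z ⟶ Si.obj X}
    (hT : RightTriangle.mk f g h ∈ Nab) {W : T} (φ : Z ⟶ W) (hφ : g ≫ φ = 0) :
    ∃ ψ : Si.obj X ⟶ W, h ≫ ψ = φ :=
  H.exists_desc₂ (H.rotate _ _ _ hT) φ hφ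

/-- Triangles cannot be rotated backwards, so the usual five lemma is not available. Instead `u - 𝟙`
kills `g`, hence factors through `h`, and `u ≫ h = h` then makes its square zero. Thus `u` is
unipotent, with inverse `2 - u`. -/
lemma isIso_of_endo {X Y Z : T} {f : X ⟶ Y} {g : Y ⟶ Z} {h : Z ⟶ Si.obj X}
    (hT : RightTriangle.mk f g h ∈ Nab) (u : Z ⟶ Z) (h₁ : g ≫ u = g) (h₂ : u ≫ h = h) :
    IsIso u := by
  obtain ⟨ψ, hψ⟩ := H.exists_desc₃ hT (u - 𝟙 Z) (by simp [h₁])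
  have h0 : (u - 𝟙 Z) ≫ (u - 𝟙 Z) = 0 := by
    nth_rw 2 [← hψ]
    rw [← Category.assoc, Preadditive.sub_comp, h₂, Category.id_comp, sub_self, zero_comp]
  simp only [Preadditive.sub_comp, Preadditive.comp_sub, Category.comp_id, Category.id_comp] at h0
  have h1 : u ≫ u = u + u - 𝟙 Z := by rw [← sub_eq_zero, ← h0]; abel
  refine ⟨𝟙 Z + 𝟙 Z - u, ?_, ?_⟩ <;>
  · simp only [Preadditive.sub_comp, Preadditive.comp_sub, Preadditive.add_comp,
      Preadditive.comp_add, Category.comp_id, Category.id_comp, h1]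
    abel

/-- Fillers in both directions compose to endomorphisms fixing the adjacent maps, which are
invertible by `isIso_of_endo`. So cones are unique up to an isomorphism compatible with both
structure maps. -/
lemma exists_iso {X Y Z Z' : T} {f : X ⟶ Y} {g : Y ⟶ Z} {h : Z ⟶ Si.obj X}
    {g' : Y ⟶ Z'} {h' : Z' ⟶ Si.obj X}
    (hT : RightTriangle.mk f g h ∈ Nab) (hT' : RightTriangle.mk f g' h' ∈ Nab) :
    ∃ e : Z ≅ Z', g ≫ e.hom = g' ∧ e.hom ≫ h' = h := by
  obtain ⟨c, hc₁, hc₂⟩ := H.complete_morphism _ _ _ _ _ _ hT hT' (𝟙 X) (𝟙 Y) (by simp)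
  obtain ⟨d, hd₁, hd₂⟩ := H.complete_morphism _ _ _ _ _ _ hT' hT (𝟙 X) (𝟙 Y) (by simp)
  simp only [Category.id_comp, CategoryTheory.Functor.map_id, Category.comp_id] at hc₁ hc₂ hd₁ hd₂
  have h₁ := H.isIso_of_endo hT (c ≫ d) (by rw [← Category.assoc, hc₁, hd₁])
    (by rw [Category.assoc, ← hd₂, ← hc₂])
  have h₂ := H.isIso_of_endo hT' (d ≫ c) (by rw [← Category.assoc, hd₁, hc₁])
    (by rw [Category.assoc, ← hc₂, ← hd₂])
  have : IsIso c := by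
    have : Mono c := mono_of_mono c d
    have : IsSplitEpi c := IsSplitEpi.mk' ⟨inv (d ≫ c) ≫ d, by simp⟩
    exact isIso_of_mono_of_isSplitEpi c
  exact ⟨asIso c, hc₁, hc₂.symm⟩

/-- In order to prove the octahedron axiom, it suffices to do so for one choice of cones,
and up to isomorphism. -/
lemma isRightTriangulated
    (hO : ∀ {X Y Z : T} (f : X ⟶ Y) (g : Y ⟶ Z), ∃ (X' Y' Z' F G H : T)
      (eX : X' ≅ X) (eY : Y' ≅ Y) (eZ : Z' ≅ Z) (f' : X' ⟶ Y') (g' : Y' ⟶ Z')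
      (a : Y' ⟶ F) (h₁ : F ⟶ Si.obj X') (b : Z' ⟶ G) (h₂ : G ⟶ Si.obj Y')
      (c : Z' ⟶ H) (h₃ : H ⟶ Si.obj X') (m : F ⟶ H) (n : H ⟶ G),
      f' ≫ eY.hom = eX.hom ≫ f ∧ g' ≫ eZ.hom = eY.hom ≫ g ∧
      RightTriangle.mk f' a h₁ ∈ Nab ∧ RightTriangle.mk g' b h₂ ∈ Nab ∧
      RightTriangle.mk (f' ≫ g') c h₃ ∈ Nab ∧ RightTriangle.mk m n (h₂ ≫ Si.map a) ∈ Nab ∧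
        a ≫ m = g' ≫ c ∧ c ≫ n = b ∧ m ≫ h₃ = h₁ ∧ n ≫ h₂ = h₃ ≫ Si.map f') :
    IsRightTriangulated Si Nab where
  additive := H.additive
  isomorphic := H.isomorphic
  contractible := H.contractible
  exists_triangle := H.exists_triangle
  rotate := H.rotate
  complete_morphism := H.complete_morphism
  octahedron {X Y Z F G K} f g a h₁ b h₂ c h₃ t₁ t₂ t₃ := by
    obtain ⟨X', Y', Z', F', G', K', eX, eY, eZ, f', g', a', h₁', b', h₂', c', h₃', m, n,
      wf, wg, t₁', t₂', t₃', t, w₁, w₂, w₃, w₄⟩ := hO f g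
    have wfg : (f' ≫ g') ≫ eZ.hom = eX.hom ≫ f ≫ g := by
      rw [Category.assoc, wg, ← Category.assoc, wf, Category.assoc]
    -- Each chosen cone is transported to the given objects and then compared with the given cone by
    -- uniqueness. The octahedral morphisms are `m` and `n` conjugated by these comparisons.
    obtain ⟨φF, hF₁, hF₂⟩ := H.exists_iso (H.mem_of_iso t₁' (f' := f) (g' := eY.inv ≫ a')
      (h' := h₁' ≫ Si.map eX.hom) eX eY (Iso.refl _) wf (by simp) (by simp)) t₁
    obtain ⟨φG, hG₁, hG₂⟩ := H.exists_iso (H.mem_of_iso t₂' (f' := g) (g' := eZ.inv ≫ b')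
      (h' := h₂' ≫ Si.map eY.hom) eY eZ (Iso.refl _) wg (by simp) (by simp)) t₂
    obtain ⟨φH, hH₁, hH₂⟩ := H.exists_iso (H.mem_of_iso t₃' (f' := f ≫ g) (g' := eZ.inv ≫ c')
      (h' := h₃' ≫ Si.map eX.hom) eX eZ (Iso.refl _) wfg (by simp) (by simp)) t₃
    refine ⟨φF.inv ≫ m ≫ φH.hom, φH.inv ≫ n ≫ φG.hom, ?_, ?_, ?_, ?_, ?_⟩
    · refine H.mem_of_iso t φF φH φG (by simp) (by simp) ?_
      rw [← Category.assoc φG.hom, hG₂, ← hF₁]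
      simp only [Category.assoc, ← Functor.map_comp, Iso.hom_inv_id_assoc]
    · rw [← hF₁, ← hH₁]
      simp only [Category.assoc, Iso.hom_inv_id_assoc]
      rw [reassoc_of% w₁]
      simp only [← Category.assoc]
      congr 2
      rw [Iso.inv_comp_eq, ← Category.assoc, ← wg]
      simp
    · rw [← hH₁, ← hG₁, ← w₂]
      simp
    · simp only [Category.assoc]
      rw [hH₂, reassoc_of% w₃, Iso.inv_comp_eq, hF₂]
    · simp only [Category.assoc]
      rw [hG₂, reassoc_of% w₄, Iso.inv_comp_eq, reassoc_of% hH₂,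
        ← Functor.map_comp, ← Functor.map_comp, wf]

end IsPreRightTriangulated

end RightTriangulated

/-! ### Consequences of the axioms of left triangulated categories -/

section LeftTriangulated

variable {T : Type u} [Category.{v} T] [Preadditive T] [HasZeroObject T]

/-- The axioms of left triangulated categories, without the octahedron axiom. -/
structure IsPreLeftTriangulated (Om : T ⥤ T) (Del : Set (LeftTriangle Om)) : Prop where
  additive : Om.Additive
  isomorphic : ∀ S S' : LeftTriangle Om, S.IsIsomorphic S' → S ∈ Del → S' ∈ Del
  contractible : ∀ M : T,
    LeftTriangle.mk (0 : Om.obj 0 ⟶ M) (𝟙 M) (0 : M ⟶ 0) ∈ Del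
  exists_triangle : ∀ {Y Z : T} (f : Y ⟶ Z), ∃ (X : T) (h : Om.obj Z ⟶ X) (g : X ⟶ Y),
    LeftTriangle.mk h g f ∈ Del
  rotate : ∀ {X Y Z : T} (h : Om.obj Z ⟶ X) (g : X ⟶ Y) (f : Y ⟶ Z),
    LeftTriangle.mk h g f ∈ Del → LeftTriangle.mk (-Om.map f) h g ∈ Del
  complete_morphism : ∀ {X Y Z X' Y' Z' : T}
    (h : Om.obj Z ⟶ X) (g : X ⟶ Y) (f : Y ⟶ Z)
    (h' : Om.obj Z' ⟶ X') (g' : X' ⟶ Y') (f' : Y' ⟶ Z'),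
    LeftTriangle.mk h g f ∈ Del → LeftTriangle.mk h' g' f' ∈ Del →
    ∀ (b : Y ⟶ Y') (c : Z ⟶ Z'), f ≫ c = b ≫ f' →
      ∃ a : X ⟶ X', g ≫ b = a ≫ g' ∧ h ≫ a = Om.map c ≫ h'

variable {Om : T ⥤ T} {Del : Set (LeftTriangle Om)}

namespace IsPreLeftTriangulated

variable (H : IsPreLeftTriangulated Om Del)
include H

lemma mem_of_iso {X Y Z X' Y' Z' : T} {h : Om.obj Z ⟶ X} {g : X ⟶ Y} {f : Y ⟶ Z}
    (hT : LeftTriangle.mk h g f ∈ Del)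
    {h' : Om.obj Z' ⟶ X'} {g' : X' ⟶ Y'} {f' : Y' ⟶ Z'}
    (e₁ : X ≅ X') (e₂ : Y ≅ Y') (e₃ : Z ≅ Z') (h₁ : h ≫ e₁.hom = Om.map e₃.hom ≫ h')
    (h₂ : g ≫ e₂.hom = e₁.hom ≫ g') (h₃ : f ≫ e₃.hom = e₂.hom ≫ f') :
    LeftTriangle.mk h' g' f' ∈ Del :=
  H.isomorphic (LeftTriangle.mk h g f) _ ⟨e₁, e₂, e₃, h₁, h₂, h₃⟩ hT

lemma exists_lift₂ {X Y Z : T} {h : Om.obj Z ⟶ X} {g : X ⟶ Y} {f : Y ⟶ Z}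
    (hT : LeftTriangle.mk h g f ∈ Del) {W : T} (φ : W ⟶ Y) (hφ : φ ≫ f = 0) :
    ∃ ψ : W ⟶ X, ψ ≫ g = φ := by
  obtain ⟨c, hc, -⟩ := H.complete_morphism _ _ _ _ _ _ (H.contractible W) hT φ 0 (by simp [hφ])
  exact ⟨c, by simpa using hc.symm⟩

lemma exists_lift₁ {X Y Z : T} {h : Om.obj Z ⟶ X} {g : X ⟶ Y} {f : Y ⟶ Z}
    (hT : LeftTriangle.mk h g f ∈ Del) {W : T} (φ : W ⟶ X) (hφ : φ ≫ g = 0) :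
    ∃ ψ : W ⟶ Om.obj Z, ψ ≫ h = φ :=
  H.exists_lift₂ (H.rotate _ _ _ hT) φ hφ

/-- Dual to the case of right triangles: `u - 𝟙` now factors through `h` on the other side, and
again squares to zero. -/
lemma isIso_of_endo {X Y Z : T} {h : Om.obj Z ⟶ X} {g : X ⟶ Y} {f : Y ⟶ Z}
    (hT : LeftTriangle.mk h g f ∈ Del) (u : X ⟶ X) (h₁ : u ≫ g = g) (h₂ : h ≫ u = h) :
    IsIso u := by
  obtain ⟨ψ, hψ⟩ := H.exists_lift₁ hT (u - 𝟙 X) (by simp [h₁])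
  have h0 : (u - 𝟙 X) ≫ (u - 𝟙 X) = 0 := by
    nth_rw 1 [← hψ]
    rw [Category.assoc, Preadditive.comp_sub, h₂, Category.comp_id, sub_self, comp_zero]
  simp only [Preadditive.sub_comp, Preadditive.comp_sub, Category.comp_id, Category.id_comp] at h0
  have h1 : u ≫ u = u + u - 𝟙 X := by rw [← sub_eq_zero, ← h0]; abel
  refine ⟨𝟙 X + 𝟙 X - u, ?_, ?_⟩ <;>
  · simp only [Preadditive.sub_comp, Preadditive.comp_sub, Preadditive.add_comp,
      Preadditive.comp_add, Category.comp_id, Category.id_comp, h1]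
    abel

lemma exists_iso {X X' Y Z : T} {h : Om.obj Z ⟶ X} {g : X ⟶ Y} {f : Y ⟶ Z}
    {h' : Om.obj Z ⟶ X'} {g' : X' ⟶ Y}
    (hT : LeftTriangle.mk h g f ∈ Del) (hT' : LeftTriangle.mk h' g' f ∈ Del) :
    ∃ e : X ≅ X', e.hom ≫ g' = g ∧ h ≫ e.hom = h' := by
  obtain ⟨c, hc₁, hc₂⟩ := H.complete_morphism _ _ _ _ _ _ hT hT' (𝟙 Y) (𝟙 Z) (by simp)
  obtain ⟨d, hd₁, hd₂⟩ := H.complete_morphism _ _ _ _ _ _ hT' hT (𝟙 Y) (𝟙 Z) (by simp)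
  simp only [Category.id_comp, CategoryTheory.Functor.map_id, Category.comp_id] at hc₁ hc₂ hd₁ hd₂
  have h₁ := H.isIso_of_endo hT (c ≫ d) (by rw [Category.assoc, ← hd₁, ← hc₁])
    (by rw [← Category.assoc, hc₂, hd₂])
  have h₂ := H.isIso_of_endo hT' (d ≫ c) (by rw [Category.assoc, ← hc₁, ← hd₁])
    (by rw [← Category.assoc, hd₂, hc₂])
  have : IsIso c := by
    have : Mono c := mono_of_mono c d
    have : IsSplitEpi c := IsSplitEpi.mk' ⟨inv (d ≫ c) ≫ d, by simp⟩
    exact isIso_of_mono_of_isSplitEpi c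
  exact ⟨asIso c, hc₁.symm, hc₂⟩

/-- In order to prove the octahedron axiom, it suffices to do so for one choice of cocones,
and up to isomorphism. -/
lemma isLeftTriangulated
    (hO : ∀ {X Y Z : T} (f : X ⟶ Y) (g : Y ⟶ Z), ∃ (X' Y' Z' F G H : T)
      (eX : X' ≅ X) (eY : Y' ≅ Y) (eZ : Z' ≅ Z) (f' : X' ⟶ Y') (g' : Y' ⟶ Z')
      (h₁ : Om.obj Y' ⟶ F) (a : F ⟶ X') (h₂ : Om.obj Z' ⟶ G) (b : G ⟶ Y')
      (h₃ : Om.obj Z' ⟶ H) (c : H ⟶ X') (m : F ⟶ H) (n : H ⟶ G),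
      f' ≫ eY.hom = eX.hom ≫ f ∧ g' ≫ eZ.hom = eY.hom ≫ g ∧
      LeftTriangle.mk h₁ a f' ∈ Del ∧ LeftTriangle.mk h₂ b g' ∈ Del ∧
      LeftTriangle.mk h₃ c (f' ≫ g') ∈ Del ∧ LeftTriangle.mk (Om.map b ≫ h₁) m n ∈ Del ∧
        m ≫ c = a ∧ n ≫ b = c ≫ f' ∧ h₃ ≫ n = h₂ ∧ h₁ ≫ m = Om.map g' ≫ h₃) :
    IsLeftTriangulated Om Del where
  additive := H.additive
  isomorphic := H.isomorphic
  contractible := H.contractible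
  exists_triangle := H.exists_triangle
  rotate := H.rotate
  complete_morphism := H.complete_morphism
  octahedron {X Y Z F G K} f g h₁ a h₂ b h₃ c t₁ t₂ t₃ := by
    obtain ⟨X', Y', Z', F', G', K', eX, eY, eZ, f', g', h₁', a', h₂', b', h₃', c', m, n,
      wf, wg, t₁', t₂', t₃', t, w₁, w₂, w₃, w₄⟩ := hO f g
    have wfg : (f' ≫ g') ≫ eZ.hom = eX.hom ≫ f ≫ g := by
      rw [Category.assoc, wg, ← Category.assoc, wf, Category.assoc]
    obtain ⟨φF, hF₁, hF₂⟩ := H.exists_iso (H.mem_of_iso t₁' (f' := f) (g' := a' ≫ eX.hom)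
      (h' := Om.map eY.inv ≫ h₁') (Iso.refl _) eX eY (by simp [← Functor.map_comp_assoc])
      (by simp) wf) t₁
    obtain ⟨φG, hG₁, hG₂⟩ := H.exists_iso (H.mem_of_iso t₂' (f' := g) (g' := b' ≫ eY.hom)
      (h' := Om.map eZ.inv ≫ h₂') (Iso.refl _) eY eZ (by simp [← Functor.map_comp_assoc])
      (by simp) wg) t₂
    obtain ⟨φH, hH₁, hH₂⟩ := H.exists_iso (H.mem_of_iso t₃' (f' := f ≫ g) (g' := c' ≫ eX.hom)
      (h' := Om.map eZ.inv ≫ h₃') (Iso.refl _) eX eZ (by simp [← Functor.map_comp_assoc])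
      (by simp) wfg) t₃
    refine ⟨φF.inv ≫ m ≫ φH.hom, φH.inv ≫ n ≫ φG.hom, ?_, ?_, ?_, ?_, ?_⟩
    · refine H.mem_of_iso t φF φH φG ?_ (by simp) (by simp)
      rw [← hF₂, ← Category.assoc (Om.map φG.hom), ← Functor.map_comp, hG₁]
      simp [← Functor.map_comp_assoc]
    · simp only [Category.assoc]
      rw [hH₁, reassoc_of% w₁, Iso.inv_comp_eq, hF₁]
    · simp only [Category.assoc]
      rw [hG₁, reassoc_of% w₂, Iso.inv_comp_eq, reassoc_of% hH₁, wf]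
    · rw [← hH₂, ← hG₂, ← w₃]
      simp
    · rw [← hF₂, ← hH₂]
      simp only [Category.assoc, Iso.hom_inv_id_assoc]
      rw [reassoc_of% w₄]
      simp only [← Category.assoc, ← Functor.map_comp]
      congr 3
      rw [Iso.inv_comp_eq, ← Category.assoc, ← wg]
      simp

end IsPreLeftTriangulated

end LeftTriangulated

/-! ### Shifts by integers defined by an autoequivalence -/

section Shift

variable {T : Type u} [Category.{v} T]

/-- A sequence of objects `X n`, indexed by the integers, with isomorphisms `Si (X n) ≅ X (n + 1)`.
-/
structure SuspensionSequence (Si : T ⥤ T) where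
  X : ℤ → T
  σ : ∀ n m : ℤ, n + 1 = m → (Si.obj (X n) ≅ X m)

namespace SuspensionSequence

variable {Si : T ⥤ T}

/-- Morphisms of sequences are compatible with the structural isomorphisms. -/
@[ext]
structure Hom (K L : SuspensionSequence Si) where
  f : ∀ n, K.X n ⟶ L.X n
  comm : ∀ n m h, (K.σ n m h).hom ≫ f m = Si.map (f n) ≫ (L.σ n m h).hom

instance : Category (SuspensionSequence Si) where
  Hom := Hom
  id K := { f := fun n => 𝟙 _, comm := by simp }
  comp φ ψ :=
    { f := fun n => φ.f n ≫ ψ.f n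
      comm := fun n m h => by
        rw [← Category.assoc, φ.comm, Category.assoc, ψ.comm, Functor.map_comp, Category.assoc] }

@[ext]
lemma hom_ext {K L : SuspensionSequence Si} {φ ψ : K ⟶ L} (h : ∀ n, φ.f n = ψ.f n) : φ = ψ :=
  Hom.ext (funext h)

@[simp]
lemma id_f (K : SuspensionSequence Si) (n : ℤ) : Hom.f (𝟙 K) n = 𝟙 _ := rfl

@[simp]
lemma comp_f {K L M : SuspensionSequence Si} (φ : K ⟶ L) (ψ : L ⟶ M) (n : ℤ) :
    (φ ≫ ψ).f n = φ.f n ≫ ψ.f n := rfl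

/-- Isomorphisms given in each degree. -/
def isoMk {K L : SuspensionSequence Si} (e : ∀ n, K.X n ≅ L.X n)
    (comm : ∀ n m h, (K.σ n m h).hom ≫ (e m).hom = Si.map (e n).hom ≫ (L.σ n m h).hom) :
    K ≅ L where
  hom := ⟨fun n => (e n).hom, comm⟩
  inv := ⟨fun n => (e n).inv, fun n m h => by
    rw [← cancel_mono (e m).hom, Category.assoc, Category.assoc, Iso.inv_hom_id, Category.comp_id,
      comm, ← Functor.map_comp_assoc, Iso.inv_hom_id, CategoryTheory.Functor.map_id,
      Category.id_comp]⟩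
  hom_inv_id := by ext; simp
  inv_hom_id := by ext; simp

/-- The evaluation in a given degree. -/
def eval (Si : T ⥤ T) (n : ℤ) : SuspensionSequence Si ⥤ T where
  obj K := K.X n
  map φ := φ.f n

/-- The reindexation of sequences. -/
def reindex (Si : T ⥤ T) (k : ℤ) : SuspensionSequence Si ⥤ SuspensionSequence Si where
  obj K :=
    { X := fun n => K.X (n + k)
      σ := fun n m h => K.σ (n + k) (m + k) (by lia) }
  map φ :=
    { f := fun n => φ.f (n + k)
      comm := fun n m h => φ.comm _ _ _ }

/-- Reindexing produces degrees that are equal only propositionally. This lemma and `f_eqToHom` move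
structural isomorphisms and components past the transports. -/
lemma σ_hom_eqToHom (K : SuspensionSequence Si) {n m n' m' : ℤ} (h : n + 1 = m) (hn : n = n')
    (hm : m = m') :
    (K.σ n m h).hom ≫ eqToHom (by rw [hm]) =
      Si.map (eqToHom (by rw [hn])) ≫ (K.σ n' m' (by lia)).hom := by
  subst hn hm
  simp

lemma f_eqToHom {K L : SuspensionSequence Si} (φ : K ⟶ L) {n n' : ℤ} (hn : n = n') :
    φ.f n ≫ eqToHom (by rw [hn]) = eqToHom (by rw [hn]) ≫ φ.f n' := by
  subst hn
  simp

lemma eqToHom_f {K L : SuspensionSequence Si} (h : K = L) (n : ℤ) :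
    Hom.f (eqToHom h) n = eqToHom (by rw [h]) := by
  subst h
  rfl

/-- The reason for passing to sequences: here shifting is reindexing, all coherence isomorphisms are
`eqToHom`s, and the axioms of a shift reduce to `eqToHom_trans`. Iterating `Si` and a quasi-inverse
directly would require genuine coherence proofs. -/
instance : HasShift (SuspensionSequence Si) ℤ :=
  hasShiftMk _ _
    { F := reindex Si
      zero := NatIso.ofComponents (fun K => isoMk
        (fun n => eqToIso (congr_arg K.X (add_zero n)))
        (fun _ _ h => K.σ_hom_eqToHom (by lia) (add_zero _) (add_zero _))) (fun φ => by
          ext n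
          exact f_eqToHom φ (add_zero n))
      add := fun a b => NatIso.ofComponents (fun K => isoMk
        (fun n => eqToIso (congr_arg K.X (show n + (a + b) = n + b + a by lia)))
        (fun _ _ h => K.σ_hom_eqToHom (by lia) (by lia) (by lia))) (fun φ => by
          ext n
          exact f_eqToHom φ (by lia))
      assoc_hom_app := fun a b c K => by
        ext n
        simp only [comp_f, eqToHom_f]
        change eqToHom (congr_arg K.X (show n + (a + b + c) = n + c + (a + b) by lia)) ≫
            eqToHom (congr_arg K.X (show n + c + (a + b) = n + c + b + a by lia)) =
          eqToHom (congr_arg K.X (show n + (a + b + c) = n + (a + (b + c)) by lia)) ≫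
            eqToHom (congr_arg K.X (show n + (a + (b + c)) = n + (b + c) + a by lia)) ≫
            eqToHom (congr_arg K.X (show n + (b + c) + a = n + c + b + a by lia))
        simp only [eqToHom_trans]
      zero_add_hom_app := fun a K => by
        ext n
        simp only [comp_f, eqToHom_f]
        change eqToHom (congr_arg K.X (show n + (0 + a) = n + a + 0 by lia)) =
          eqToHom (congr_arg K.X (show n + (0 + a) = n + a by lia)) ≫
            eqToHom (congr_arg K.X (show n + a = n + a + 0 by lia))
        simp only [eqToHom_trans]
      add_zero_hom_app := fun a K => by
        ext n
        simp only [comp_f, eqToHom_f]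
        change eqToHom (congr_arg K.X (show n + (a + 0) = n + 0 + a by lia)) =
          eqToHom (congr_arg K.X (show n + (a + 0) = n + a by lia)) ≫
            eqToHom (congr_arg K.X (show n + a = n + 0 + a by lia))
        simp only [eqToHom_trans] }

section

variable [Si.IsEquivalence]

/-- The iterations of `Si`. -/
def iterate (Si : T ⥤ T) (M : T) : ℕ → T
  | 0 => M
  | k + 1 => Si.obj (iterate Si M k)

/-- The sequence with a given object in degree zero. -/
def objOfZero (Si : T ⥤ T) [Si.IsEquivalence] (M : T) : ℤ → T
  | .ofNat k => iterate Si M k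
  | .negSucc k => iterate Si.inv M (k + 1)

/-- The structural isomorphisms of the sequence with a given object in degree zero. -/
def isoOfZero (M : T) : ∀ n : ℤ, Si.obj (objOfZero Si M n) ≅ objOfZero Si M (n + 1)
  | .ofNat _ => Iso.refl _
  | .negSucc 0 => Si.asEquivalence.counitIso.app M
  | .negSucc (k + 1) => Si.asEquivalence.counitIso.app (iterate Si.inv M (k + 1))

/-- The sequence with a given object in degree zero. -/
def ofZero (M : T) : SuspensionSequence Si where
  X := objOfZero Si M
  σ n m h := isoOfZero M n ≪≫ eqToIso (by rw [h])

/-- The components in nonnegative degrees of a morphism of sequences. -/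
def homOfZeroPos {K L : SuspensionSequence Si} (f : K.X 0 ⟶ L.X 0) :
    ∀ k : ℕ, K.X (.ofNat k) ⟶ L.X (.ofNat k)
  | 0 => f
  | k + 1 => (K.σ (.ofNat k) (.ofNat (k + 1)) rfl).inv ≫
      Si.map (homOfZeroPos f k) ≫ (L.σ (.ofNat k) (.ofNat (k + 1)) rfl).hom

/-- The components in negative degrees of a morphism of sequences. -/
def homOfZeroNeg {K L : SuspensionSequence Si} (f : K.X 0 ⟶ L.X 0) :
    ∀ k : ℕ, K.X (.negSucc k) ⟶ L.X (.negSucc k)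
  | 0 => Si.preimage ((K.σ (.negSucc 0) 0 rfl).hom ≫ f ≫ (L.σ (.negSucc 0) 0 rfl).inv)
  | k + 1 => Si.preimage ((K.σ (.negSucc (k + 1)) (.negSucc k) rfl).hom ≫
      homOfZeroNeg f k ≫ (L.σ (.negSucc (k + 1)) (.negSucc k) rfl).inv)

/-- The morphism of sequences with a given component in degree zero. -/
def homOfZero {K L : SuspensionSequence Si} (f : K.X 0 ⟶ L.X 0) : ∀ n : ℤ, K.X n ⟶ L.X n
  | .ofNat k => homOfZeroPos f k
  | .negSucc k => homOfZeroNeg f k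

lemma homOfZero_comm {K L : SuspensionSequence Si} (f : K.X 0 ⟶ L.X 0) (n m : ℤ)
    (h : n + 1 = m) :
    (K.σ n m h).hom ≫ homOfZero f m = Si.map (homOfZero f n) ≫ (L.σ n m h).hom := by
  match n, m, h with
  | .ofNat k, m, h =>
    obtain rfl : m = .ofNat (k + 1) := h.symm
    change _ ≫ homOfZeroPos f (k + 1) = Si.map (homOfZeroPos f k) ≫ _
    rw [homOfZeroPos, Iso.hom_inv_id_assoc]
  | .negSucc 0, m, h =>
    obtain rfl : m = 0 := h.symm
    change _ ≫ f = Si.map (homOfZeroNeg f 0) ≫ _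
    rw [homOfZeroNeg, Functor.map_preimage, Category.assoc, Category.assoc, Iso.inv_hom_id,
      Category.comp_id]
  | .negSucc (k + 1), m, h =>
    obtain rfl : m = .negSucc k := h.symm
    change _ ≫ homOfZeroNeg f k = Si.map (homOfZeroNeg f (k + 1)) ≫ _
    rw [homOfZeroNeg, Functor.map_preimage, Category.assoc, Category.assoc, Iso.inv_hom_id,
      Category.comp_id]

/-- A component in degree zero propagates upwards by applying `Si` and downwards because `Si` is
full and faithful. Together with `ofZero`, this makes evaluation in degree zero an equivalence. -/
instance : (eval Si 0).Full where
  map_surjective f := ⟨⟨homOfZero f, homOfZero_comm f⟩, rfl⟩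

instance : (eval Si 0).Faithful where
  map_injective {K L} φ ψ h := by
    have up : ∀ n, φ.f n = ψ.f n → φ.f (n + 1) = ψ.f (n + 1) := fun n hn => by
      rw [← cancel_epi (K.σ n (n + 1) rfl).hom, φ.comm, ψ.comm, hn]
    have down : ∀ n, φ.f (n + 1) = ψ.f (n + 1) → φ.f n = ψ.f n := fun n hn => by
      apply Si.map_injective
      rw [← cancel_mono (L.σ n (n + 1) rfl).hom, ← φ.comm, ← ψ.comm, hn]
    ext n
    induction n using Int.induction_on with
    | zero => exact h
    | succ k hk => exact up _ hk
    | pred k hk => exact down _ (by rwa [Int.sub_add_cancel])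

instance : (eval Si 0).EssSurj where
  mem_essImage M := ⟨ofZero M, ⟨Iso.refl M⟩⟩

instance : (eval Si 0).IsEquivalence where

end

end SuspensionSequence

open SuspensionSequence in
/-- Any autoequivalence is the shift by `1` for a shift by the integers. -/
lemma exists_hasShift (Si : T ⥤ T) [Si.IsEquivalence] :
    ∃ (_ : HasShift T ℤ), Nonempty (shiftFunctor T (1 : ℤ) ≅ Si) := by
  -- The shift of sequences is transported along this equivalence; `s k` is what reindexing by `k`
  -- becomes on `T`, and `i` records the compatibility.
  let F : T ⥤ SuspensionSequence Si := (eval Si 0).inv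
  let s : ℤ → T ⥤ T := fun k => F ⋙ shiftFunctor _ k ⋙ eval Si 0
  let i : ∀ k, s k ⋙ F ≅ F ⋙ shiftFunctor (SuspensionSequence Si) k := fun k =>
    Functor.associator _ _ _ ≪≫ Functor.isoWhiskerLeft F (Functor.associator _ _ _ ≪≫
      Functor.isoWhiskerLeft _ (eval Si 0).asEquivalence.unitIso.symm ≪≫ Functor.rightUnitor _)
  have hF : F.FullyFaithful := Functor.FullyFaithful.ofFullyFaithful F
  refine ⟨hF.hasShift s i, ⟨?_⟩⟩
  -- In degree zero, reindexing by `1` gives `X 1`, which the structural isomorphism identifies with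
  -- `Si (X 0)`.
  let e : shiftFunctor (SuspensionSequence Si) (1 : ℤ) ⋙ eval Si 0 ≅ eval Si 0 ⋙ Si :=
    NatIso.ofComponents (fun K => (K.σ 0 (0 + 1) rfl).symm) (fun {K L} φ => by
      have := φ.comm 0 (0 + 1) rfl
      change φ.f (0 + 1) ≫ (L.σ 0 (0 + 1) rfl).inv = (K.σ 0 (0 + 1) rfl).inv ≫ Si.map (φ.f 0)
      rw [Iso.comp_inv_eq, Category.assoc, ← this, Iso.inv_hom_id_assoc])
  exact Functor.isoWhiskerLeft F e ≪≫ (Functor.associator _ _ _).symm ≪≫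
    Functor.isoWhiskerRight (eval Si 0).asEquivalence.counitIso Si ≪≫ Functor.leftUnitor _

end Shift

/-! ### Triangulated categories from right triangulated categories -/

section

variable {T : Type u} [Category.{v} T] [Preadditive T]

/-- The shift by `-1` is additive as an inverse of an additive equivalence, and every integer shift
is a composite of shifts by `1` and `-1`. -/
lemma shiftFunctor_additive [HasShift T ℤ] (h : (shiftFunctor T (1 : ℤ)).Additive) (n : ℤ) :
    (shiftFunctor T n).Additive := by
  have : (shiftEquiv T (1 : ℤ)).functor.Additive := h
  have h' : (shiftFunctor T (-1 : ℤ)).Additive :=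
    (shiftEquiv T (1 : ℤ)).inverse_additive
  induction n using Int.induction_on with
  | zero => exact Functor.additive_of_iso (shiftFunctorZero T ℤ).symm
  | succ k hk => exact Functor.additive_of_iso (shiftFunctorAdd T (k : ℤ) 1).symm
  | pred k hk => exact Functor.additive_of_iso (shiftFunctorAdd T (-k : ℤ) (-1)).symm

variable [HasZeroObject T] [HasShift T ℤ] {Si : T ⥤ T} {Nab : Set (RightTriangle Si)}

open Pretriangulated

/-- A right triangulated category is triangulated if its suspension functor is the shift functor
by `1` of a shift by the integers. -/
lemma IsRightTriangulated.exists_isTriangulated (H : IsRightTriangulated Si Nab)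
    (e : shiftFunctor T (1 : ℤ) ≅ Si) :
    ∃ (_ : ∀ n : ℤ, (shiftFunctor T n).Additive) (_ : Pretriangulated T) (_ : IsTriangulated T),
      ∀ S : Triangle T, S ∈ distinguishedTriangles ↔
        RightTriangle.mk S.mor₁ S.mor₂ (S.mor₃ ≫ e.hom.app S.obj₁) ∈ Nab := by
  have H' := H.isPreRightTriangulated
  have := H.additive
  have hadd : ∀ n : ℤ, (shiftFunctor T n).Additive :=
    shiftFunctor_additive (Functor.additive_of_iso e.symm)
  have : Si.IsEquivalence := Functor.isEquivalence_of_iso e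
  have iso_mem : ∀ (S S' : Triangle T), (S' ≅ S) →
      RightTriangle.mk S.mor₁ S.mor₂ (S.mor₃ ≫ e.hom.app S.obj₁) ∈ Nab →
      RightTriangle.mk S'.mor₁ S'.mor₂ (S'.mor₃ ≫ e.hom.app S'.obj₁) ∈ Nab := by
    intro S S' i h
    refine H'.mem_of_iso h (Triangle.π₁.mapIso i.symm) (Triangle.π₂.mapIso i.symm)
      (Triangle.π₃.mapIso i.symm) i.inv.comm₁ i.inv.comm₂ ?_
    have := i.inv.comm₃
    simp only [Functor.mapIso_hom, Iso.symm_hom, Triangle.π₁_map, Triangle.π₃_map]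
    rw [Category.assoc, ← e.hom.naturality, reassoc_of% this]
  have rot : ∀ {X Y Z : T} (f : X ⟶ Y) (g : Y ⟶ Z) (h : Z ⟶ X⟦(1 : ℤ)⟧),
      RightTriangle.mk f g (h ≫ e.hom.app X) ∈ Nab ↔
      RightTriangle.mk g h ((-f⟦(1 : ℤ)⟧') ≫ e.hom.app Y) ∈ Nab := by
    intro X Y Z f g h
    have w : (-f⟦(1 : ℤ)⟧') ≫ e.hom.app Y = e.hom.app X ≫ (-Si.map f) := by simp
    have key : RightTriangle.mk g h ((-f⟦(1 : ℤ)⟧') ≫ e.hom.app Y) ∈ Nab ↔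
        RightTriangle.mk g (h ≫ e.hom.app X) (-Si.map f) ∈ Nab :=
      ⟨fun h' => H'.mem_of_iso₃ h' (e.app X) rfl w,
        fun h' => H'.mem_of_iso₃ h' (e.app X).symm (by simp) (by rw [w]; simp)⟩
    rw [key]
    -- Rotating backwards is where invertibility of `Si` is needed. Take a cone of `f`, and rotate
    -- both triangles until they start with `-Si.map f`. Uniqueness of cones gives an isomorphism
    -- `Si Z ≅ Si Z'`, which descends to `Z ≅ Z'` since `Si` is fully faithful.
    refine ⟨H'.rotate _ _ _, fun t' => ?_⟩
    obtain ⟨Z', g', h', t⟩ := H'.exists_triangle f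
    have t₁ := H'.rotate _ _ _ (H'.rotate _ _ _ t')
    have t₂ := H'.rotate _ _ _ (H'.rotate _ _ _ (H'.rotate _ _ _ t))
    obtain ⟨φ, hφ₁, hφ₂⟩ := H'.exists_iso t₁ t₂
    obtain ⟨ψ, rfl⟩ : ∃ ψ : Z ≅ Z', Si.mapIso ψ = φ := ⟨Si.preimageIso φ, by ext; simp⟩
    simp only [Functor.mapIso_hom, Preadditive.neg_comp, neg_inj, ← Functor.map_comp,
      Preadditive.comp_neg] at hφ₁ hφ₂
    exact H'.mem_of_iso₃ t ψ.symm (by simp [← Si.map_injective hφ₁])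
      (by simp [← Si.map_injective hφ₂])
  let P : Pretriangulated T :=
    { distinguishedTriangles := {S | RightTriangle.mk S.mor₁ S.mor₂
        (S.mor₃ ≫ e.hom.app S.obj₁) ∈ Nab}
      isomorphic_distinguished := fun S hS S' i => iso_mem S S' i hS
      contractible_distinguished := fun X => by
        change RightTriangle.mk (𝟙 X) (0 : X ⟶ 0) ((0 : (0 : T) ⟶ X⟦(1 : ℤ)⟧) ≫ e.hom.app X) ∈ Nab
        -- The required triangle is the rotation of the contractible triangle `0 ⟶ X ⟶ X ⟶ Si 0`, in
        -- which `Si 0` is replaced by `0`.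
        have hz : IsZero (Si.obj 0) := Si.map_isZero (isZero_zero T)
        exact H'.mem_of_iso₃ (H'.rotate _ _ _ (H'.contractible X)) (hz.iso (isZero_zero T))
          zero_comp (by simp)
      distinguished_cocone_triangle := fun {X Y} f => by
        obtain ⟨Z, g, h, t⟩ := H'.exists_triangle f
        refine ⟨Z, g, h ≫ e.inv.app X, ?_⟩
        change RightTriangle.mk f g ((h ≫ e.inv.app X) ≫ e.hom.app X) ∈ Nab
        simpa using t
      rotate_distinguished_triangle := fun S => rot S.mor₁ S.mor₂ S.mor₃
      complete_distinguished_triangle_morphism := fun S S' hS hS' a b w => by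
        obtain ⟨c, hc₁, hc₂⟩ := H'.complete_morphism _ _ _ _ _ _ hS hS' a b w
        refine ⟨c, hc₁, ?_⟩
        rw [Category.assoc, ← e.hom.naturality, ← Category.assoc, ← Category.assoc,
          cancel_mono] at hc₂
        exact hc₂ }
  refine ⟨hadd, P, ⟨fun {X₁ X₂ X₃ Z₁₂ Z₂₃ Z₁₃ u₁₂ u₂₃ u₁₃} comm v₁₂ w₁₂ h₁₂ v₂₃ w₂₃ h₂₃
    v₁₃ w₁₃ h₁₃ =>
    ?_⟩, fun _ => Iff.rfl⟩
  subst comm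
  obtain ⟨m, n, t, q₁, q₂, q₃, q₄⟩ := H.octahedron u₁₂ u₂₃ v₁₂ (w₁₂ ≫ e.hom.app X₁) v₂₃
    (w₂₃ ≫ e.hom.app X₂) v₁₃ (w₁₃ ≫ e.hom.app X₁) h₁₂ h₂₃ h₁₃
  refine ⟨⟨m, n, q₁, ?_, q₂, ?_, ?_⟩⟩
  · rwa [← Category.assoc, cancel_mono] at q₃
  · rw [Category.assoc, ← e.hom.naturality, ← Category.assoc, ← Category.assoc, cancel_mono] at q₄
    exact q₄.symm
  · change RightTriangle.mk m n ((w₂₃ ≫ v₁₂⟦1⟧') ≫ e.hom.app _) ∈ Nab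
    have := e.hom.naturality v₁₂
    simpa only [Category.assoc, this] using t

end

/-! ### The right triangulation of a stable category -/

section StableBasic

variable {A : Type u} [Category.{v} A] [Abelian A] (C : ObjectProperty A)

/-- Cokernels are handled as epimorphisms with existence of factorizations, so that the later
computations carry no limit or colimit data. -/
lemma nonempty_isColimit_cokernelCofork_iff {X Y Z : A} {f : X ⟶ Y} {g : Y ⟶ Z}
    (zero : f ≫ g = 0) :
    Nonempty (IsColimit (CokernelCofork.ofπ g zero)) ↔
      Epi g ∧ ∀ ⦃W : A⦄ (φ : Y ⟶ W), f ≫ φ = 0 → ∃ ψ : Z ⟶ W, g ≫ ψ = φ := by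
  constructor
  · rintro ⟨h⟩
    exact ⟨Cofork.IsColimit.epi h, fun W φ hφ =>
      ⟨h.desc (CokernelCofork.ofπ φ hφ), h.fac _ WalkingParallelPair.one⟩⟩
  · rintro ⟨h₁, h₂⟩
    exact ⟨CokernelCofork.IsColimit.ofπ _ _ (fun φ hφ => (h₂ φ hφ).choose)
      (fun φ hφ => (h₂ φ hφ).choose_spec) (fun φ hφ ψ hψ => by
        rw [← cancel_epi g, hψ, (h₂ φ hφ).choose_spec])⟩

lemma nonempty_isLimit_kernelFork_iff {X Y Z : A} {g : X ⟶ Y} {f : Y ⟶ Z}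
    (zero : g ≫ f = 0) :
    Nonempty (IsLimit (KernelFork.ofι g zero)) ↔
      Mono g ∧ ∀ ⦃W : A⦄ (φ : W ⟶ Y), φ ≫ f = 0 → ∃ ψ : W ⟶ X, ψ ≫ g = φ := by
  constructor
  · rintro ⟨h⟩
    exact ⟨Fork.IsLimit.mono h, fun W φ hφ =>
      ⟨h.lift (KernelFork.ofι φ hφ), h.fac _ WalkingParallelPair.zero⟩⟩
  · rintro ⟨h₁, h₂⟩
    exact ⟨KernelFork.IsLimit.ofι _ _ (fun φ hφ => (h₂ φ hφ).choose)
      (fun φ hφ => (h₂ φ hφ).choose_spec) (fun φ hφ ψ hψ => by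
        rw [← cancel_mono g, hψ, (h₂ φ hφ).choose_spec])⟩

variable [IsAdditiveSubcategory C]

variable {C} in
lemma toStable_map_eq_iff {M N : A} (f g : M ⟶ N) :
    (toStable C).map f = (toStable C).map g ↔ stableRel C f g :=
  Quotient.functor_map_eq_iff _ _ _

variable {C} in
lemma toStable_map_eq_zero {M N : A} {f : M ⟶ N} {P : A} (hP : C P) (a : M ⟶ P) (b : P ⟶ N)
    (h : f = a ≫ b) : (toStable C).map f = 0 := by
  rw [← (toStable C).map_zero]
  exact toStable_map_eq P hP a b (by rw [sub_zero, h])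

variable {C} in
lemma exists_factorization_of_toStable_map_eq_zero {M N : A} {f : M ⟶ N}
    (h : (toStable C).map f = 0) : ∃ (P : A) (_ : C P) (a : M ⟶ P) (b : P ⟶ N), f = a ≫ b := by
  rw [← (toStable C).map_zero, toStable_map_eq_iff] at h
  simpa [stableRel] using h

variable {C} in
/-- Adding a summand in `C` does not change an object of the stable category. -/
@[simps]
def stableBiprodIso (M : A) {P : A} (hP : C P) :
    (toStable C).obj (M ⊞ P) ≅ (toStable C).obj M where
  hom := (toStable C).map biprod.fst
  inv := (toStable C).map biprod.inl
  hom_inv_id := by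
    rw [← Functor.map_comp, ← CategoryTheory.Functor.map_id]
    refine toStable_map_eq P hP (-biprod.snd) biprod.inr ?_
    rw [Preadditive.neg_comp, ← biprod.total]
    abel
  inv_hom_id := by
    rw [← Functor.map_comp, biprod.inl_fst, CategoryTheory.Functor.map_id]

end StableBasic

/-! ### Right triangles from cokernels of `C`-monic morphisms -/

section StableRight

variable {A : Type u} [Category.{v} A] [Abelian A] (C : ObjectProperty A)
  [IsAdditiveSubcategory C] [IsCovariantlyFinite C]

lemma exists_cosyzygyπ_desc (X : A) {W : A} (φ : leftApproxObj C X ⟶ W)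
    (hφ : leftApprox C X ≫ φ = 0) : ∃ ψ : cosyzygyObj C X ⟶ W, cosyzygyπ C X ≫ ψ = φ :=
  ⟨cokernel.desc _ φ hφ, cokernel.π_desc _ _ _⟩

instance (X : A) : Epi (cosyzygyπ C X) := inferInstanceAs (Epi (cokernel.π _))

/-- The morphism to `Σ X` in `A/C` given by a morphism to the cokernel of the left
`C`-approximation of `X`. -/
def toSusp {X Z : A} (h : Z ⟶ cosyzygyObj C X) :
    (toStable C).obj Z ⟶ (cosyzygy C).obj ((toStable C).obj X) := (toStable C).map h

variable {C} in
lemma toStable_map_comp_toSusp {X Y Z : A} (c : Y ⟶ Z) (h : Z ⟶ cosyzygyObj C X) :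
    (toStable C).map c ≫ toSusp C h = toSusp C (c ≫ h) := ((toStable C).map_comp c h).symm

variable {C} in
lemma toSusp_comp_cosyzygy_map {X Y Z : A} {f : X ⟶ Y}
    {k : cosyzygyObj C X ⟶ cosyzygyObj C Y} (hk : IsCosyzygyMap C f k)
    (h : Z ⟶ cosyzygyObj C X) :
    toSusp C h ≫ (cosyzygy C).map ((toStable C).map f) = toSusp C (h ≫ k) := by
  rw [cosyzygy_map_eq C hk]
  exact ((toStable C).map_comp h k).symm

variable {C} in
lemma toSusp_eq {X Z : A} {h h' : Z ⟶ cosyzygyObj C X} {P : A} (hP : C P) (a : Z ⟶ P)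
    (b : P ⟶ cosyzygyObj C X) (w : h - h' = a ≫ b) : toSusp C h = toSusp C h' :=
  toStable_map_eq P hP a b w

/-- The diagrams `X ⟶ Y ⟶ Z ⟶ Σ X` in `A` which induce the right triangles of `A/C`. -/
structure IsStandardRightTriangle {X Y Z : A} (f : X ⟶ Y) (g : Y ⟶ Z)
    (h : Z ⟶ cosyzygyObj C X) : Prop where
  zero : f ≫ g = 0
  epi : Epi g
  exists_desc : ∀ ⦃W : A⦄ (φ : Y ⟶ W), f ≫ φ = 0 → ∃ ψ : Z ⟶ W, g ≫ ψ = φ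
  isRelMono : IsRelMono C f
  exists_extension : ∃ l : Y ⟶ leftApproxObj C X, f ≫ l = leftApprox C X ∧
    g ≫ h = l ≫ cosyzygyπ C X

variable {C}

lemma IsStandardRightTriangle.mem {X Y Z : A} {f : X ⟶ Y} {g : Y ⟶ Z} {h : Z ⟶ cosyzygyObj C X}
    (H : IsStandardRightTriangle C f g h) :
    RightTriangle.mk ((toStable C).map f) ((toStable C).map g) (toSusp C h) ∈
      stableRightTriangles C := by
  obtain ⟨l, hl, hl'⟩ := H.exists_extension
  exact ⟨X, Y, Z, f, g, H.zero, (nonempty_isColimit_cokernelCofork_iff _).2 ⟨H.epi, H.exists_desc⟩,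
    H.isRelMono, l, h, hl, hl', Iso.refl _, Iso.refl _, Iso.refl _,
    (Category.comp_id _).trans (Category.id_comp _).symm,
    (Category.comp_id _).trans (Category.id_comp _).symm, by
      rw [Iso.refl_hom, Iso.refl_hom, CategoryTheory.Functor.map_id]
      exact (Category.comp_id _).trans (Category.id_comp _).symm⟩

lemma exists_isStandardRightTriangle {X Y Z : StableCategory C} {f : X ⟶ Y} {g : Y ⟶ Z}
    {h : Z ⟶ (cosyzygy C).obj X} (hT : RightTriangle.mk f g h ∈ stableRightTriangles C) :
    ∃ (X' Y' Z' : A) (f' : X' ⟶ Y') (g' : Y' ⟶ Z') (h' : Z' ⟶ cosyzygyObj C X')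
      (e₁ : (toStable C).obj X' ≅ X) (e₂ : (toStable C).obj Y' ≅ Y) (e₃ : (toStable C).obj Z' ≅ Z),
      IsStandardRightTriangle C f' g' h' ∧ (toStable C).map f' ≫ e₂.hom = e₁.hom ≫ f ∧
        (toStable C).map g' ≫ e₃.hom = e₂.hom ≫ g ∧
        toSusp C h' ≫ (cosyzygy C).map e₁.hom = e₃.hom ≫ h := by
  obtain ⟨X', Y', Z', f', g', zero, hg, hf, l, h', hl, hl', e₁, e₂, e₃, h₁, h₂, h₃⟩ := hT
  rw [nonempty_isColimit_cokernelCofork_iff] at hg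
  exact ⟨X', Y', Z', f', g', h', e₁, e₂, e₃, ⟨zero, hg.1, hg.2, hf, l, hl, hl'⟩, h₁, h₂, h₃⟩

variable (C) in
/-- Any relative monomorphism is part of a standard right triangle. -/
lemma exists_isStandardRightTriangle_of_isRelMono {X Y : A} (f : X ⟶ Y) (hf : IsRelMono C f) :
    ∃ (h : cokernel f ⟶ cosyzygyObj C X), IsStandardRightTriangle C f (cokernel.π f) h := by
  obtain ⟨l, hl⟩ := hf (leftApproxObj_mem C X) (leftApprox C X)
  have hl' : f ≫ l ≫ cosyzygyπ C X = 0 := by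
    rw [← Category.assoc, hl, comp_cosyzygyπ]
  exact ⟨cokernel.desc f _ hl', cokernel.condition f, inferInstance,
    fun W φ hφ => ⟨cokernel.desc f φ hφ, cokernel.π_desc _ _ _⟩, hf, l, hl, cokernel.π_desc _ _ _⟩

/-- The second component alone already extends every morphism to `C`. For `i` a left approximation
the summand `P` is stably zero, so every stable morphism has a `C`-monic representative. -/
lemma isRelMono_lift_left {X Y P : A} (f : X ⟶ Y) {i : X ⟶ P} (hi : IsRelMono C i) :
    IsRelMono C (biprod.lift f i) := fun Q hQ g => by
  obtain ⟨h, rfl⟩ := hi hQ g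
  exact ⟨biprod.snd ≫ h, by simp⟩

lemma IsRelMono.comp {X Y Z : A} {f : X ⟶ Y} {g : Y ⟶ Z} (hf : IsRelMono C f)
    (hg : IsRelMono C g) : IsRelMono C (f ≫ g) := fun Q hQ φ => by
  obtain ⟨h, rfl⟩ := hf hQ φ
  obtain ⟨k, rfl⟩ := hg hQ h
  exact ⟨k, by simp⟩

/-- If a square commutes in the stable category and its left vertical map is a relative
monomorphism, the right vertical map may be changed so that it commutes strictly. -/
lemma exists_comp_eq_of_isRelMono {X Y X' Y' : A} {f : X ⟶ Y} (hf : IsRelMono C f)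
    {f' : X' ⟶ Y'} {a : X ⟶ X'} {b : Y ⟶ Y'}
    (w : (toStable C).map (f ≫ b) = (toStable C).map (a ≫ f')) :
    ∃ b' : Y ⟶ Y', (toStable C).map b' = (toStable C).map b ∧ f ≫ b' = a ≫ f' := by
  obtain ⟨P, hP, u, v, huv⟩ := (toStable_map_eq_iff _ _).1 w
  -- The failure of strict commutativity is `u ≫ v` with middle object in `C`. Extending `u` along
  -- `f` turns it into a correction of `b` that is stably zero.
  obtain ⟨u, rfl⟩ := hf hP u
  refine ⟨b - u ≫ v, (toStable_map_eq P hP (-u) v (by simp)), ?_⟩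
  rw [Preadditive.comp_sub, ← Category.assoc, ← huv]
  abel

/-- The third morphism of a morphism of standard right triangles. -/
lemma IsStandardRightTriangle.exists_hom {X Y Z X' Y' Z' : A} {f : X ⟶ Y} {g : Y ⟶ Z}
    {h : Z ⟶ cosyzygyObj C X} {f' : X' ⟶ Y'} {g' : Y' ⟶ Z'} {h' : Z' ⟶ cosyzygyObj C X'}
    (H : IsStandardRightTriangle C f g h) (H' : IsStandardRightTriangle C f' g' h')
    (a : X ⟶ X') (b : Y ⟶ Y') (w : f ≫ b = a ≫ f') :
    ∃ c : Z ⟶ Z', g ≫ c = b ≫ g' ∧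
      toSusp C h ≫ (cosyzygy C).map ((toStable C).map a) = toSusp C (c ≫ h') := by
  obtain ⟨c, hc⟩ := H.exists_desc (b ≫ g') (by rw [reassoc_of% w, H'.zero, comp_zero])
  refine ⟨c, hc, ?_⟩
  obtain ⟨l, hl, hl'⟩ := H.exists_extension
  obtain ⟨m, hm, hm'⟩ := H'.exists_extension
  obtain ⟨k, t, ht, hk⟩ := exists_isCosyzygyMap C a
  rw [toSusp_comp_cosyzygy_map ⟨t, ht, hk⟩]
  -- The two routes from `Y` to the left approximation of `X'` agree on `X`, so their difference
  -- descends to `x`. The two morphisms to `Σ X'` then differ by `x` followed by the projection,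
  -- which passes through `C`.
  obtain ⟨x, hx⟩ := H.exists_desc (l ≫ t - b ≫ m) (by
    rw [Preadditive.comp_sub, reassoc_of% hl, reassoc_of% w, hm, ht, sub_self])
  refine toSusp_eq (leftApproxObj_mem C X') x (cosyzygyπ C X') ?_
  have := H.epi
  rw [← cancel_epi g, Preadditive.comp_sub, reassoc_of% hl', hk, reassoc_of% hc, hm',
    ← Category.assoc g, hx]
  simp

variable (C) in
lemma isRelMono_leftApprox_of_eq {X Y P : A} {f : X ⟶ Y} {g : Y ⟶ P} {i : X ⟶ P}
    (hi : IsRelMono C i) (w : f ≫ g = i) : IsRelMono C f := fun Q hQ φ => by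
  obtain ⟨h, rfl⟩ := hi hQ φ
  exact ⟨g ≫ h, by rw [reassoc_of% w]⟩

instance cosyzygy_additive : (cosyzygy C).Additive where
  map_add {X Y f g} := by
    obtain ⟨f, rfl⟩ := (toStable C).map_surjective f
    obtain ⟨g, rfl⟩ := (toStable C).map_surjective g
    obtain ⟨k, t, ht, hk⟩ := exists_isCosyzygyMap C f
    obtain ⟨k', t', ht', hk'⟩ := exists_isCosyzygyMap C g
    rw [← Functor.map_add, cosyzygy_map_eq C (f := f + g) (k := k + k') ⟨t + t', by simp [ht, ht'],
      by simp [hk, hk']⟩, cosyzygy_map_eq C ⟨t, ht, hk⟩, cosyzygy_map_eq C ⟨t', ht', hk'⟩,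
      Functor.map_add]
    rfl

lemma RightTriangle.IsIsomorphic.trans {T : Type u} [Category.{v} T] {Si : T ⥤ T}
    {S S' S'' : RightTriangle Si} (h : S.IsIsomorphic S') (h' : S'.IsIsomorphic S'') :
    S.IsIsomorphic S'' := by
  obtain ⟨e₁, e₂, e₃, h₁, h₂, h₃⟩ := h
  obtain ⟨e₁', e₂', e₃', h₁', h₂', h₃'⟩ := h'
  refine ⟨e₁ ≪≫ e₁', e₂ ≪≫ e₂', e₃ ≪≫ e₃', ?_, ?_, ?_⟩
  · simp [reassoc_of% h₁, h₁']
  · simp [reassoc_of% h₂, h₂']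
  · simp [reassoc_of% h₃, h₃']

lemma stableRightTriangles_isomorphic (S S' : RightTriangle (cosyzygy C))
    (i : S.IsIsomorphic S') (hS : S ∈ stableRightTriangles C) :
    S' ∈ stableRightTriangles C := by
  obtain ⟨X, Y, Z, f, g, zero, hg, hf, l, h, hl, hl', j⟩ := hS
  exact ⟨X, Y, Z, f, g, zero, hg, hf, l, h, hl, hl', j.trans i⟩

lemma stableRightTriangles_mem_of_iso₂ {X Y Y' Z : StableCategory C} {f : X ⟶ Y} {g : Y ⟶ Z}
    {h : Z ⟶ (cosyzygy C).obj X} (hT : RightTriangle.mk f g h ∈ stableRightTriangles C)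
    {f' : X ⟶ Y'} {g' : Y' ⟶ Z} (e : Y ≅ Y') (h₁ : f ≫ e.hom = f') (h₂ : g = e.hom ≫ g') :
    RightTriangle.mk f' g' h ∈ stableRightTriangles C :=
  stableRightTriangles_isomorphic (RightTriangle.mk f g h) _
    ⟨Iso.refl _, e, Iso.refl _, by simpa using h₁, by simpa using h₂, by simp⟩ hT

variable (C) in
lemma stableRightTriangles_exists {X Y : StableCategory C} (f : X ⟶ Y) :
    ∃ (Z : StableCategory C) (g : Y ⟶ Z) (h : Z ⟶ (cosyzygy C).obj X),
      RightTriangle.mk f g h ∈ stableRightTriangles C := by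
  obtain ⟨X⟩ := X
  obtain ⟨Y⟩ := Y
  obtain ⟨f, rfl⟩ := (toStable C).map_surjective (X := X) (Y := Y) f
  obtain ⟨h, H⟩ := exists_isStandardRightTriangle_of_isRelMono C (biprod.lift f (leftApprox C X))
    (isRelMono_lift_left f (leftApprox_isRelMono C X))
  exact ⟨_, (stableBiprodIso Y (leftApproxObj_mem C X)).inv ≫ (toStable C).map (cokernel.π _),
    toSusp C h, stableRightTriangles_mem_of_iso₂ H.mem (stableBiprodIso Y (leftApproxObj_mem C X))
      (by rw [stableBiprodIso_hom, ← Functor.map_comp, biprod.lift_fst])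
      (by rw [Iso.hom_inv_id_assoc])⟩

/-- The morphism `g` need not be `C`-monic, but `(g, l) : Y ⟶ Z ⊞ C^X` is, where `l` extends the
approximation of `X`. Its cokernel is `Σ X`, through `(h, -π)`, and the sign of `π` is the one on
the rotated morphism. -/
lemma IsStandardRightTriangle.rotate {X Y Z : A} {f : X ⟶ Y} {g : Y ⟶ Z}
    {h : Z ⟶ cosyzygyObj C X} (H : IsStandardRightTriangle C f g h) :
    RightTriangle.mk ((toStable C).map g) (toSusp C h)
      (-(cosyzygy C).map ((toStable C).map f)) ∈ stableRightTriangles C := by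
  obtain ⟨l, hl, hl'⟩ := H.exists_extension
  obtain ⟨k, t, ht, hk⟩ := exists_isCosyzygyMap C f
  have := H.epi
  -- On `X` the approximation of `Y` agrees with `l ≫ t`, so `(w, t)` on `Z ⊞ C^X` extends the
  -- approximation of `Y` along `(g, l)`.
  obtain ⟨w, hw⟩ := H.exists_desc (leftApprox C Y - l ≫ t) (by
    rw [Preadditive.comp_sub, reassoc_of% hl, ht, sub_self])
  have H' : IsStandardRightTriangle C (biprod.lift g l) (biprod.desc h (-cosyzygyπ C X)) (-k) :=
    { zero := by simp [hl']
      epi := by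
        have : Epi (biprod.inr ≫ biprod.desc h (-cosyzygyπ C X)) := by
          rw [biprod.inr_desc]
          infer_instance
        exact epi_of_epi biprod.inr _
      exists_desc := fun W φ hφ => by
        have h0 : g ≫ biprod.inl ≫ φ + l ≫ biprod.inr ≫ φ = 0 := by
          simpa only [biprod.lift_eq, Preadditive.add_comp, Category.assoc] using hφ
        have h1 : leftApprox C X ≫ biprod.inr ≫ φ = 0 := by
          have := f ≫= h0
          simpa [reassoc_of% H.zero, reassoc_of% hl] using this
        obtain ⟨ψ, hψ⟩ := exists_cosyzygyπ_desc C X _ h1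
        refine ⟨-ψ, ?_⟩
        ext
        · rw [← cancel_epi g]
          simp only [biprod.inl_desc_assoc, Preadditive.comp_neg, reassoc_of% hl', hψ]
          rw [← add_eq_zero_iff_neg_eq, add_comm, h0]
        · simp [hψ]
      isRelMono := fun P hP φ => by
        obtain ⟨a, ha⟩ := leftApprox_isRelMono C X hP (f ≫ φ)
        obtain ⟨b, hb⟩ := H.exists_desc (φ - l ≫ a) (by
          rw [Preadditive.comp_sub, reassoc_of% hl, ha, sub_self])
        exact ⟨biprod.desc b a, by simp [hb]⟩
      exists_extension := ⟨biprod.desc w t, by simp [hw], by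
        ext
        · rw [← cancel_epi g]
          simp [reassoc_of% hl', reassoc_of% hw, hk]
        · simp [hk]⟩ }
  rw [cosyzygy_map_eq C ⟨t, ht, hk⟩]
  refine stableRightTriangles_mem_of_iso₂ H'.mem (stableBiprodIso Z (leftApproxObj_mem C X))
    (by rw [stableBiprodIso_hom, ← Functor.map_comp, biprod.lift_fst]) ?_
  refine Eq.trans ?_ (toStable_map_comp_toSusp (biprod.fst : _ ⟶ Z) h).symm
  refine toSusp_eq (leftApproxObj_mem C X) biprod.snd (-cosyzygyπ C X) ?_
  ext <;> simp

variable (C) in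
lemma stableRightTriangles_isPreRightTriangulated :
    IsPreRightTriangulated (cosyzygy C) (stableRightTriangles C) where
  additive := inferInstance
  isomorphic := stableRightTriangles_isomorphic
  contractible M := by
    obtain ⟨M⟩ := M
    have H : IsStandardRightTriangle C (0 : 0 ⟶ M) (𝟙 M) 0 :=
      { zero := by simp
        epi := inferInstance
        exists_desc := fun W φ _ => ⟨φ, by simp⟩
        isRelMono := fun P hP g => ⟨0, (isZero_zero A).eq_of_src _ _⟩
        exists_extension := ⟨0, (isZero_zero A).eq_of_src _ _, by simp⟩ }
    have hz : IsZero ((toStable C).obj 0) := (toStable C).map_isZero (isZero_zero A)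
    refine stableRightTriangles_isomorphic (RightTriangle.mk ((toStable C).map 0)
      ((toStable C).map (𝟙 M)) (toSusp C 0)) _ ⟨hz.iso (isZero_zero _), Iso.refl _, Iso.refl _,
      hz.eq_of_src _ _, ?_, ?_⟩ H.mem
    · simp only [Iso.refl_hom]
      rw [(toStable C).map_id]
      rfl
    · dsimp only
      rw [show toSusp C (0 : M ⟶ cosyzygyObj C 0) = 0 from (toStable C).map_zero _ _]
      exact zero_comp.trans comp_zero.symm
  exists_triangle := stableRightTriangles_exists C
  rotate {X Y Z} f g h hT := by
    obtain ⟨X', Y', Z', f', g', h', e₁, e₂, e₃, H, h₁, h₂, h₃⟩ := exists_isStandardRightTriangle hT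
    refine stableRightTriangles_isomorphic _ _ ⟨e₂, e₃, (cosyzygy C).mapIso e₁, h₂, h₃, ?_⟩ H.rotate
    simp only [Functor.mapIso_hom, Preadditive.comp_neg, Preadditive.neg_comp, ← Functor.map_comp,
      h₁]
  complete_morphism {X Y Z X' Y' Z'} f g h f' g' h' hT hT' a b w := by
    obtain ⟨X₁, Y₁, Z₁, f₁, g₁, h₁, e₁, e₂, e₃, H₁, p₁, p₂, p₃⟩ :=
      exists_isStandardRightTriangle hT
    obtain ⟨X₁', Y₁', Z₁', f₁', g₁', h₁', e₁', e₂', e₃', H₁', p₁', p₂', p₃'⟩ :=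
      exists_isStandardRightTriangle hT'
    obtain ⟨a₁, ha₁⟩ := (toStable C).map_surjective (e₁.hom ≫ a ≫ e₁'.inv)
    obtain ⟨b₁, hb₁⟩ := (toStable C).map_surjective (e₂.hom ≫ b ≫ e₂'.inv)
    -- Lifts to `A` make the square commute only stably. As `f₁` is `C`-monic, the lift of `b` can
    -- be corrected within its stable class.
    obtain ⟨b₂, hb₂, w₂⟩ := exists_comp_eq_of_isRelMono H₁.isRelMono (a := a₁) (b := b₁)
      (f' := f₁') (by
        rw [Functor.map_comp, Functor.map_comp, ha₁, hb₁, reassoc_of% p₁, reassoc_of% w]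
        simp only [Category.assoc]
        rw [← cancel_mono e₂'.hom]
        simp [p₁'])
    obtain ⟨c, hc₁, hc₂⟩ := H₁.exists_hom H₁' a₁ b₂ w₂
    refine ⟨e₃.inv ≫ (toStable C).map c ≫ e₃'.hom, ?_, ?_⟩
    · rw [← cancel_epi e₂.hom, ← reassoc_of% p₂, Iso.hom_inv_id_assoc, ← Functor.map_comp_assoc,
        hc₁, Functor.map_comp, hb₂, hb₁]
      simp [p₂']
    · rw [ha₁, ← toStable_map_comp_toSusp] at hc₂
      rw [← cancel_epi e₃.hom, ← reassoc_of% p₃]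
      simp only [Category.assoc, Iso.hom_inv_id_assoc]
      rw [← p₃', ← reassoc_of% hc₂]
      simp only [← Functor.map_comp, Category.assoc, Iso.inv_hom_id, Category.comp_id]

variable (C) in
/-- The right triangulated structure of a stable category. -/
theorem stableRightTriangles_isRightTriangulated :
    IsRightTriangulated (cosyzygy C) (stableRightTriangles C) := by
  refine (stableRightTriangles_isPreRightTriangulated C).isRightTriangulated ?_
  rintro ⟨X⟩ ⟨Y⟩ ⟨Z⟩ f g
  obtain ⟨f, rfl⟩ := (toStable C).map_surjective (X := X) (Y := Y) f
  obtain ⟨g, rfl⟩ := (toStable C).map_surjective (X := Y) (Y := Z) g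
  -- Both morphisms are made `C`-monic, hence so is their composite, and the octahedron becomes the
  -- sequence of the three cokernels in `A`.
  let Y' := Y ⊞ leftApproxObj C X
  let f' : X ⟶ Y' := biprod.lift f (leftApprox C X)
  let Z' := Z ⊞ leftApproxObj C Y'
  let g' : Y' ⟶ Z' := biprod.lift (biprod.fst ≫ g) (leftApprox C Y')
  have hf' : IsRelMono C f' := isRelMono_lift_left _ (leftApprox_isRelMono C X)
  have hg' : IsRelMono C g' := isRelMono_lift_left _ (leftApprox_isRelMono C Y')
  obtain ⟨h₃, H₃⟩ := exists_isStandardRightTriangle_of_isRelMono C (f' ≫ g') (hf'.comp hg')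
  obtain ⟨h₂, H₂⟩ := exists_isStandardRightTriangle_of_isRelMono C g' hg'
  set a := cokernel.π f'
  set b := cokernel.π g'
  set c := cokernel.π (f' ≫ g')
  obtain ⟨l₃, hl₃, hl₃'⟩ := H₃.exists_extension
  obtain ⟨l₂, hl₂, hl₂'⟩ := H₂.exists_extension
  have wa : f' ≫ a = 0 := cokernel.condition f'
  obtain ⟨m, hm⟩ : ∃ m : cokernel f' ⟶ cokernel (f' ≫ g'), a ≫ m = g' ≫ c :=
    ⟨cokernel.desc _ (g' ≫ c) (by rw [← Category.assoc, H₃.zero]), cokernel.π_desc _ _ _⟩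
  obtain ⟨n, hn⟩ := H₃.exists_desc b (by rw [Category.assoc, H₂.zero, comp_zero])
  -- The connecting morphism of the first cone is taken to be `m ≫ h₃`, so that one of the
  -- octahedral identities holds by construction.
  have H₁ : IsStandardRightTriangle C f' a (m ≫ h₃) :=
    { zero := wa
      epi := inferInstance
      exists_desc := fun W φ hφ => ⟨cokernel.desc _ φ hφ, cokernel.π_desc _ _ _⟩
      isRelMono := hf'
      exists_extension := ⟨g' ≫ l₃, by rw [← Category.assoc, hl₃], by
        rw [reassoc_of% hm, hl₃', Category.assoc]⟩ }
  have epin : Epi n := by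
    have : Epi (c ≫ n) := by rw [hn]; infer_instance
    exact epi_of_epi c n
  obtain ⟨k, t, ht, hk⟩ := exists_isCosyzygyMap C a
  -- `L` extends the left approximation of the cone of `f'` along `m`. This shows that `m` is
  -- `C`-monic and computes its connecting morphism.
  obtain ⟨L, hL⟩ := H₃.exists_desc (l₂ ≫ t) (by
    rw [Category.assoc, reassoc_of% hl₂, ht, reassoc_of% wa, zero_comp])
  have hmL : m ≫ L = leftApprox C _ := by
    rw [← cancel_epi a, reassoc_of% hm, hL, reassoc_of% hl₂, ht]
  have H : IsStandardRightTriangle C m n (h₂ ≫ k) :=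
    { zero := by
        rw [← cancel_epi a, reassoc_of% hm, hn, H₂.zero, comp_zero]
      epi := epin
      exists_desc := fun W φ hφ => by
        obtain ⟨ψ, hψ⟩ := H₂.exists_desc (c ≫ φ) (by
          rw [← reassoc_of% hm, hφ, comp_zero])
        exact ⟨ψ, by rw [← cancel_epi c, reassoc_of% hn, hψ]⟩
      isRelMono := isRelMono_leftApprox_of_eq C (leftApprox_isRelMono C _) hmL
      exists_extension := ⟨L, hmL, by
        rw [← cancel_epi c, reassoc_of% hn, reassoc_of% hl₂', hk, reassoc_of% hL]⟩ }
  refine ⟨_, _, _, _, _, _, Iso.refl _, stableBiprodIso Y (leftApproxObj_mem C X),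
    stableBiprodIso Z (leftApproxObj_mem C Y'), (toStable C).map f', (toStable C).map g',
    (toStable C).map a, toSusp C (m ≫ h₃), (toStable C).map b, toSusp C h₂,
    (toStable C).map c, toSusp C h₃, (toStable C).map m, (toStable C).map n,
    ?_, ?_, H₁.mem, H₂.mem, ?_, ?_, ?_, ?_, ?_, ?_⟩
  · refine Eq.trans ?_ (Category.id_comp _).symm
    simp only [stableBiprodIso_hom, ← Functor.map_comp]
    simp [f']
  · simp only [stableBiprodIso_hom, ← Functor.map_comp]
    simp [g']
  · rw [← Functor.map_comp]
    exact H₃.mem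
  · rw [toSusp_comp_cosyzygy_map ⟨t, ht, hk⟩]
    exact H.mem
  · rw [← Functor.map_comp, ← Functor.map_comp, hm]
  · rw [← Functor.map_comp, hn]
  · rw [toStable_map_comp_toSusp]
  · obtain ⟨k', t', ht', hk'⟩ := exists_isCosyzygyMap C f'
    rw [toSusp_comp_cosyzygy_map ⟨t', ht', hk'⟩, toStable_map_comp_toSusp]
    -- This identity holds only stably: the two extensions agree on `X`, and the difference of the
    -- induced morphisms factors through the approximation of `Y'`.
    obtain ⟨x, hx⟩ := H₃.exists_desc (l₂ - l₃ ≫ t') (by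
      rw [Preadditive.comp_sub, ← Category.assoc (f' ≫ g') l₃, hl₃, ht', Category.assoc, hl₂,
        sub_self])
    refine toSusp_eq (leftApproxObj_mem C Y') x (cosyzygyπ C Y') ?_
    rw [← cancel_epi c, reassoc_of% hx, Preadditive.comp_sub, reassoc_of% hn, hl₂',
      reassoc_of% hl₃', hk']
    simp

end StableRight

/-! ### The left triangulation of a stable category -/

section StableLeft

variable {A : Type u} [Category.{v} A] [Abelian A] (C : ObjectProperty A)
  [IsAdditiveSubcategory C] [IsContravariantlyFinite C]

lemma exists_syzygyι_lift (X : A) {W : A} (φ : W ⟶ rightApproxObj C X)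
    (hφ : φ ≫ rightApprox C X = 0) : ∃ ψ : W ⟶ syzygyObj C X, ψ ≫ syzygyι C X = φ :=
  ⟨kernel.lift _ φ hφ, kernel.lift_ι _ _ _⟩

instance (X : A) : Mono (syzygyι C X) := inferInstanceAs (Mono (kernel.ι _))

/-- The morphism from `Ω Z` in `A/C` given by a morphism from the kernel of the right
`C`-approximation of `Z`. -/
def ofLoop {X Z : A} (h : syzygyObj C Z ⟶ X) :
    (syzygy C).obj ((toStable C).obj Z) ⟶ (toStable C).obj X := (toStable C).map h

variable {C} in
lemma ofLoop_comp_toStable_map {X Y Z : A} (h : syzygyObj C Z ⟶ X) (c : X ⟶ Y) :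
    ofLoop C h ≫ (toStable C).map c = ofLoop C (h ≫ c) := ((toStable C).map_comp h c).symm

variable {C} in
lemma syzygy_map_comp_ofLoop {X Y Z : A} {f : X ⟶ Y}
    {k : syzygyObj C X ⟶ syzygyObj C Y} (hk : IsSyzygyMap C f k)
    (h : syzygyObj C Y ⟶ Z) :
    (syzygy C).map ((toStable C).map f) ≫ ofLoop C h = ofLoop C (k ≫ h) := by
  rw [syzygy_map_eq C hk]
  exact ((toStable C).map_comp k h).symm

variable {C} in
lemma ofLoop_eq {X Z : A} {h h' : syzygyObj C Z ⟶ X} {P : A} (hP : C P)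
    (a : syzygyObj C Z ⟶ P) (b : P ⟶ X) (w : h - h' = a ≫ b) : ofLoop C h = ofLoop C h' :=
  toStable_map_eq P hP a b w

/-- The diagrams `Ω Z ⟶ X ⟶ Y ⟶ Z` in `A` which induce the left triangles of `A/C`. -/
structure IsStandardLeftTriangle {X Y Z : A} (h : syzygyObj C Z ⟶ X) (g : X ⟶ Y) (f : Y ⟶ Z) :
    Prop where
  zero : g ≫ f = 0
  mono : Mono g
  exists_lift : ∀ ⦃W : A⦄ (φ : W ⟶ Y), φ ≫ f = 0 → ∃ ψ : W ⟶ X, ψ ≫ g = φ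
  isRelEpi : IsRelEpi C f
  exists_coextension : ∃ l : rightApproxObj C Z ⟶ Y, l ≫ f = rightApprox C Z ∧
    h ≫ g = syzygyι C Z ≫ l

variable {C}

lemma IsStandardLeftTriangle.mem {X Y Z : A} {h : syzygyObj C Z ⟶ X} {g : X ⟶ Y} {f : Y ⟶ Z}
    (H : IsStandardLeftTriangle C h g f) :
    LeftTriangle.mk (ofLoop C h) ((toStable C).map g) ((toStable C).map f) ∈
      stableLeftTriangles C := by
  obtain ⟨l, hl, hl'⟩ := H.exists_coextension
  exact ⟨X, Y, Z, g, f, H.zero, (nonempty_isLimit_kernelFork_iff _).2 ⟨H.mono, H.exists_lift⟩,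
    H.isRelEpi, l, h, hl, hl', Iso.refl _, Iso.refl _, Iso.refl _, by
      rw [Iso.refl_hom, Iso.refl_hom, CategoryTheory.Functor.map_id]
      exact (Category.comp_id _).trans (Category.id_comp _).symm,
    (Category.comp_id _).trans (Category.id_comp _).symm,
    (Category.comp_id _).trans (Category.id_comp _).symm⟩

lemma exists_isStandardLeftTriangle {X Y Z : StableCategory C} {h : (syzygy C).obj Z ⟶ X}
    {g : X ⟶ Y} {f : Y ⟶ Z} (hT : LeftTriangle.mk h g f ∈ stableLeftTriangles C) :
    ∃ (X' Y' Z' : A) (h' : syzygyObj C Z' ⟶ X') (g' : X' ⟶ Y') (f' : Y' ⟶ Z')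
      (e₁ : (toStable C).obj X' ≅ X) (e₂ : (toStable C).obj Y' ≅ Y) (e₃ : (toStable C).obj Z' ≅ Z),
      IsStandardLeftTriangle C h' g' f' ∧
        ofLoop C h' ≫ e₁.hom = (syzygy C).map e₃.hom ≫ h ∧
        (toStable C).map g' ≫ e₂.hom = e₁.hom ≫ g ∧
        (toStable C).map f' ≫ e₃.hom = e₂.hom ≫ f := by
  obtain ⟨X', Y', Z', g', f', zero, hg, hf, l, h', hl, hl', e₁, e₂, e₃, h₁, h₂, h₃⟩ := hT
  rw [nonempty_isLimit_kernelFork_iff] at hg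
  exact ⟨X', Y', Z', h', g', f', e₁, e₂, e₃, ⟨zero, hg.1, hg.2, hf, l, hl, hl'⟩, h₁, h₂, h₃⟩

variable (C) in
/-- Any relative epimorphism is part of a standard left triangle. -/
lemma exists_isStandardLeftTriangle_of_isRelEpi {Y Z : A} (f : Y ⟶ Z) (hf : IsRelEpi C f) :
    ∃ (h : syzygyObj C Z ⟶ kernel f), IsStandardLeftTriangle C h (kernel.ι f) f := by
  obtain ⟨l, hl⟩ := hf (rightApproxObj_mem C Z) (rightApprox C Z)
  have hl' : (syzygyι C Z ≫ l) ≫ f = 0 := by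
    rw [Category.assoc, hl, syzygyι_comp]
  exact ⟨kernel.lift f _ hl', kernel.condition f, inferInstance,
    fun W φ hφ => ⟨kernel.lift f φ hφ, kernel.lift_ι _ _ _⟩, hf, l, hl, kernel.lift_ι _ _ _⟩

lemma isRelEpi_desc_right {Y Z P : A} (f : Y ⟶ Z) {p : P ⟶ Z} (hp : IsRelEpi C p) :
    IsRelEpi C (biprod.desc f p) := fun Q hQ g => by
  obtain ⟨h, rfl⟩ := hp hQ g
  exact ⟨h ≫ biprod.inr, by simp⟩

lemma IsRelEpi.comp {X Y Z : A} {f : X ⟶ Y} {g : Y ⟶ Z} (hf : IsRelEpi C f)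
    (hg : IsRelEpi C g) : IsRelEpi C (f ≫ g) := fun Q hQ φ => by
  obtain ⟨h, rfl⟩ := hg hQ φ
  obtain ⟨k, rfl⟩ := hf hQ h
  exact ⟨k, by simp⟩

/-- If a square commutes in the stable category and its right vertical map is a relative
epimorphism, the left vertical map may be changed so that it commutes strictly. -/
lemma exists_comp_eq_of_isRelEpi {Y Z Y' Z' : A} {f : Y ⟶ Z}
    {f' : Y' ⟶ Z'} (hf' : IsRelEpi C f') {b : Y ⟶ Y'} {c : Z ⟶ Z'}
    (w : (toStable C).map (b ≫ f') = (toStable C).map (f ≫ c)) :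
    ∃ b' : Y ⟶ Y', (toStable C).map b' = (toStable C).map b ∧ b' ≫ f' = f ≫ c := by
  obtain ⟨P, hP, u, v, huv⟩ := (toStable_map_eq_iff _ _).1 w
  obtain ⟨v, rfl⟩ := hf' hP v
  refine ⟨b - u ≫ v, (toStable_map_eq P hP (-u) v (by simp)), ?_⟩
  rw [Preadditive.sub_comp, Category.assoc, ← huv]
  abel

/-- The first morphism of a morphism of standard left triangles. -/
lemma IsStandardLeftTriangle.exists_hom {X Y Z X' Y' Z' : A} {h : syzygyObj C Z ⟶ X}
    {g : X ⟶ Y} {f : Y ⟶ Z} {h' : syzygyObj C Z' ⟶ X'} {g' : X' ⟶ Y'} {f' : Y' ⟶ Z'}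
    (H : IsStandardLeftTriangle C h g f) (H' : IsStandardLeftTriangle C h' g' f')
    (b : Y ⟶ Y') (c : Z ⟶ Z') (w : b ≫ f' = f ≫ c) :
    ∃ a : X ⟶ X', a ≫ g' = g ≫ b ∧
      (syzygy C).map ((toStable C).map c) ≫ ofLoop C h' = ofLoop C (h ≫ a) := by
  obtain ⟨a, ha⟩ := H'.exists_lift (g ≫ b) (by
    rw [Category.assoc, w, ← Category.assoc, H.zero, zero_comp])
  refine ⟨a, ha, ?_⟩
  obtain ⟨l, hl, hl'⟩ := H.exists_coextension
  obtain ⟨m, hm, hm'⟩ := H'.exists_coextension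
  obtain ⟨k, t, ht, hk⟩ := exists_isSyzygyMap C c
  rw [syzygy_map_comp_ofLoop ⟨t, ht, hk⟩]
  -- The two routes from the approximation of `Z` to `Y'` agree in `Z'`, so their difference lifts
  -- to `X'`. On `Ω Z` the two morphisms therefore differ by one through `C`.
  obtain ⟨x, hx⟩ := H'.exists_lift (t ≫ m - l ≫ b) (by
    rw [Preadditive.sub_comp, Category.assoc, Category.assoc, hm, w, ht, reassoc_of% hl, sub_self])
  refine ofLoop_eq (rightApproxObj_mem C Z) (syzygyι C Z) x ?_
  have := H'.mono
  rw [← cancel_mono g', Preadditive.sub_comp, Category.assoc, Category.assoc, Category.assoc, hm',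
    ha, reassoc_of% hk, hx, ← Category.assoc h, hl', Preadditive.comp_sub, Category.assoc]

variable (C) in
lemma isRelEpi_of_comp_eq {X Y P : A} {f : X ⟶ Y} {g : P ⟶ X} {p : P ⟶ Y}
    (hp : IsRelEpi C p) (w : g ≫ f = p) : IsRelEpi C f := fun Q hQ φ => by
  obtain ⟨h, rfl⟩ := hp hQ φ
  exact ⟨h ≫ g, by rw [Category.assoc, w]⟩

instance syzygy_additive : (syzygy C).Additive where
  map_add {X Y f g} := by
    obtain ⟨f, rfl⟩ := (toStable C).map_surjective f
    obtain ⟨g, rfl⟩ := (toStable C).map_surjective g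
    obtain ⟨k, t, ht, hk⟩ := exists_isSyzygyMap C f
    obtain ⟨k', t', ht', hk'⟩ := exists_isSyzygyMap C g
    rw [← Functor.map_add, syzygy_map_eq C (f := f + g) (k := k + k') ⟨t + t', by simp [ht, ht'],
      by simp [hk, hk']⟩, syzygy_map_eq C ⟨t, ht, hk⟩, syzygy_map_eq C ⟨t', ht', hk'⟩,
      Functor.map_add]
    rfl

lemma LeftTriangle.IsIsomorphic.trans {T : Type u} [Category.{v} T] {Om : T ⥤ T}
    {S S' S'' : LeftTriangle Om} (h : S.IsIsomorphic S') (h' : S'.IsIsomorphic S'') :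
    S.IsIsomorphic S'' := by
  obtain ⟨e₁, e₂, e₃, h₁, h₂, h₃⟩ := h
  obtain ⟨e₁', e₂', e₃', h₁', h₂', h₃'⟩ := h'
  refine ⟨e₁ ≪≫ e₁', e₂ ≪≫ e₂', e₃ ≪≫ e₃', ?_, ?_, ?_⟩
  · simp [reassoc_of% h₁, h₁']
  · simp [reassoc_of% h₂, h₂']
  · simp [reassoc_of% h₃, h₃']

lemma stableLeftTriangles_isomorphic (S S' : LeftTriangle (syzygy C))
    (i : S.IsIsomorphic S') (hS : S ∈ stableLeftTriangles C) :
    S' ∈ stableLeftTriangles C := by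
  obtain ⟨X, Y, Z, f, g, zero, hg, hf, l, h, hl, hl', j⟩ := hS
  exact ⟨X, Y, Z, f, g, zero, hg, hf, l, h, hl, hl', j.trans i⟩

lemma stableLeftTriangles_mem_of_iso₂ {X Y Y' Z : StableCategory C} {h : (syzygy C).obj Z ⟶ X}
    {g : X ⟶ Y} {f : Y ⟶ Z} (hT : LeftTriangle.mk h g f ∈ stableLeftTriangles C)
    {g' : X ⟶ Y'} {f' : Y' ⟶ Z} (e : Y ≅ Y') (h₁ : g ≫ e.hom = g') (h₂ : f = e.hom ≫ f') :
    LeftTriangle.mk h g' f' ∈ stableLeftTriangles C :=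
  stableLeftTriangles_isomorphic (LeftTriangle.mk h g f) _
    ⟨Iso.refl _, e, Iso.refl _, by simp, by simpa using h₁, by simpa using h₂⟩ hT

variable (C) in
lemma stableLeftTriangles_exists {Y Z : StableCategory C} (f : Y ⟶ Z) :
    ∃ (X : StableCategory C) (h : (syzygy C).obj Z ⟶ X) (g : X ⟶ Y),
      LeftTriangle.mk h g f ∈ stableLeftTriangles C := by
  obtain ⟨Y⟩ := Y
  obtain ⟨Z⟩ := Z
  obtain ⟨f, rfl⟩ := (toStable C).map_surjective (X := Y) (Y := Z) f
  obtain ⟨h, H⟩ := exists_isStandardLeftTriangle_of_isRelEpi C (biprod.desc f (rightApprox C Z))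
    (isRelEpi_desc_right f (rightApprox_isRelEpi C Z))
  exact ⟨_, ofLoop C h, (toStable C).map (kernel.ι _) ≫
    (stableBiprodIso Y (rightApproxObj_mem C Z)).hom,
    stableLeftTriangles_mem_of_iso₂ H.mem (stableBiprodIso Y (rightApproxObj_mem C Z)) rfl
      (by rw [← Iso.inv_comp_eq, stableBiprodIso_inv, ← Functor.map_comp, biprod.inl_desc])⟩

/-- Here `g` is replaced by the `C`-epic `(g, l) : X ⊞ C_Z ⟶ Y`, with `l` a lift of the
approximation of `Z`. Its kernel is `Ω Z`, through `(h, -ι)`, whence the sign. -/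
lemma IsStandardLeftTriangle.rotate {X Y Z : A} {h : syzygyObj C Z ⟶ X} {g : X ⟶ Y}
    {f : Y ⟶ Z} (H : IsStandardLeftTriangle C h g f) :
    LeftTriangle.mk (-(syzygy C).map ((toStable C).map f)) (ofLoop C h)
      ((toStable C).map g) ∈ stableLeftTriangles C := by
  obtain ⟨l, hl, hl'⟩ := H.exists_coextension
  obtain ⟨k, t, ht, hk⟩ := exists_isSyzygyMap C f
  have := H.mono
  obtain ⟨w, hw⟩ := H.exists_lift (rightApprox C Y - t ≫ l) (by
    rw [Preadditive.sub_comp, Category.assoc, hl, ht, sub_self])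
  have H' : IsStandardLeftTriangle C (-k) (biprod.lift h (-syzygyι C Z)) (biprod.desc g l) :=
    { zero := by simp [hl']
      mono := by
        have : Mono (biprod.lift h (-syzygyι C Z) ≫ biprod.snd) := by
          rw [biprod.lift_snd]
          infer_instance
        exact mono_of_mono _ biprod.snd
      exists_lift := fun W φ hφ => by
        have h0 : (φ ≫ biprod.fst) ≫ g + (φ ≫ biprod.snd) ≫ l = 0 := by
          simpa only [biprod.desc_eq, Preadditive.comp_add, Category.assoc] using hφ
        have h1 : (φ ≫ biprod.snd) ≫ rightApprox C Z = 0 := by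
          have := h0 =≫ f
          simpa only [Preadditive.add_comp, Category.assoc, H.zero, hl, comp_zero, zero_add,
            zero_comp] using this
        obtain ⟨ψ, hψ⟩ := exists_syzygyι_lift C Z _ h1
        refine ⟨-ψ, ?_⟩
        ext
        · rw [← cancel_mono g]
          simp only [Category.assoc, biprod.lift_fst, Preadditive.neg_comp, hl']
          rw [← Category.assoc ψ, hψ, ← add_eq_zero_iff_neg_eq, add_comm, ← h0]
          simp only [Category.assoc]
        · simp [hψ]
      isRelEpi := fun P hP φ => by
        obtain ⟨a, ha⟩ := rightApprox_isRelEpi C Z hP (φ ≫ f)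
        obtain ⟨b, hb⟩ := H.exists_lift (φ - a ≫ l) (by
          rw [Preadditive.sub_comp, Category.assoc, hl, ha, sub_self])
        exact ⟨biprod.lift b a, by simp [hb]⟩
      exists_coextension := ⟨biprod.lift w t, by simp [hw], by
        ext
        · rw [← cancel_mono g]
          simp [hl', hw, reassoc_of% hk]
        · simp [hk]⟩ }
  rw [syzygy_map_eq C ⟨t, ht, hk⟩]
  refine stableLeftTriangles_mem_of_iso₂ H'.mem (stableBiprodIso X (rightApproxObj_mem C Z)) ?_ ?_
  · refine Eq.trans ((toStable C).map_comp _ _).symm ?_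
    rw [biprod.lift_fst]
    rfl
  · rw [← Iso.inv_comp_eq, stableBiprodIso_inv, ← Functor.map_comp, biprod.inl_desc]

variable (C) in
lemma stableLeftTriangles_isPreLeftTriangulated :
    IsPreLeftTriangulated (syzygy C) (stableLeftTriangles C) where
  additive := inferInstance
  isomorphic := stableLeftTriangles_isomorphic
  contractible M := by
    obtain ⟨M⟩ := M
    have H : IsStandardLeftTriangle C 0 (𝟙 M) (0 : M ⟶ 0) :=
      { zero := by simp
        mono := inferInstance
        exists_lift := fun W φ _ => ⟨φ, by simp⟩
        isRelEpi := fun P hP g => ⟨0, (isZero_zero A).eq_of_tgt _ _⟩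
        exists_coextension := ⟨0, (isZero_zero A).eq_of_tgt _ _, by simp⟩ }
    have hz : IsZero ((toStable C).obj 0) := (toStable C).map_isZero (isZero_zero A)
    refine stableLeftTriangles_isomorphic (LeftTriangle.mk (ofLoop C 0) ((toStable C).map (𝟙 M))
      ((toStable C).map (0 : M ⟶ 0))) _ ⟨Iso.refl _, Iso.refl _, hz.iso (isZero_zero _), ?_, ?_,
      (isZero_zero _).eq_of_tgt _ _⟩ H.mem
    · dsimp only
      rw [show ofLoop C (0 : syzygyObj C 0 ⟶ M) = 0 from (toStable C).map_zero _ _]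
      exact zero_comp.trans comp_zero.symm
    · simp only [Iso.refl_hom]
      rw [(toStable C).map_id]
      rfl
  exists_triangle := stableLeftTriangles_exists C
  rotate {X Y Z} h g f hT := by
    obtain ⟨X', Y', Z', h', g', f', e₁, e₂, e₃, H, h₁, h₂, h₃⟩ := exists_isStandardLeftTriangle hT
    refine stableLeftTriangles_isomorphic _ _ ⟨(syzygy C).mapIso e₃, e₁, e₂, ?_, h₁, h₂⟩ H.rotate
    simp only [Functor.mapIso_hom, Preadditive.comp_neg, Preadditive.neg_comp, ← Functor.map_comp,
      h₃]
  complete_morphism {X Y Z X' Y' Z'} h g f h' g' f' hT hT' b c w := by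
    obtain ⟨X₁, Y₁, Z₁, h₁, g₁, f₁, e₁, e₂, e₃, H₁, p₁, p₂, p₃⟩ :=
      exists_isStandardLeftTriangle hT
    obtain ⟨X₁', Y₁', Z₁', h₁', g₁', f₁', e₁', e₂', e₃', H₁', p₁', p₂', p₃'⟩ :=
      exists_isStandardLeftTriangle hT'
    obtain ⟨b₁, hb₁⟩ := (toStable C).map_surjective (e₂.hom ≫ b ≫ e₂'.inv)
    obtain ⟨c₁, hc₁⟩ := (toStable C).map_surjective (e₃.hom ≫ c ≫ e₃'.inv)
    obtain ⟨b₂, hb₂, w₂⟩ := exists_comp_eq_of_isRelEpi H₁'.isRelEpi (b := b₁) (c := c₁)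
      (f := f₁) (by
        rw [Functor.map_comp, Functor.map_comp, hb₁, hc₁, reassoc_of% p₃, reassoc_of% w]
        simp only [Category.assoc]
        rw [← cancel_mono e₃'.hom]
        simp [p₃'])
    obtain ⟨a, ha₁, ha₂⟩ := H₁.exists_hom H₁' b₂ c₁ w₂
    refine ⟨e₁.inv ≫ (toStable C).map a ≫ e₁'.hom, ?_, ?_⟩
    · rw [← cancel_epi e₁.hom, ← reassoc_of% p₂]
      simp only [Category.assoc, Iso.hom_inv_id_assoc]
      rw [← p₂', ← Functor.map_comp_assoc, ha₁, Functor.map_comp, hb₂, hb₁]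
      simp
    · rw [hc₁, ← ofLoop_comp_toStable_map] at ha₂
      rw [← cancel_epi ((syzygy C).map e₃.hom), ← reassoc_of% p₁]
      simp only [Iso.hom_inv_id_assoc]
      rw [← reassoc_of% ha₂, p₁']
      simp only [← Functor.map_comp_assoc, Category.assoc, Iso.inv_hom_id, Category.comp_id]

variable (C) in
/-- The left triangulated structure of a stable category. -/
theorem stableLeftTriangles_isLeftTriangulated :
    IsLeftTriangulated (syzygy C) (stableLeftTriangles C) := by
  refine (stableLeftTriangles_isPreLeftTriangulated C).isLeftTriangulated ?_
  rintro ⟨X⟩ ⟨Y⟩ ⟨Z⟩ f g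
  obtain ⟨f, rfl⟩ := (toStable C).map_surjective (X := X) (Y := Y) f
  obtain ⟨g, rfl⟩ := (toStable C).map_surjective (X := Y) (Y := Z) g
  let Y' := Y ⊞ rightApproxObj C Z
  let g' : Y' ⟶ Z := biprod.desc g (rightApprox C Z)
  let X' := X ⊞ rightApproxObj C Y'
  let f' : X' ⟶ Y' := biprod.desc (f ≫ biprod.inl) (rightApprox C Y')
  have hf' : IsRelEpi C f' := isRelEpi_desc_right _ (rightApprox_isRelEpi C Y')
  have hg' : IsRelEpi C g' := isRelEpi_desc_right _ (rightApprox_isRelEpi C Z)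
  obtain ⟨h₃, H₃⟩ := exists_isStandardLeftTriangle_of_isRelEpi C (f' ≫ g') (hf'.comp hg')
  obtain ⟨h₁, H₁⟩ := exists_isStandardLeftTriangle_of_isRelEpi C f' hf'
  set a := kernel.ι f'
  set b := kernel.ι g'
  set c := kernel.ι (f' ≫ g')
  obtain ⟨l₃, hl₃, hl₃'⟩ := H₃.exists_coextension
  obtain ⟨l₁, hl₁, hl₁'⟩ := H₁.exists_coextension
  have wb : b ≫ g' = 0 := kernel.condition g'
  obtain ⟨n, hn⟩ : ∃ n : kernel (f' ≫ g') ⟶ kernel g', n ≫ b = c ≫ f' :=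
    ⟨kernel.lift _ (c ≫ f') (by rw [Category.assoc, H₃.zero]), kernel.lift_ι _ _ _⟩
  obtain ⟨m, hm⟩ := H₃.exists_lift a (by rw [← Category.assoc, H₁.zero, zero_comp])
  -- As for right triangles, one connecting morphism is defined from the composite's, so that the
  -- identity `h₃ ≫ n = h₂` is built in.
  have H₂ : IsStandardLeftTriangle C (h₃ ≫ n) b g' :=
    { zero := wb
      mono := inferInstance
      exists_lift := fun W φ hφ => ⟨kernel.lift _ φ hφ, kernel.lift_ι _ _ _⟩
      isRelEpi := hg'
      exists_coextension := ⟨l₃ ≫ f', by rw [Category.assoc, hl₃], by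
        rw [Category.assoc, hn, ← Category.assoc, hl₃', Category.assoc]⟩ }
  have monom : Mono m := by
    have : Mono (m ≫ c) := by rw [hm]; infer_instance
    exact mono_of_mono m c
  obtain ⟨k, t, ht, hk⟩ := exists_isSyzygyMap C b
  -- `L` lifts the right approximation of the kernel of `g'` through `n`. Hence `n` is `C`-epic,
  -- with connecting morphism computed by `L`.
  obtain ⟨L, hL⟩ := H₃.exists_lift (t ≫ l₁) (by
    rw [Category.assoc, reassoc_of% hl₁, reassoc_of% ht, wb, comp_zero])
  have hLn : L ≫ n = rightApprox C _ := by
    rw [← cancel_mono b, Category.assoc, hn, reassoc_of% hL, hl₁, ht]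
  have H : IsStandardLeftTriangle C (k ≫ h₁) m n :=
    { zero := by
        rw [← cancel_mono b, Category.assoc, hn, reassoc_of% hm, H₁.zero, zero_comp]
      mono := monom
      exists_lift := fun W φ hφ => by
        obtain ⟨ψ, hψ⟩ := H₁.exists_lift (φ ≫ c) (by
          rw [Category.assoc, ← hn, reassoc_of% hφ, zero_comp])
        exact ⟨ψ, by rw [← cancel_mono c, Category.assoc, hm, hψ]⟩
      isRelEpi := isRelEpi_of_comp_eq C (rightApprox_isRelEpi C _) hLn
      exists_coextension := ⟨L, hLn, by
        rw [← cancel_mono c, Category.assoc, Category.assoc, hm, hl₁', reassoc_of% hk,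
          Category.assoc, hL]⟩ }
  refine ⟨_, _, _, _, _, _, stableBiprodIso X (rightApproxObj_mem C Y'),
    stableBiprodIso Y (rightApproxObj_mem C Z), Iso.refl _, (toStable C).map f',
    (toStable C).map g',
    ofLoop C h₁, (toStable C).map a, ofLoop C (h₃ ≫ n), (toStable C).map b,
    ofLoop C h₃, (toStable C).map c, (toStable C).map m, (toStable C).map n,
    ?_, ?_, H₁.mem, H₂.mem, ?_, ?_, ?_, ?_, ?_, ?_⟩
  · rw [← Iso.inv_comp_eq, stableBiprodIso_inv, stableBiprodIso_hom, ← Functor.map_comp_assoc,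
      ← Functor.map_comp, biprod.inl_desc, Category.assoc, biprod.inl_fst, Category.comp_id]
  · refine (Category.comp_id _).trans ?_
    rw [← Iso.inv_comp_eq, stableBiprodIso_inv, ← Functor.map_comp, biprod.inl_desc]
  · rw [← Functor.map_comp]
    exact H₃.mem
  · rw [syzygy_map_comp_ofLoop ⟨t, ht, hk⟩]
    exact H.mem
  · rw [← Functor.map_comp, hm]
  · rw [← Functor.map_comp, ← Functor.map_comp, hn]
  · rw [ofLoop_comp_toStable_map]
  · obtain ⟨k', t', ht', hk'⟩ := exists_isSyzygyMap C g'
    rw [syzygy_map_comp_ofLoop ⟨t', ht', hk'⟩, ofLoop_comp_toStable_map]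
    obtain ⟨x, hx⟩ := H₃.exists_lift (l₁ - t' ≫ l₃) (by
      rw [Preadditive.sub_comp, Category.assoc t' l₃, hl₃, ht', ← Category.assoc l₁, hl₁, sub_self])
    refine ofLoop_eq (rightApproxObj_mem C Y') (syzygyι C Y') x ?_
    rw [← cancel_mono c, Category.assoc, hx, Preadditive.sub_comp, Preadditive.comp_sub,
      Category.assoc, Category.assoc, hm, hl₁', hl₃', reassoc_of% hk']

end StableLeft

/-! ### The pretriangulated structure of a stable category -/

section StablePretriangulated

variable {A : Type u} [Category.{v} A] [Abelian A] (C : ObjectProperty A)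
  [IsAdditiveSubcategory C] [IsContravariantlyFinite C] [IsCovariantlyFinite C]

/-- The morphisms `d : Σ X ⟶ N` and `a : X ⟶ Ω N` are induced by the same morphism from the left
approximation of `X` to the right approximation of `N`, up to a sign. -/
def IsAdjunct {X N : A} (d : cosyzygyObj C X ⟶ N) (a : X ⟶ syzygyObj C N) : Prop :=
  ∃ t : leftApproxObj C X ⟶ rightApproxObj C N,
    leftApprox C X ≫ t = a ≫ syzygyι C N ∧ cosyzygyπ C X ≫ d = -(t ≫ rightApprox C N)

variable {C}

lemma exists_isAdjunct_right {X N : A} (d : cosyzygyObj C X ⟶ N) :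
    ∃ a : X ⟶ syzygyObj C N, IsAdjunct C d a := by
  obtain ⟨t, ht⟩ := rightApprox_isRelEpi C N (leftApproxObj_mem C X) (-(cosyzygyπ C X ≫ d))
  obtain ⟨a, ha⟩ := exists_syzygyι_lift C N (leftApprox C X ≫ t) (by
    rw [Category.assoc, ht, Preadditive.comp_neg, ← Category.assoc, comp_cosyzygyπ, zero_comp,
      neg_zero])
  exact ⟨a, t, ha.symm, by rw [ht, neg_neg]⟩

lemma exists_isAdjunct_left {X N : A} (a : X ⟶ syzygyObj C N) :
    ∃ d : cosyzygyObj C X ⟶ N, IsAdjunct C d a := by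
  obtain ⟨t, ht⟩ := leftApprox_isRelMono C X (rightApproxObj_mem C N) (a ≫ syzygyι C N)
  obtain ⟨d, hd⟩ := exists_cosyzygyπ_desc C X (-(t ≫ rightApprox C N)) (by
    rw [Preadditive.comp_neg, reassoc_of% ht, syzygyι_comp, comp_zero, neg_zero])
  exact ⟨d, t, ht, hd⟩

lemma IsAdjunct.sub {X N : A} {d d' : cosyzygyObj C X ⟶ N} {a a' : X ⟶ syzygyObj C N}
    (h : IsAdjunct C d a) (h' : IsAdjunct C d' a') : IsAdjunct C (d - d') (a - a') := by
  obtain ⟨t, ht, ht'⟩ := h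
  obtain ⟨s, hs, hs'⟩ := h'
  exact ⟨t - s, by simp [ht, hs], by simp [ht', hs']; abel⟩

/-- If `d` or `a` factors through `C`, the factorization can be absorbed into the common morphism `t
: C^X ⟶ C_N`. The corrected `t` then lands in `Ω N`, respectively descends to `Σ X`, and exhibits
the other morphism as stably zero. This makes the correspondence well defined and injective on
stable classes. -/
lemma IsAdjunct.map_eq_zero_iff {X N : A} {d : cosyzygyObj C X ⟶ N} {a : X ⟶ syzygyObj C N}
    (h : IsAdjunct C d a) : (toStable C).map d = 0 ↔ (toStable C).map a = 0 := by
  obtain ⟨t, ht, hd⟩ := h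
  constructor
  · intro h0
    obtain ⟨P, hP, u, v, rfl⟩ := exists_factorization_of_toStable_map_eq_zero h0
    obtain ⟨v, rfl⟩ := rightApprox_isRelEpi C N hP v
    obtain ⟨y, hy⟩ := exists_syzygyι_lift C N (t + cosyzygyπ C X ≫ u ≫ v) (by
      rw [Preadditive.add_comp, Category.assoc, Category.assoc, hd, add_neg_cancel])
    refine toStable_map_eq_zero (leftApproxObj_mem C X) (leftApprox C X) y ?_
    rw [← cancel_mono (syzygyι C N), Category.assoc, hy, Preadditive.comp_add, ← Category.assoc _
      (cosyzygyπ C X), comp_cosyzygyπ, zero_comp, add_zero, ht]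
  · intro h0
    obtain ⟨P, hP, u, v, rfl⟩ := exists_factorization_of_toStable_map_eq_zero h0
    obtain ⟨u, rfl⟩ := leftApprox_isRelMono C X hP u
    obtain ⟨x, hx⟩ := exists_cosyzygyπ_desc C X (t - u ≫ v ≫ syzygyι C N) (by
      rw [Preadditive.comp_sub, ht]
      simp)
    refine toStable_map_eq_zero (rightApproxObj_mem C N) (-x) (rightApprox C N) ?_
    rw [← cancel_epi (cosyzygyπ C X), hd, Preadditive.neg_comp, Preadditive.comp_neg,
      ← Category.assoc, hx]
    simp

lemma IsAdjunct.map_eq_iff {X N : A} {d d' : cosyzygyObj C X ⟶ N} {a a' : X ⟶ syzygyObj C N}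
    (h : IsAdjunct C d a) (h' : IsAdjunct C d' a') :
    (toStable C).map d = (toStable C).map d' ↔ (toStable C).map a = (toStable C).map a' := by
  rw [← sub_eq_zero, ← Functor.map_sub, (h.sub h').map_eq_zero_iff, Functor.map_sub, sub_eq_zero]

lemma IsAdjunct.precomp {X X' N : A} {d : cosyzygyObj C X ⟶ N} {a : X ⟶ syzygyObj C N}
    (h : IsAdjunct C d a) {f : X' ⟶ X} {k : cosyzygyObj C X' ⟶ cosyzygyObj C X}
    (hk : IsCosyzygyMap C f k) : IsAdjunct C (k ≫ d) (f ≫ a) := by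
  obtain ⟨t, ht, hd⟩ := h
  obtain ⟨s, hs, hs'⟩ := hk
  exact ⟨s ≫ t, by rw [reassoc_of% hs, ht, Category.assoc], by
    rw [reassoc_of% hs', hd, Preadditive.comp_neg, Category.assoc]⟩

lemma IsAdjunct.postcomp {X N N' : A} {d : cosyzygyObj C X ⟶ N} {a : X ⟶ syzygyObj C N}
    (h : IsAdjunct C d a) {f : N ⟶ N'} {k : syzygyObj C N ⟶ syzygyObj C N'}
    (hk : IsSyzygyMap C f k) : IsAdjunct C (d ≫ f) (a ≫ k) := by
  obtain ⟨t, ht, hd⟩ := h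
  obtain ⟨s, hs, hs'⟩ := hk
  exact ⟨t ≫ s, by rw [reassoc_of% ht, Category.assoc, hs'], by
    rw [reassoc_of% hd, Preadditive.neg_comp, Category.assoc, Category.assoc, hs]⟩

variable (C) in
/-- The morphism `Σ X ⟶ N` in `A/C` given by a morphism from the cokernel of the left
`C`-approximation of `X`. -/
def ofSusp {X N : A} (d : cosyzygyObj C X ⟶ N) :
    (cosyzygy C).obj ((toStable C).obj X) ⟶ (toStable C).obj N := (toStable C).map d

variable (C) in
/-- The morphism `X ⟶ Ω N` in `A/C` given by a morphism to the kernel of the right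
`C`-approximation of `N`. -/
def toLoop {X N : A} (a : X ⟶ syzygyObj C N) :
    (toStable C).obj X ⟶ (syzygy C).obj ((toStable C).obj N) := (toStable C).map a

lemma ofSusp_surjective {X N : A}
    (d : (cosyzygy C).obj ((toStable C).obj X) ⟶ (toStable C).obj N) :
    ∃ d' : cosyzygyObj C X ⟶ N, ofSusp C d' = d :=
  (toStable C).map_surjective (X := cosyzygyObj C X) (Y := N) d

lemma toLoop_surjective {X N : A}
    (a : (toStable C).obj X ⟶ (syzygy C).obj ((toStable C).obj N)) :
    ∃ a' : X ⟶ syzygyObj C N, toLoop C a' = a :=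
  (toStable C).map_surjective (X := X) (Y := syzygyObj C N) a

lemma toSusp_comp_ofSusp {X Z N : A} (h : Z ⟶ cosyzygyObj C X) (d : cosyzygyObj C X ⟶ N) :
    toSusp C h ≫ ofSusp C d = (toStable C).map (h ≫ d) := ((toStable C).map_comp h d).symm

lemma toLoop_comp_ofLoop {X Z N : A} (a : X ⟶ syzygyObj C N) (h : syzygyObj C N ⟶ Z) :
    toLoop C a ≫ ofLoop C h = (toStable C).map (a ≫ h) := ((toStable C).map_comp a h).symm

lemma cosyzygy_map_comp_ofSusp {X X' N : A} {f : X' ⟶ X}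
    {k : cosyzygyObj C X' ⟶ cosyzygyObj C X} (hk : IsCosyzygyMap C f k)
    (d : cosyzygyObj C X ⟶ N) :
    (cosyzygy C).map ((toStable C).map f) ≫ ofSusp C d = ofSusp C (k ≫ d) := by
  rw [cosyzygy_map_eq C hk]
  exact ((toStable C).map_comp k d).symm

lemma toLoop_comp_syzygy_map {X N N' : A} {f : N ⟶ N'}
    {k : syzygyObj C N ⟶ syzygyObj C N'} (hk : IsSyzygyMap C f k)
    (a : X ⟶ syzygyObj C N) :
    toLoop C a ≫ (syzygy C).map ((toStable C).map f) = toLoop C (a ≫ k) := by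
  rw [syzygy_map_eq C hk]
  exact ((toStable C).map_comp a k).symm

lemma ofSusp_comp_toStable_map {X N N' : A} (d : cosyzygyObj C X ⟶ N) (f : N ⟶ N') :
    ofSusp C d ≫ (toStable C).map f = ofSusp C (d ≫ f) := ((toStable C).map_comp d f).symm

lemma toStable_map_comp_toLoop {X X' N : A} (f : X' ⟶ X) (a : X ⟶ syzygyObj C N) :
    (toStable C).map f ≫ toLoop C a = toLoop C (f ≫ a) := ((toStable C).map_comp f a).symm

/-- The bijection between morphisms `Σ X ⟶ N` and morphisms `X ⟶ Ω N`. -/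
def stableHomEquiv (X N : A) :
    ((cosyzygy C).obj ((toStable C).obj X) ⟶ (toStable C).obj N) ≃
      ((toStable C).obj X ⟶ (syzygy C).obj ((toStable C).obj N)) :=
  Equiv.ofBijective
    -- Any two adjuncts of stably equal morphisms are stably equal, so the choice of an adjunct does
    -- not matter; the converse implication gives injectivity.
    (Quot.lift (fun d => toLoop C (exists_isAdjunct_right (X := X) d).choose) fun d d' h =>
      ((exists_isAdjunct_right d).choose_spec.map_eq_iff
        (exists_isAdjunct_right d').choose_spec).1 (Quot.sound h))
    ⟨by
      rintro ⟨d⟩ ⟨d'⟩ h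
      exact ((exists_isAdjunct_right (X := X) d).choose_spec.map_eq_iff
        (exists_isAdjunct_right d').choose_spec).2 h, by
      intro a
      obtain ⟨a, rfl⟩ := toLoop_surjective a
      obtain ⟨d, hd⟩ := exists_isAdjunct_left a
      exact ⟨ofSusp C d, ((exists_isAdjunct_right d).choose_spec.map_eq_iff hd).1 rfl⟩⟩

lemma IsAdjunct.stableHomEquiv_eq {X N : A} {d : cosyzygyObj C X ⟶ N} {a : X ⟶ syzygyObj C N}
    (h : IsAdjunct C d a) : stableHomEquiv X N (ofSusp C d) = toLoop C a :=
  ((exists_isAdjunct_right d).choose_spec.map_eq_iff h).1 rfl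

lemma IsAdjunct.stableHomEquiv_symm_eq {X N : A} {d : cosyzygyObj C X ⟶ N}
    {a : X ⟶ syzygyObj C N} (h : IsAdjunct C d a) :
    (stableHomEquiv X N).symm (toLoop C a) = ofSusp C d :=
  (Equiv.symm_apply_eq _).2 h.stableHomEquiv_eq.symm

variable (C) in
/-- The adjunction between `Σ` and `Ω`. -/
def stableAdjunction : cosyzygy C ⊣ syzygy C :=
  Adjunction.mkOfHomEquiv
    { homEquiv := fun X N => stableHomEquiv X.as N.as
      homEquiv_naturality_left_symm := by
        rintro ⟨X'⟩ ⟨X⟩ ⟨N⟩ f a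
        change (stableHomEquiv X' N).symm _ = _ ≫ (stableHomEquiv X N).symm _
        obtain ⟨f, rfl⟩ := (toStable C).map_surjective (X := X') (Y := X) f
        obtain ⟨a, rfl⟩ := toLoop_surjective (X := X) (N := N) a
        obtain ⟨d, hd⟩ := exists_isAdjunct_left a
        obtain ⟨k, hk⟩ := exists_isCosyzygyMap C f
        refine Eq.trans (congrArg _ (toStable_map_comp_toLoop f a)) ?_
        rw [hd.stableHomEquiv_symm_eq, (hd.precomp hk).stableHomEquiv_symm_eq]
        exact (cosyzygy_map_comp_ofSusp hk d).symm
      homEquiv_naturality_right := by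
        rintro ⟨X⟩ ⟨N⟩ ⟨N'⟩ d f
        change stableHomEquiv X N' _ = stableHomEquiv X N _ ≫ _
        obtain ⟨f, rfl⟩ := (toStable C).map_surjective (X := N) (Y := N') f
        obtain ⟨d, rfl⟩ := ofSusp_surjective (X := X) (N := N) d
        obtain ⟨a, ha⟩ := exists_isAdjunct_right d
        obtain ⟨k, hk⟩ := exists_isSyzygyMap C f
        refine Eq.trans (congrArg _ (ofSusp_comp_toStable_map d f)) ?_
        rw [ha.stableHomEquiv_eq, (ha.postcomp hk).stableHomEquiv_eq]
        exact (toLoop_comp_syzygy_map hk a).symm }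

lemma stableAdjunction_homEquiv (X N : A) :
    (stableAdjunction C).homEquiv ((toStable C).obj X) ((toStable C).obj N) =
      stableHomEquiv X N := by
  rw [stableAdjunction, Adjunction.mkOfHomEquiv_homEquiv]
  rfl

lemma exists_isAdjunct_of_hom {X N : A}
    (a : (toStable C).obj X ⟶ (syzygy C).obj ((toStable C).obj N)) :
    ∃ (d₀ : cosyzygyObj C X ⟶ N) (a₀ : X ⟶ syzygyObj C N), IsAdjunct C d₀ a₀ ∧
      toLoop C a₀ = a ∧
      ((stableAdjunction C).homEquiv _ _).symm a = ofSusp C d₀ := by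
  obtain ⟨a, rfl⟩ := toLoop_surjective a
  obtain ⟨d, hd⟩ := exists_isAdjunct_left a
  refine ⟨d, a, hd, rfl, ?_⟩
  rw [stableAdjunction_homEquiv]
  exact hd.stableHomEquiv_symm_eq

lemma exists_isAdjunct_of_hom' {X N : A}
    (d : (cosyzygy C).obj ((toStable C).obj X) ⟶ (toStable C).obj N) :
    ∃ (d₀ : cosyzygyObj C X ⟶ N) (a₀ : X ⟶ syzygyObj C N), IsAdjunct C d₀ a₀ ∧
      ofSusp C d₀ = d ∧
      (stableAdjunction C).homEquiv _ _ d = toLoop C a₀ := by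
  obtain ⟨d, rfl⟩ := ofSusp_surjective d
  obtain ⟨a, ha⟩ := exists_isAdjunct_right d
  refine ⟨d, a, ha, rfl, ?_⟩
  rw [stableAdjunction_homEquiv]
  exact ha.stableHomEquiv_eq

/-- After making the given square strict, `b' ≫ g'` and the route through `C^X ⟶ C_N` agree on `X`,
so their difference descends to `c`. The second route is stably zero, and it contributes `-(t ≫
rightApprox C N)`; the sign in `IsAdjunct` is chosen to cancel this. -/
lemma IsAdjunct.exists_glue_right {X Y Z X' Y' N : A} {f : X ⟶ Y} {g : Y ⟶ Z}
    {h : Z ⟶ cosyzygyObj C X} (H : IsStandardRightTriangle C f g h)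
    {h' : syzygyObj C N ⟶ X'} {g' : X' ⟶ Y'} {f' : Y' ⟶ N}
    (H' : IsStandardLeftTriangle C h' g' f') {d : cosyzygyObj C X ⟶ N} {a : X ⟶ syzygyObj C N}
    (hda : IsAdjunct C d a) {b : Y ⟶ X'}
    (w : (toStable C).map (f ≫ b) = (toStable C).map (a ≫ h')) :
    ∃ c : Z ⟶ Y', (toStable C).map (g ≫ c) = (toStable C).map (b ≫ g') ∧ c ≫ f' = h ≫ d := by
  obtain ⟨b', hb', w'⟩ := exists_comp_eq_of_isRelMono H.isRelMono w
  obtain ⟨l, hl, hl'⟩ := H.exists_extension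
  obtain ⟨m, hm, hm'⟩ := H'.exists_coextension
  obtain ⟨t, ht, hd⟩ := hda
  obtain ⟨c, hc⟩ := H.exists_desc (b' ≫ g' - l ≫ t ≫ m) (by
    rw [Preadditive.comp_sub, reassoc_of% w', reassoc_of% hl, reassoc_of% ht, hm', sub_self])
  refine ⟨c, ?_, ?_⟩
  · rw [Functor.map_comp _ b, ← hb', ← Functor.map_comp]
    exact toStable_map_eq _ (leftApproxObj_mem C X) (-l) (t ≫ m) (by rw [hc]; simp)
  · have := H.epi
    rw [← cancel_epi g, reassoc_of% hc, reassoc_of% hl', hd]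
    simp [H'.zero, hm]

/-- Dual argument: `g ≫ c'` plus the route through `C^X ⟶ C_N` vanishes in `N`, again because of the
sign in `IsAdjunct`, and so lifts to `X'`. -/
lemma IsAdjunct.exists_glue_left {X Y Z X' Y' N : A} {f : X ⟶ Y} {g : Y ⟶ Z}
    {h : Z ⟶ cosyzygyObj C X} (H : IsStandardRightTriangle C f g h)
    {h' : syzygyObj C N ⟶ X'} {g' : X' ⟶ Y'} {f' : Y' ⟶ N}
    (H' : IsStandardLeftTriangle C h' g' f') {d : cosyzygyObj C X ⟶ N} {a : X ⟶ syzygyObj C N}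
    (hda : IsAdjunct C d a) {c : Z ⟶ Y'}
    (w : (toStable C).map (c ≫ f') = (toStable C).map (h ≫ d)) :
    ∃ b : Y ⟶ X', (toStable C).map (b ≫ g') = (toStable C).map (g ≫ c) ∧ f ≫ b = a ≫ h' := by
  obtain ⟨c', hc', w'⟩ := exists_comp_eq_of_isRelEpi H'.isRelEpi w
  obtain ⟨l, hl, hl'⟩ := H.exists_extension
  obtain ⟨m, hm, hm'⟩ := H'.exists_coextension
  obtain ⟨t, ht, hd⟩ := hda
  obtain ⟨b, hb⟩ := H'.exists_lift (g ≫ c' + l ≫ t ≫ m) (by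
    rw [Preadditive.add_comp, Category.assoc, w', reassoc_of% hl', hd]
    simp [hm])
  refine ⟨b, ?_, ?_⟩
  · rw [Functor.map_comp _ g, ← hc', ← Functor.map_comp]
    exact toStable_map_eq _ (leftApproxObj_mem C X) l (t ≫ m) (by rw [hb]; simp)
  · have := H'.mono
    rw [← cancel_mono g', Category.assoc, hb, Category.assoc, hm', Preadditive.comp_add,
      reassoc_of% H.zero, zero_comp, zero_add, reassoc_of% hl, reassoc_of% ht]

variable (C) in
/-- The pretriangulated structure of a stable category. -/
theorem isPretriangulated_stable :
    IsPretriangulated (stableAdjunction C) (stableLeftTriangles C) (stableRightTriangles C) where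
  left := stableLeftTriangles_isLeftTriangulated C
  right := stableRightTriangles_isRightTriangulated C
  glue_right {X Y Z X' Y' N} f g h h' g' f' hT hT' a b w := by
    obtain ⟨X₁, Y₁, Z₁, f₁, g₁, h₁, e₁, e₂, e₃, H₁, p₁, p₂, p₃⟩ :=
      exists_isStandardRightTriangle hT
    obtain ⟨X₁', Y₁', N₁, h₁', g₁', f₁', e₁', e₂', e₃', H₁', p₁', p₂', p₃'⟩ :=
      exists_isStandardLeftTriangle hT'
    have hΩ : (syzygy C).map e₃'.inv ≫ (syzygy C).map e₃'.hom = 𝟙 _ :=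
      ((syzygy C).mapIso e₃').inv_hom_id
    obtain ⟨d₁, a₁, hda, ha₁, hd₁⟩ := exists_isAdjunct_of_hom
      (e₁.hom ≫ a ≫ (syzygy C).map e₃'.inv)
    obtain ⟨b₁, hb₁⟩ := (toStable C).map_surjective (e₂.hom ≫ b ≫ e₁'.inv)
    have hw : (toStable C).map (f₁ ≫ b₁) = (toStable C).map (a₁ ≫ h₁') := by
      rw [Functor.map_comp, hb₁, reassoc_of% p₁, reassoc_of% w, ← toLoop_comp_ofLoop, ha₁,
        ← cancel_mono e₁'.hom]
      simp only [Category.assoc, Iso.inv_hom_id, Category.comp_id, p₁']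
      rw [← Category.assoc ((syzygy C).map e₃'.inv), hΩ, Category.id_comp]
    obtain ⟨c₁, hc₁, hc₁'⟩ := hda.exists_glue_right H₁ H₁' hw
    refine ⟨e₃.inv ≫ (toStable C).map c₁ ≫ e₂'.hom, ?_, ?_⟩
    · rw [← cancel_epi e₂.hom, ← reassoc_of% p₂, Iso.hom_inv_id_assoc, ← Functor.map_comp_assoc,
        hc₁, Functor.map_comp, hb₁]
      simp [p₂']
    -- The adjunct was formed after conjugating `a` into the standard triangles; naturality of the
    -- counit undoes the conjugation.
    · have hd₂ : ofSusp C d₁ ≫ e₃'.hom =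
          (cosyzygy C).map e₁.hom ≫ (cosyzygy C).map a ≫ (stableAdjunction C).counit.app N := by
        rw [← hd₁, Adjunction.homEquiv_counit]
        simp
      rw [← cancel_epi e₃.hom, ← reassoc_of% p₃, ← hd₂]
      simp only [Category.assoc, Iso.hom_inv_id_assoc]
      rw [← p₃', ← Functor.map_comp_assoc, hc₁', ← toSusp_comp_ofSusp, Category.assoc]
  glue_left {X Y Z X' Y' N} f g h h' g' f' hT hT' c d w := by
    obtain ⟨X₁, Y₁, Z₁, f₁, g₁, h₁, e₁, e₂, e₃, H₁, p₁, p₂, p₃⟩ :=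
      exists_isStandardRightTriangle hT
    obtain ⟨X₁', Y₁', N₁, h₁', g₁', f₁', e₁', e₂', e₃', H₁', p₁', p₂', p₃'⟩ :=
      exists_isStandardLeftTriangle hT'
    have hΩ : (syzygy C).map e₃'.inv ≫ (syzygy C).map e₃'.hom = 𝟙 _ :=
      ((syzygy C).mapIso e₃').inv_hom_id
    obtain ⟨d₁, a₁, hda, hd₁, ha₁⟩ := exists_isAdjunct_of_hom'
      ((cosyzygy C).map e₁.hom ≫ d ≫ e₃'.inv)
    obtain ⟨c₁, hc₁⟩ := (toStable C).map_surjective (e₃.hom ≫ c ≫ e₂'.inv)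
    obtain ⟨b₁, hb₁, hb₁'⟩ := hda.exists_glue_left H₁ H₁' (c := c₁) (by
      rw [Functor.map_comp, hc₁, ← toSusp_comp_ofSusp, hd₁, reassoc_of% p₃, reassoc_of% w,
        ← cancel_mono e₃'.hom]
      simp [p₃'])
    refine ⟨e₂.inv ≫ (toStable C).map b₁ ≫ e₁'.hom, ?_, ?_⟩
    · rw [← cancel_epi e₂.hom, ← reassoc_of% p₂]
      simp only [Category.assoc, Iso.hom_inv_id_assoc]
      rw [← p₂', ← Functor.map_comp_assoc, hb₁, Functor.map_comp, hc₁]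
      simp
    · rw [← cancel_epi e₁.hom, ← reassoc_of% p₁, Iso.hom_inv_id_assoc, ← Functor.map_comp_assoc,
        hb₁', ← toLoop_comp_ofLoop, ← ha₁, Adjunction.homEquiv_unit]
      simp [p₁', reassoc_of% hΩ]

end StablePretriangulated

/-! ### Short exact sequences -/

section ShortExact

variable {A : Type u} [Category.{v} A] [Abelian A]

/-- `0 ⟶ K ⟶ E ⟶ M ⟶ 0` is a short exact sequence. -/
def IsShortExact {K E M : A} (i : K ⟶ E) (p : E ⟶ M) : Prop :=
  ∃ zero : i ≫ p = 0, (ShortComplex.mk i p zero).ShortExact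

namespace IsShortExact

variable {K E M : A} {i : K ⟶ E} {p : E ⟶ M}

lemma zero (h : IsShortExact i p) : i ≫ p = 0 := h.choose

lemma mono (h : IsShortExact i p) : Mono i := h.choose_spec.mono_f

lemma epi (h : IsShortExact i p) : Epi p := h.choose_spec.epi_g

lemma exists_lift (h : IsShortExact i p) {W : A} (φ : W ⟶ E) (hφ : φ ≫ p = 0) :
    ∃ ψ : W ⟶ K, ψ ≫ i = φ :=
  have := h.mono
  ⟨h.choose_spec.exact.lift φ hφ, h.choose_spec.exact.lift_f _ _⟩

lemma exists_desc (h : IsShortExact i p) {W : A} (φ : E ⟶ W) (hφ : i ≫ φ = 0) :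
    ∃ ψ : M ⟶ W, p ≫ ψ = φ :=
  have := h.epi
  ⟨h.choose_spec.exact.desc φ hφ, h.choose_spec.exact.g_desc _ _⟩

lemma of_lift (zero : i ≫ p = 0) (hi : Mono i) (hp : Epi p)
    (H : ∀ ⦃W : A⦄ (φ : W ⟶ E), φ ≫ p = 0 → ∃ ψ : W ⟶ K, ψ ≫ i = φ) : IsShortExact i p :=
  ⟨zero, { exact := ShortComplex.exact_of_f_is_kernel _
            (((nonempty_isLimit_kernelFork_iff zero).2 ⟨hi, H⟩).some) }⟩

lemma of_desc (zero : i ≫ p = 0) (hi : Mono i) (hp : Epi p)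
    (H : ∀ ⦃W : A⦄ (φ : E ⟶ W), i ≫ φ = 0 → ∃ ψ : M ⟶ W, p ≫ ψ = φ) : IsShortExact i p :=
  ⟨zero, { exact := ShortComplex.exact_of_g_is_cokernel _
            (((nonempty_isColimit_cokernelCofork_iff zero).2 ⟨hp, H⟩).some) }⟩

lemma of_mono (i : K ⟶ E) [Mono i] : IsShortExact i (cokernel.π i) :=
  of_desc (cokernel.condition i) inferInstance inferInstance
    fun _ φ hφ => ⟨cokernel.desc i φ hφ, cokernel.π_desc _ _ _⟩

lemma of_epi (p : E ⟶ M) [Epi p] : IsShortExact (kernel.ι p) p :=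
  of_lift (kernel.condition p) inferInstance inferInstance
    fun _ φ hφ => ⟨kernel.lift p φ hφ, kernel.lift_ι _ _ _⟩

lemma inl_snd (M N : A) : IsShortExact (biprod.inl : M ⟶ M ⊞ N) biprod.snd :=
  of_lift (by simp) inferInstance inferInstance fun W φ hφ => ⟨φ ≫ biprod.fst, by
    ext <;> simp [hφ]⟩

lemma exists_iso_cokernel (h : IsShortExact i p) : Nonempty (cokernel i ≅ M) := by
  have := h.mono
  have := h.epi
  obtain ⟨ψ, hψ⟩ := h.exists_desc (cokernel.π i) (cokernel.condition i)
  exact ⟨{ hom := cokernel.desc i p h.zero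
           inv := ψ
           hom_inv_id := by rw [← cancel_epi (cokernel.π i)]; simp [hψ]
           inv_hom_id := by rw [← cancel_epi p]; simp [reassoc_of% hψ] }⟩

lemma exists_iso_kernel (h : IsShortExact i p) : Nonempty (K ≅ kernel p) := by
  have := h.mono
  have := h.epi
  obtain ⟨ψ, hψ⟩ := h.exists_lift (kernel.ι p) (kernel.condition p)
  exact ⟨{ hom := kernel.lift p i h.zero
           inv := ψ
           hom_inv_id := by rw [← cancel_mono i]; simp [hψ]
           inv_hom_id := by rw [← cancel_mono (kernel.ι p)]; simp [hψ] }⟩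

/-- A morphism `E' ⟶ E` from a short exact sequence `K' ⟶ E' ⟶ M` to `K ⟶ E ⟶ M`
gives a short exact sequence `K' ⟶ K ⊞ E' ⟶ E`. -/
lemma rotate_left (h : IsShortExact i p) {K' E' : A} {i' : K' ⟶ E'} {p' : E' ⟶ M}
    (h' : IsShortExact i' p') {l : E' ⟶ E} (hl : l ≫ p = p') {t : K' ⟶ K}
    (ht : t ≫ i = -(i' ≫ l)) : IsShortExact (biprod.lift t i') (biprod.desc i l) := by
  have := h.mono
  have := h'.mono
  have := h'.epi
  refine of_lift (by simp [ht]) ?_ ?_ ?_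
  · have : Mono (biprod.lift t i' ≫ biprod.snd) := by rwa [biprod.lift_snd]
    exact mono_of_mono _ biprod.snd
  · refine Preadditive.epi_of_cancel_zero _ fun {W} φ hφ => ?_
    have h₁ : i ≫ φ = 0 := by simpa using biprod.inl ≫= hφ
    have h₂ : l ≫ φ = 0 := by simpa using biprod.inr ≫= hφ
    obtain ⟨ψ, rfl⟩ := h.exists_desc φ h₁
    rw [reassoc_of% hl, ← comp_zero (X := E') (Y := M), cancel_epi] at h₂
    rw [h₂, comp_zero]
  · intro W φ hφ
    have h0 : (φ ≫ biprod.fst) ≫ i + (φ ≫ biprod.snd) ≫ l = 0 := by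
      simpa only [biprod.desc_eq, Preadditive.comp_add, Category.assoc] using hφ
    have h1 : (φ ≫ biprod.snd) ≫ p' = 0 := by
      have := h0 =≫ p
      simpa only [Preadditive.add_comp, Category.assoc, h.zero, hl, comp_zero, zero_add,
        zero_comp] using this
    obtain ⟨ψ, hψ⟩ := h'.exists_lift _ h1
    refine ⟨ψ, ?_⟩
    ext
    · rw [← cancel_mono i, Category.assoc ψ, biprod.lift_fst, Category.assoc, ht,
        Preadditive.comp_neg, reassoc_of% hψ, neg_eq_iff_add_eq_zero, add_comm]
      simpa only [Category.assoc] using h0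
    · simp [hψ]

lemma exists_rotate_left (h : IsShortExact i p) {K' E' : A} {i' : K' ⟶ E'} {p' : E' ⟶ M}
    (h' : IsShortExact i' p') {l : E' ⟶ E} (hl : l ≫ p = p') :
    ∃ t : K' ⟶ K, IsShortExact (biprod.lift t i') (biprod.desc i l) := by
  obtain ⟨t, ht⟩ := h.exists_lift (-(i' ≫ l)) (by simp [hl, h'.zero])
  exact ⟨t, h.rotate_left h' hl ht⟩

/-- A morphism `E ⟶ E'` from a short exact sequence `K ⟶ E ⟶ M` to `K ⟶ E' ⟶ M'`
gives a short exact sequence `E ⟶ M ⊞ E' ⟶ M'`. -/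
lemma rotate_right (h : IsShortExact i p) {E' M' : A} {i' : K ⟶ E'} {p' : E' ⟶ M'}
    (h' : IsShortExact i' p') {l : E ⟶ E'} (hl : i ≫ l = i') {t : M ⟶ M'}
    (ht : p ≫ t = -(l ≫ p')) : IsShortExact (biprod.lift p l) (biprod.desc t p') := by
  have := h.epi
  have := h'.epi
  have := h'.mono
  refine of_desc (by simp [ht]) ?_ ?_ ?_
  · refine Preadditive.mono_of_cancel_zero _ fun {W} φ hφ => ?_
    have h₁ : φ ≫ p = 0 := by simpa using hφ =≫ biprod.fst
    have h₂ : φ ≫ l = 0 := by simpa using hφ =≫ biprod.snd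
    obtain ⟨ψ, rfl⟩ := h.exists_lift φ h₁
    rw [Category.assoc, hl, ← zero_comp (Y := K) (Z := E'), cancel_mono] at h₂
    rw [h₂, zero_comp]
  · have : Epi (biprod.inr ≫ biprod.desc t p') := by rwa [biprod.inr_desc]
    exact epi_of_epi biprod.inr _
  · intro W φ hφ
    have h0 : p ≫ biprod.inl ≫ φ + l ≫ biprod.inr ≫ φ = 0 := by
      simpa only [biprod.lift_eq, Preadditive.add_comp, Category.assoc] using hφ
    have h1 : i' ≫ biprod.inr ≫ φ = 0 := by
      have := i ≫= h0
      simpa [reassoc_of% h.zero, reassoc_of% hl] using this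
    obtain ⟨ψ, hψ⟩ := h'.exists_desc _ h1
    refine ⟨ψ, ?_⟩
    ext
    · rw [← cancel_epi p, biprod.inl_desc_assoc, reassoc_of% ht, Preadditive.neg_comp,
        Category.assoc, hψ, neg_eq_iff_add_eq_zero, add_comm, h0]
    · simp [hψ]

lemma exists_rotate_right (h : IsShortExact i p) {E' M' : A} {i' : K ⟶ E'} {p' : E' ⟶ M'}
    (h' : IsShortExact i' p') {l : E ⟶ E'} (hl : i ≫ l = i') :
    ∃ t : M ⟶ M', IsShortExact (biprod.lift p l) (biprod.desc t p') := by
  obtain ⟨t, ht⟩ := h.exists_desc (-(l ≫ p')) (by simp [reassoc_of% hl, h'.zero])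
  exact ⟨t, h.rotate_right h' hl ht⟩

/-- The pushout of two short exact sequences with the same kernel. -/
lemma exists_pushout (h : IsShortExact i p) {E' M' : A} {i' : K ⟶ E'} {p' : E' ⟶ M'}
    (h' : IsShortExact i' p') :
    ∃ (N : A) (a : E ⟶ N) (b : E' ⟶ N) (q : N ⟶ M) (q' : N ⟶ M'),
      IsShortExact b q ∧ IsShortExact a q' ∧ a ≫ q = p := by
  have := h.mono
  have := h'.mono
  have := h.epi
  have := h'.epi
  have hk : Mono (biprod.lift i i') := by
    have : Mono (biprod.lift i i' ≫ biprod.fst) := by rwa [biprod.lift_fst]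
    exact mono_of_mono _ biprod.fst
  have H := of_mono (biprod.lift i i')
  set π := cokernel.π (biprod.lift i i')
  -- Without a sign in `(i, i')` the pushout square anticommutes. This is harmless, as only the two
  -- exact sequences and `a ≫ q = p` are used.
  have w : i ≫ biprod.inl ≫ π + i' ≫ biprod.inr ≫ π = 0 := by
    simpa only [biprod.lift_eq, Preadditive.add_comp, Category.assoc] using H.zero
  obtain ⟨q, hq⟩ := H.exists_desc (biprod.desc p 0) (by simp [h.zero])
  obtain ⟨q', hq'⟩ := H.exists_desc (biprod.desc 0 p') (by simp [h'.zero])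
  have ha : biprod.inl ≫ π ≫ q = p := by simp [hq]
  have hb : biprod.inr ≫ π ≫ q' = p' := by simp [hq']
  refine ⟨_, biprod.inl ≫ π, biprod.inr ≫ π, q, q', ?_, ?_, by simpa using ha⟩
  · refine of_desc (by simp [hq]) ?_ ?_ ?_
    · refine Preadditive.mono_of_cancel_zero _ fun {W} φ hφ => ?_
      obtain ⟨ψ, hψ⟩ := H.exists_lift (φ ≫ biprod.inr) (by simpa using hφ)
      have h₁ : ψ ≫ i = 0 := by simpa using hψ =≫ biprod.fst
      have h₂ : ψ ≫ i' = φ := by simpa using hψ =≫ biprod.snd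
      rw [← zero_comp (Y := K) (Z := E), cancel_mono] at h₁
      rw [← h₂, h₁, zero_comp]
    · have : Epi (biprod.inl ≫ π ≫ q) := by rwa [ha]
      have : Epi (π ≫ q) := epi_of_epi biprod.inl _
      exact epi_of_epi π q
    · intro W φ hφ
      rw [Category.assoc] at hφ
      obtain ⟨ψ, hψ⟩ := h.exists_desc (biprod.inl ≫ π ≫ φ) (by
        simpa [hφ] using w =≫ φ)
      refine ⟨ψ, ?_⟩
      rw [← cancel_epi π]
      ext
      · rw [reassoc_of% ha, hψ]
      · rw [hφ, reassoc_of% hq]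
        simp
  · refine of_desc (by simp [hq']) ?_ ?_ ?_
    · refine Preadditive.mono_of_cancel_zero _ fun {W} φ hφ => ?_
      obtain ⟨ψ, hψ⟩ := H.exists_lift (φ ≫ biprod.inl) (by simpa using hφ)
      have h₁ : ψ ≫ i' = 0 := by simpa using hψ =≫ biprod.snd
      have h₂ : ψ ≫ i = φ := by simpa using hψ =≫ biprod.fst
      rw [← zero_comp (Y := K) (Z := E'), cancel_mono] at h₁
      rw [← h₂, h₁, zero_comp]
    · have : Epi (biprod.inr ≫ π ≫ q') := by rwa [hb]
      have : Epi (π ≫ q') := epi_of_epi biprod.inr _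
      exact epi_of_epi π q'
    · intro W φ hφ
      rw [Category.assoc] at hφ
      obtain ⟨ψ, hψ⟩ := h'.exists_desc (biprod.inr ≫ π ≫ φ) (by
        simpa [hφ] using w =≫ φ)
      refine ⟨ψ, ?_⟩
      rw [← cancel_epi π]
      ext
      · rw [hφ, reassoc_of% hq']
        simp
      · rw [reassoc_of% hb, hψ]

end IsShortExact

end ShortExact

/-! ### Vanishing of `Ext¹` -/

section ExtVanishing

variable {A : Type u} [Category.{v} A] [Abelian A] [HasExt.{w} A]

/-- The group `Ext¹(M, N)` vanishes. -/
def ExtVanishes (M N : A) : Prop := ∀ e : Ext.{w} M N 1, e = 0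

lemma extVanishes_of_projective (M N : A) [Projective M] : ExtVanishes.{w} M N :=
  fun e => Ext.eq_zero_of_projective e

lemma extVanishes_of_injective (M N : A) [Injective N] : ExtVanishes.{w} M N :=
  fun e => Ext.eq_zero_of_injective e

variable {K E M : A} {i : K ⟶ E} {p : E ⟶ M}

lemma ExtVanishes.exists_lift {W : A} (hW : ExtVanishes.{w} W K) (h : IsShortExact i p)
    (φ : W ⟶ M) : ∃ ψ : W ⟶ E, ψ ≫ p = φ := by
  obtain ⟨x, hx⟩ := Ext.covariant_sequence_exact₃ _ h.choose_spec (Ext.mk₀ φ) (n₁ := 1) rfl (hW _)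
  obtain ⟨ψ, rfl⟩ := Ext.addEquiv₀.symm.surjective x
  exact ⟨ψ, Ext.addEquiv₀.symm.injective (by simpa using hx)⟩

lemma ExtVanishes.exists_extension {W : A} (hW : ExtVanishes.{w} M W) (h : IsShortExact i p)
    (φ : K ⟶ W) : ∃ ψ : E ⟶ W, i ≫ ψ = φ := by
  obtain ⟨x, hx⟩ := Ext.contravariant_sequence_exact₁ h.choose_spec _ (Ext.mk₀ φ) (n₁ := 1) rfl
    (hW _)
  obtain ⟨ψ, rfl⟩ := Ext.addEquiv₀.symm.surjective x
  exact ⟨ψ, Ext.addEquiv₀.symm.injective (by simpa using hx)⟩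

/-- As `Ext¹(E, W)` vanishes, every class in `Ext¹(M, W)` comes from a morphism `K ⟶ W`, and
morphisms that extend to `E` give zero. -/
lemma extVanishes_of_exists_extension [Projective E] (h : IsShortExact i p) {W : A}
    (H : ∀ φ : K ⟶ W, ∃ ψ : E ⟶ W, i ≫ ψ = φ) : ExtVanishes.{w} M W := fun e => by
  obtain ⟨x, rfl⟩ := Ext.contravariant_sequence_exact₃ h.choose_spec _ e
    (Ext.eq_zero_of_projective _) (n₀ := 0) rfl
  obtain ⟨φ, rfl⟩ := Ext.addEquiv₀.symm.surjective x
  obtain ⟨ψ, rfl⟩ := H φ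
  have := h.choose_spec.extClass_comp_assoc (Ext.mk₀ ψ) (h := add_zero 1)
  rwa [Ext.mk₀_comp_mk₀] at this

lemma extVanishes_of_exists_lift [Injective E] (h : IsShortExact i p) {W : A}
    (H : ∀ φ : W ⟶ M, ∃ ψ : W ⟶ E, ψ ≫ p = φ) : ExtVanishes.{w} W K := fun e => by
  obtain ⟨x, rfl⟩ := Ext.covariant_sequence_exact₁ _ h.choose_spec e
    (Ext.eq_zero_of_injective _) (n₀ := 0) rfl
  obtain ⟨φ, rfl⟩ := Ext.addEquiv₀.symm.surjective x
  obtain ⟨ψ, rfl⟩ := H φ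
  have := h.choose_spec.comp_extClass
  rw [Ext.addEquiv₀_symm_apply, ← Ext.mk₀_comp_mk₀, Ext.comp_assoc_of_second_deg_zero, this,
    Ext.comp_zero]

lemma ExtVanishes.mid_left {W : A} (h : IsShortExact i p) (h₁ : ExtVanishes.{w} K W)
    (h₂ : ExtVanishes.{w} M W) : ExtVanishes.{w} E W := fun e => by
  obtain ⟨x, rfl⟩ := Ext.contravariant_sequence_exact₂ h.choose_spec _ e (h₁ _)
  rw [h₂ x, Ext.comp_zero]

lemma ExtVanishes.mid_right {W : A} (h : IsShortExact i p) (h₁ : ExtVanishes.{w} W K)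
    (h₂ : ExtVanishes.{w} W M) : ExtVanishes.{w} W E := fun e => by
  obtain ⟨x, rfl⟩ := Ext.covariant_sequence_exact₂ _ h.choose_spec e (h₂ _)
  rw [h₁ x, Ext.zero_comp]

lemma ExtVanishes.retract_left {M N W : A} (h : ExtVanishes.{w} N W) (r : Retract M N) :
    ExtVanishes.{w} M W := fun e => by
  have : (Ext.mk₀ r.i).comp ((Ext.mk₀ r.r).comp e (zero_add 1)) (zero_add 1) = e := by simp
  rw [← this, h (Ext.comp _ _ _), Ext.comp_zero]

lemma ExtVanishes.retract_right {M N W : A} (h : ExtVanishes.{w} W N) (r : Retract M N) :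
    ExtVanishes.{w} W M := fun e => by
  have : (e.comp (Ext.mk₀ r.i) (add_zero 1)).comp (Ext.mk₀ r.r) (add_zero 1) = e := by
    simp [Ext.comp_assoc_of_third_deg_zero]
  rw [← this, h (Ext.comp _ _ _), Ext.zero_comp]

end ExtVanishing

/-! ### Cotorsion pairs -/

section CotorsionPair

variable {A : Type u} [Category.{v} A] [Abelian A]

/-- A class of objects which is closed under retracts and extensions. -/
structure IsClosedUnderRetractsAndExtensions (D : ObjectProperty A) : Prop where
  of_retract : ∀ ⦃M N : A⦄, Retract M N → D N → D M
  of_shortExact : ∀ ⦃K E M : A⦄ ⦃i : K ⟶ E⦄ ⦃p : E ⟶ M⦄, IsShortExact i p → D K → D M → D E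

lemma IsClosedUnderRetractsAndExtensions.of_iso {D : ObjectProperty A}
    (h : IsClosedUnderRetractsAndExtensions D) {M N : A} (e : M ≅ N) (hM : D M) : D N :=
  h.of_retract (Retract.ofIso e.symm) hM

lemma IsClosedUnderRetractsAndExtensions.biprod {D : ObjectProperty A}
    (h : IsClosedUnderRetractsAndExtensions D) {M N : A} (hM : D M) (hN : D N) : D (M ⊞ N) :=
  h.of_shortExact (IsShortExact.inl_snd M N) hM hN

lemma IsResolving.iff {X : ObjectProperty A} (hX : IsResolving X) {K E M : A} {i : K ⟶ E}
    {p : E ⟶ M} (h : IsShortExact i p) (hM : X M) : X E ↔ X K :=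
  hX.iff_of_shortExact _ h.choose_spec hM

namespace IsCotorsionPair

variable [HasExt.{w} A] {U V : ObjectProperty A} (h : IsCotorsionPair.{w} U V)
include h

lemma extVanishes {M N : A} (hM : U M) (hN : V N) : ExtVanishes.{w} M N :=
  (h.left_iff M).1 hM N hN

lemma isClosed_left : IsClosedUnderRetractsAndExtensions U where
  of_retract M N r hN := (h.left_iff M).2 fun _ hK =>
    (h.extVanishes hN hK).retract_left r
  of_shortExact K E M i p hip hK hM := (h.left_iff E).2 fun _ hN =>
    ExtVanishes.mid_left hip (h.extVanishes hK hN) (h.extVanishes hM hN)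

lemma isClosed_right : IsClosedUnderRetractsAndExtensions V where
  of_retract M N r hN := (h.right_iff M).2 fun _ hK =>
    (h.extVanishes hK hN).retract_right r
  of_shortExact K E M i p hip hK hM := (h.right_iff E).2 fun _ hN =>
    ExtVanishes.mid_right hip (h.extVanishes hN hK) (h.extVanishes hN hM)

lemma of_projective (P : A) [Projective P] : U P :=
  (h.left_iff P).2 fun N _ => extVanishes_of_projective P N

lemma of_injective (I : A) [Injective I] : V I :=
  (h.right_iff I).2 fun M _ => extVanishes_of_injective M I

/-- The right class of a hereditary cotorsion pair is closed under cokernels of monomorphisms. -/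
lemma cokernel_mem [EnoughProjectives A] (hU : IsResolving U) {K E M : A} {i : K ⟶ E} {p : E ⟶ M}
    (hip : IsShortExact i p) (hK : V K) (hE : V E) : V M :=
  (h.right_iff M).2 fun W hW => by
    have hP := IsShortExact.of_epi (Projective.π W)
    have hΩ : U (kernel (Projective.π W)) := (hU.iff hP hW).1 (h.of_projective _)
    -- A dimension shift without `Ext²`: a morphism from the syzygy of `W` to `M` lifts to `E`,
    -- since the syzygy is in `U`, and then extends to the projective, since `Ext¹(W, E)` vanishes.
    refine extVanishes_of_exists_extension hP fun φ => ?_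
    obtain ⟨ψ, rfl⟩ := (h.extVanishes hΩ hK).exists_lift hip φ
    obtain ⟨χ, rfl⟩ := (h.extVanishes hW hE).exists_extension hP ψ
    exact ⟨χ ≫ p, by simp⟩

end IsCotorsionPair

end CotorsionPair

/-! ### Full subcategories of right triangulated categories -/

section Restriction

variable {T : Type u} [Category.{v} T] [Preadditive T] [HasZeroObject T]
  {Si : T ⥤ T} {Nab : Set (RightTriangle Si)} (D : ObjectProperty T)

/-- The restriction of an endofunctor to a full subcategory. -/
abbrev restrictFunctor (Si : T ⥤ T) (hD : ∀ X, D X → D (Si.obj X)) :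
    D.FullSubcategory ⥤ D.FullSubcategory :=
  D.lift (D.ι ⋙ Si) fun X => hD X.obj X.property

variable (hD : ∀ X, D X → D (Si.obj X))

/-- The right triangles of a full subcategory. -/
def restrictRightTriangles (Nab : Set (RightTriangle Si)) :
    Set (RightTriangle (restrictFunctor D Si hD)) :=
  {S | RightTriangle.mk (Si := Si) S.f.hom S.g.hom S.h.hom ∈ Nab}

/-- Only existence of cones needs an argument, which is the hypothesis `hD'`. All other axioms
produce morphisms between objects already in `D`, and the subcategory is full. -/
lemma IsRightTriangulated.restrict (H : IsRightTriangulated Si Nab)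
    [HasZeroObject D.FullSubcategory]
    (hD' : ∀ {X Y : T} (f : X ⟶ Y), D X → D Y → ∃ (Z : T) (g : Y ⟶ Z) (h : Z ⟶ Si.obj X),
      D Z ∧ RightTriangle.mk f g h ∈ Nab) :
    IsRightTriangulated (restrictFunctor D Si hD) (restrictRightTriangles D hD Nab) where
  additive := by
    have := H.additive
    exact ⟨fun {X Y f g} => by ext; exact Si.map_add⟩
  isomorphic := by
    rintro S S' ⟨e₁, e₂, e₃, h₁, h₂, h₃⟩ hS
    exact H.isomorphic (RightTriangle.mk S.f.hom S.g.hom S.h.hom) _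
      ⟨D.ι.mapIso e₁, D.ι.mapIso e₂, D.ι.mapIso e₃, D.ι.congr_map h₁,
      D.ι.congr_map h₂, D.ι.congr_map h₃⟩ hS
  contractible M := by
    have hz : IsZero (D.ι.obj 0) := by
      rw [IsZero.iff_id_eq_zero]
      exact D.ι.congr_map ((isZero_zero D.FullSubcategory).eq_of_src (𝟙 0) 0)
    exact H.isomorphic (RightTriangle.mk (0 : 0 ⟶ M.obj) (𝟙 M.obj) (0 : M.obj ⟶ Si.obj 0)) _
      ⟨(isZero_zero T).iso hz, Iso.refl _, Iso.refl _,
      (isZero_zero T).eq_of_src _ _, (Category.comp_id _).trans (Category.id_comp _).symm,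
      zero_comp.trans comp_zero.symm⟩ (H.contractible M.obj)
  exists_triangle {X Y} f := by
    obtain ⟨Z, g, h, hZ, hT⟩ := hD' f.hom X.property Y.property
    exact ⟨⟨Z, hZ⟩, ObjectProperty.homMk g, ObjectProperty.homMk h, hT⟩
  rotate f g h hT := H.rotate _ _ _ hT
  complete_morphism f g h f' g' h' hT hT' a b w := by
    obtain ⟨c, hc, hc'⟩ := H.complete_morphism _ _ _ _ _ _ hT hT' a.hom b.hom (D.ι.congr_map w)
    exact ⟨ObjectProperty.homMk c, by ext; exact hc, by ext; exact hc'⟩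
  octahedron f g a h₁ b h₂ c h₃ t₁ t₂ t₃ := by
    obtain ⟨m, n, hmn, w₁, w₂, w₃, w₄⟩ := H.octahedron _ _ _ _ _ _ _ _ t₁ t₂ t₃
    exact ⟨ObjectProperty.homMk m, ObjectProperty.homMk n, hmn, by ext; exact w₁, by ext; exact w₂,
      by ext; exact w₃, by ext; exact w₄⟩

end Restriction

/-! ### Stable categories of Frobenius subcategories -/

section Frobenius

variable {A : Type u} [Category.{v} A] [Abelian A] (C D : ObjectProperty A)

/-- `D` is closed under retracts and extensions and contains `C`; every object of `D` is
the left term, and the right term, of a short exact sequence in `D` with middle term in `C`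
whose morphisms are a left and a right `C`-approximation. -/
structure IsFrobeniusSubcategory : Prop where
  closed : IsClosedUnderRetractsAndExtensions D
  le : ∀ ⦃M : A⦄, C M → D M
  left : ∀ M : A, D M → ∃ (P E : A) (i : M ⟶ P) (p : P ⟶ E), IsShortExact i p ∧ C P ∧ D E ∧
    IsRelMono C i ∧ IsRelEpi C p
  right : ∀ M : A, D M → ∃ (K P : A) (i : K ⟶ P) (p : P ⟶ M), IsShortExact i p ∧ C P ∧ D K ∧
    IsRelMono C i ∧ IsRelEpi C p

variable {C D} [IsAdditiveSubcategory C] [IsCovariantlyFinite C]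

/-- If `M` has a monomorphic left `C`-approximation, all left `C`-approximations are
monomorphic. -/
lemma isShortExact_cosyzygy {M P : A} (i : M ⟶ P) [Mono i] (hP : C P) :
    IsShortExact (leftApprox C M) (cosyzygyπ C M) := by
  obtain ⟨l, hl⟩ := leftApprox_isRelMono C M hP i
  have : Mono (leftApprox C M ≫ l) := by rwa [hl]
  have : Mono (leftApprox C M) := mono_of_mono _ l
  exact IsShortExact.of_mono (leftApprox C M)

/-- Comparing the left approximation with `i` gives an exact sequence `C^M ⟶ Σ M ⊞ P ⟶ E` whose ends
are in `D`, and `Σ M` is a summand of the middle. -/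
lemma cosyzygyObj_mem (hD : IsClosedUnderRetractsAndExtensions D) (hCD : ∀ ⦃M : A⦄, C M → D M)
    {M P E : A} {i : M ⟶ P} {p : P ⟶ E} (h : IsShortExact i p) (hP : C P) (hE : D E) :
    D (cosyzygyObj C M) := by
  have := h.mono
  obtain ⟨l, hl⟩ := leftApprox_isRelMono C M hP i
  obtain ⟨t, ht⟩ := (isShortExact_cosyzygy (C := C) i hP).exists_rotate_right h hl
  exact hD.of_retract ⟨biprod.inl, biprod.fst, by simp⟩
    (hD.of_shortExact ht (hCD (leftApproxObj_mem C M)) hE)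

/-- Two monomorphic left `C`-approximations have stably isomorphic cokernels, by an isomorphism
induced by a morphism between the approximations. -/
lemma exists_iso_cosyzygy {M P E : A} {i : M ⟶ P} {p : P ⟶ E} (h : IsShortExact i p)
    (hP : C P) (hi : IsRelMono C i) :
    ∃ (l : leftApproxObj C M ⟶ P) (m : P ⟶ leftApproxObj C M) (s : cosyzygyObj C M ⟶ E)
      (t : E ⟶ cosyzygyObj C M) (x : E ⟶ P) (y : cosyzygyObj C M ⟶ leftApproxObj C M),
      cosyzygyπ C M ≫ s = l ≫ p ∧ p ≫ t = m ≫ cosyzygyπ C M ∧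
      t ≫ s - 𝟙 _ = x ≫ p ∧ s ≫ t - 𝟙 _ = y ≫ cosyzygyπ C M := by
  have := h.mono
  have := h.epi
  have h' := isShortExact_cosyzygy (C := C) i hP
  obtain ⟨l, hl⟩ := leftApprox_isRelMono C M hP i
  obtain ⟨m, hm⟩ := hi (leftApproxObj_mem C M) (leftApprox C M)
  obtain ⟨s, hs⟩ := h'.exists_desc (l ≫ p) (by rw [reassoc_of% hl, h.zero])
  obtain ⟨t, ht⟩ := h.exists_desc (m ≫ cosyzygyπ C M) (by rw [reassoc_of% hm, h'.zero])
  obtain ⟨x, hx⟩ := h.exists_desc (m ≫ l - 𝟙 _) (by simp [reassoc_of% hm, hl])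
  obtain ⟨y, hy⟩ := h'.exists_desc (l ≫ m - 𝟙 _) (by simp [reassoc_of% hl, hm])
  refine ⟨l, m, s, t, x, y, hs, ht, ?_, ?_⟩
  · rw [← cancel_epi p, reassoc_of% hx, Preadditive.comp_sub, reassoc_of% ht, hs]
    simp
  · rw [← cancel_epi (cosyzygyπ C M), reassoc_of% hy, Preadditive.comp_sub, reassoc_of% hs, ht]
    simp

/-- Being `C`-epic transfers along the stable isomorphism between `Σ M` and `E`: lift `g ≫ s` along
`p`, return by `m`, and correct with the homotopy `y`. -/
lemma isRelEpi_cosyzygyπ {M P E : A} {i : M ⟶ P} {p : P ⟶ E} (h : IsShortExact i p)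
    (hP : C P) (hi : IsRelMono C i) (hp : IsRelEpi C p) : IsRelEpi C (cosyzygyπ C M) := by
  obtain ⟨l, m, s, t, x, y, hs, ht, hts, hst⟩ := exists_iso_cosyzygy h hP hi
  intro Q hQ g
  obtain ⟨z, hz⟩ := hp hQ (g ≫ s)
  refine ⟨z ≫ m - g ≫ y, ?_⟩
  rw [Preadditive.sub_comp, Category.assoc, Category.assoc, ← ht, reassoc_of% hz, ← hst]
  simp

variable (hD : IsFrobeniusSubcategory C D)
include hD

namespace IsFrobeniusSubcategory

lemma suspension_mem (M : StableCategory C) (hM : stableSubcategory C D M) :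
    stableSubcategory C D ((cosyzygy C).obj M) := by
  obtain ⟨P, E, i, p, h, hP, hE, -, -⟩ := hD.left M.as hM
  exact cosyzygyObj_mem hD.closed hD.le h hP hE

lemma isShortExact_cosyzygy {M : A} (hM : D M) :
    IsShortExact (leftApprox C M) (cosyzygyπ C M) := by
  obtain ⟨P, E, i, p, h, hP, hE, -, -⟩ := hD.left M hM
  have := h.mono
  exact CotorsionTriples.isShortExact_cosyzygy i hP

/-- The cone of a relative monomorphism between objects of `D` is in `D`. -/
lemma mem_of_isRelMono {X Y E : A} {f : X ⟶ Y} {g : Y ⟶ E} (h : IsShortExact f g)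
    (hf : IsRelMono C f) (hX : D X) (hY : D Y) : D E := by
  obtain ⟨P, F, i, p, hip, hP, hF, -, -⟩ := hD.left X hX
  obtain ⟨l, hl⟩ := hf hP i
  -- This yields an exact sequence `Y ⟶ E ⊞ P ⟶ F` with ends in `D`, of which `E` is a summand of
  -- the middle term.
  obtain ⟨t, ht⟩ := h.exists_rotate_right hip hl
  exact hD.closed.of_retract ⟨biprod.inl, biprod.fst, by simp⟩ (hD.closed.of_shortExact ht hY hF)

lemma exists_triangle {X Y : StableCategory C} (f : X ⟶ Y) (hX : stableSubcategory C D X)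
    (hY : stableSubcategory C D Y) :
    ∃ (Z : StableCategory C) (g : Y ⟶ Z) (h : Z ⟶ (cosyzygy C).obj X),
      stableSubcategory C D Z ∧ RightTriangle.mk f g h ∈ stableRightTriangles C := by
  obtain ⟨X⟩ := X
  obtain ⟨Y⟩ := Y
  obtain ⟨f, rfl⟩ := (toStable C).map_surjective (X := X) (Y := Y) f
  have hf := isRelMono_lift_left (C := C) f (leftApprox_isRelMono C X)
  obtain ⟨h, H⟩ := exists_isStandardRightTriangle_of_isRelMono C _ hf
  have : Mono (leftApprox C X) := (hD.isShortExact_cosyzygy hX).mono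
  have : Mono (biprod.lift f (leftApprox C X)) := by
    have : Mono (biprod.lift f (leftApprox C X) ≫ biprod.snd) := by rwa [biprod.lift_snd]
    exact mono_of_mono _ biprod.snd
  refine ⟨_, (stableBiprodIso Y (leftApproxObj_mem C X)).inv ≫ (toStable C).map (cokernel.π _),
    toSusp C h, ?_, stableRightTriangles_mem_of_iso₂ H.mem
      (stableBiprodIso Y (leftApproxObj_mem C X))
      (by rw [stableBiprodIso_hom, ← Functor.map_comp, biprod.lift_fst])
      (by rw [Iso.hom_inv_id_assoc])⟩
  exact hD.mem_of_isRelMono (IsShortExact.of_mono (biprod.lift f (leftApprox C X))) hf hX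
    (hD.closed.biprod hY (hD.le (leftApproxObj_mem C X)))

/-- If the induced `Σ X ⟶ Σ Y` factors through `C`, the second factor lifts to `C^Y` because the
projection onto `Σ Y` is `C`-epic. Correcting `C^X ⟶ C^Y` by this lift makes it land in `Y`, so `f`
factors through `C^X`. -/
lemma map_eq_zero_of_cosyzygy_map_eq_zero {X Y : A} (hX : D X) (hY : D Y) (f : X ⟶ Y)
    (hf : (cosyzygy C).map ((toStable C).map f) = 0) : (toStable C).map f = 0 := by
  obtain ⟨k, t, ht, hk⟩ := exists_isCosyzygyMap C f
  rw [cosyzygy_map_eq C ⟨t, ht, hk⟩] at hf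
  obtain ⟨P, E, i, p, h, hP, hE, hi, hp⟩ := hD.left Y hY
  obtain ⟨Q, hQ, u, v, rfl⟩ := exists_factorization_of_toStable_map_eq_zero hf
  obtain ⟨v, rfl⟩ := isRelEpi_cosyzygyπ h hP hi hp hQ v
  have hY' := hD.isShortExact_cosyzygy hY
  have := hY'.mono
  obtain ⟨y, hy⟩ := hY'.exists_lift (t - cosyzygyπ C X ≫ u ≫ v) (by
    simp [← hk])
  refine toStable_map_eq_zero (leftApproxObj_mem C X) (leftApprox C X) y ?_
  rw [← cancel_mono (leftApprox C Y), Category.assoc, hy, Preadditive.comp_sub, ht,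
    ← Category.assoc _ (cosyzygyπ C X), comp_cosyzygyπ, zero_comp, sub_zero]

/-- The projection `C^Y ⟶ Σ Y` is `C`-epic, so `k` lifts to a morphism of approximations, which
restricts to `X ⟶ Y` on kernels. -/
lemma exists_isCosyzygyMap_of_hom {X Y : A} (hY : D Y)
    (k : cosyzygyObj C X ⟶ cosyzygyObj C Y) : ∃ f : X ⟶ Y, IsCosyzygyMap C f k := by
  obtain ⟨P, E, i, p, h, hP, hE, hi, hp⟩ := hD.left Y hY
  obtain ⟨t, ht⟩ := isRelEpi_cosyzygyπ h hP hi hp (leftApproxObj_mem C X) (cosyzygyπ C X ≫ k)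
  obtain ⟨f, hf⟩ := (hD.isShortExact_cosyzygy hY).exists_lift (leftApprox C X ≫ t) (by
    rw [Category.assoc, ht, ← Category.assoc, comp_cosyzygyπ, zero_comp])
  exact ⟨f, t, hf.symm, ht.symm⟩

/-- The restriction of the suspension functor to `D/C` is an equivalence. -/
lemma isEquivalence_restrictFunctor :
    (restrictFunctor (stableSubcategory C D) (cosyzygy C) hD.suspension_mem).IsEquivalence where
  faithful := ⟨by
    rintro ⟨⟨X⟩, hX⟩ ⟨⟨Y⟩, hY⟩ ⟨f⟩ ⟨g⟩ h
    obtain ⟨f, rfl⟩ := (toStable C).map_surjective (X := X) (Y := Y) f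
    obtain ⟨g, rfl⟩ := (toStable C).map_surjective (X := X) (Y := Y) g
    ext
    change (toStable C).map f = (toStable C).map g
    have h' : (cosyzygy C).map ((toStable C).map f) = (cosyzygy C).map ((toStable C).map g) :=
      (stableSubcategory C D).ι.congr_map h
    rw [← sub_eq_zero, ← Functor.map_sub] at h' ⊢
    rw [← Functor.map_sub] at h'
    exact hD.map_eq_zero_of_cosyzygy_map_eq_zero hX hY _ h'⟩
  full := ⟨by
    rintro ⟨⟨X⟩, hX⟩ ⟨⟨Y⟩, hY⟩ ⟨k⟩
    obtain ⟨k, rfl⟩ := (toStable C).map_surjective (X := cosyzygyObj C X)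
      (Y := cosyzygyObj C Y) k
    obtain ⟨f, hf⟩ := hD.exists_isCosyzygyMap_of_hom hY k
    exact ⟨ObjectProperty.homMk ((toStable C).map f), by ext; exact cosyzygy_map_eq C hf⟩⟩
  essSurj := ⟨by
    rintro ⟨⟨M⟩, hM⟩
    -- `K ⟶ P` is a monomorphic left approximation with cokernel `M`, so `M` is stably `Σ K`.
    obtain ⟨K, P, i, p, h, hP, hK, hi, hp⟩ := hD.right M hM
    obtain ⟨l, m, s, t, x, y, hs, ht, hts, hst⟩ := exists_iso_cosyzygy h hP hi
    let e : (toStable C).obj (cosyzygyObj C K) ≅ (toStable C).obj M :=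
      { hom := (toStable C).map s
        inv := (toStable C).map t
        hom_inv_id := by
          rw [← Functor.map_comp, ← CategoryTheory.Functor.map_id]
          exact toStable_map_eq _ (leftApproxObj_mem C K) y _ hst
        inv_hom_id := by
          rw [← Functor.map_comp, ← CategoryTheory.Functor.map_id]
          exact toStable_map_eq _ hP x _ hts }
    exact ⟨⟨(toStable C).obj K, hK⟩, ⟨ObjectProperty.isoMk _ e⟩⟩⟩

/-- Cones of morphisms of `D/C` can be chosen in `D`, so the right triangulation of `A/C` restricts
to `D/C`. There `Σ` is an autoequivalence, hence the shift by `1` of a `ℤ`-shift, and the right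
triangles form a triangulation. -/
theorem isStableTriangulated : IsStableTriangulated C D := by
  let T := (stableSubcategory C D).FullSubcategory
  let Si := restrictFunctor (stableSubcategory C D) (cosyzygy C) hD.suspension_mem
  have := hD.isEquivalence_restrictFunctor
  have hz : HasZeroObject T := ⟨⟨(toStable C).obj 0, hD.le IsAdditiveSubcategory.zero⟩, by
    rw [IsZero.iff_id_eq_zero]
    ext
    exact ((toStable C).map_isZero (isZero_zero A)).eq_of_src _ _⟩
  obtain ⟨hshift, ⟨e⟩⟩ := exists_hasShift Si
  have H : IsRightTriangulated Si _ := (stableRightTriangles_isRightTriangulated C).restrict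
    (stableSubcategory C D) hD.suspension_mem hD.exists_triangle
  obtain ⟨h₁, h₂, h₃, h⟩ := H.exists_isTriangulated e
  exact ⟨hz, hshift, h₁, h₂, h₃, Functor.isoWhiskerRight e (stableSubcategory C D).ι, h⟩

end IsFrobeniusSubcategory

end Frobenius

/-! ### Cotorsion triples -/

section Triple

variable {A : Type u} [Category.{v} A] [Abelian A]

lemma isRelEpi_isProjective {M N : A} (p : M ⟶ N) [Epi p] : IsRelEpi (isProjective A) p :=
  fun P hP g =>
    have : Projective P := hP
    ⟨Projective.factorThru g p, Projective.factorThru_comp _ _⟩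

lemma isRelMono_isInjective {M N : A} (i : M ⟶ N) [Mono i] : IsRelMono (isInjective A) i :=
  fun P hP g =>
    have : Injective P := hP
    ⟨Injective.factorThru g i, Injective.comp_factorThru _ _⟩

lemma IsShortExact.exists_isStandardRightTriangle {C : ObjectProperty A} [IsAdditiveSubcategory C]
    [IsCovariantlyFinite C] {X Y Z : A} {f : X ⟶ Y} {g : Y ⟶ Z} (h : IsShortExact f g)
    (hf : IsRelMono C f) :
    ∃ k : Z ⟶ cosyzygyObj C X, IsStandardRightTriangle C f g k := by
  obtain ⟨l, hl⟩ := hf (leftApproxObj_mem C X) (leftApprox C X)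
  obtain ⟨k, hk⟩ := h.exists_desc (l ≫ cosyzygyπ C X) (by rw [reassoc_of% hl, comp_cosyzygyπ])
  exact ⟨k, h.zero, h.epi, fun _ φ hφ => h.exists_desc φ hφ, hf, l, hl, hk⟩

lemma IsShortExact.exists_isStandardLeftTriangle {C : ObjectProperty A} [IsAdditiveSubcategory C]
    [IsContravariantlyFinite C] {X Y Z : A} {g : X ⟶ Y} {f : Y ⟶ Z} (h : IsShortExact g f)
    (hf : IsRelEpi C f) :
    ∃ k : syzygyObj C Z ⟶ X, IsStandardLeftTriangle C k g f := by
  obtain ⟨l, hl⟩ := hf (rightApproxObj_mem C Z) (rightApprox C Z)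
  obtain ⟨k, hk⟩ := h.exists_lift (syzygyι C Z ≫ l) (by rw [Category.assoc, hl, syzygyι_comp])
  exact ⟨k, h.zero, h.mono, fun _ φ hφ => h.exists_lift φ hφ, hf, l, hl, hk⟩

/-- Short exact sequences which are relatively exact on both sides give left and right
triangles. -/
lemma IsShortExact.exists_triangles {C : ObjectProperty A} [IsAdditiveSubcategory C]
    [IsContravariantlyFinite C] [IsCovariantlyFinite C] {X M Q Z : A} (hQ : C Q)
    {f : X ⟶ M ⊞ Q} {g : M ⊞ Q ⟶ Z} (h : IsShortExact f g) (hf : IsRelMono C f)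
    (hg : IsRelEpi C g) :
    ∃ (i : (toStable C).obj X ⟶ (toStable C).obj M) (p : (toStable C).obj M ⟶ (toStable C).obj Z)
      (a : (syzygy C).obj ((toStable C).obj Z) ⟶ (toStable C).obj X)
      (b : (toStable C).obj Z ⟶ (cosyzygy C).obj ((toStable C).obj X)),
      LeftTriangle.mk a i p ∈ stableLeftTriangles C ∧
        RightTriangle.mk i p b ∈ stableRightTriangles C := by
  obtain ⟨b, hb⟩ := h.exists_isStandardRightTriangle hf
  obtain ⟨a, ha⟩ := h.exists_isStandardLeftTriangle hg
  exact ⟨(toStable C).map f ≫ (stableBiprodIso M hQ).hom,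
    (stableBiprodIso M hQ).inv ≫ (toStable C).map g, ofLoop C a, toSusp C b,
    stableLeftTriangles_mem_of_iso₂ ha.mem (stableBiprodIso M hQ) rfl
      (Iso.hom_inv_id_assoc _ _).symm,
    stableRightTriangles_mem_of_iso₂ hb.mem (stableBiprodIso M hQ) rfl
      (Iso.hom_inv_id_assoc _ _).symm⟩

namespace IsCompleteHereditaryCotorsionTriple

variable [HasExt.{w} A] {X Z Y : ObjectProperty A}
  (h : IsCompleteHereditaryCotorsionTriple.{w} X Z Y)
include h

lemma trivial_of_projective (P : A) [Projective P] : Z P := h.cotorsion_right.of_projective P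

lemma trivial_of_injective (I : A) [Injective I] : Z I := h.cotorsion_left.of_injective I

lemma exists_left (M : A) : ∃ (E L : A) (i : M ⟶ E) (p : E ⟶ L),
    IsShortExact i p ∧ Z E ∧ X L := by
  obtain ⟨E, L, i, p, zero, hS, hE, hL⟩ := h.complete_left.left_approx M
  exact ⟨E, L, i, p, ⟨zero, hS⟩, hE, hL⟩

lemma exists_right (M : A) : ∃ (K E : A) (i : K ⟶ E) (p : E ⟶ M),
    IsShortExact i p ∧ Y K ∧ Z E := by
  obtain ⟨K, E, i, p, zero, hS, hK, hE⟩ := h.complete_right.right_approx M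
  exact ⟨K, E, i, p, ⟨zero, hS⟩, hK, hE⟩

/-- A morphism from an object of `X` to an object of `Z` factors through any epimorphism onto the
target with source in `Z`. -/
lemma exists_factor_of_epi {M N P : A} (hM : X M) (hN : Z N) (hP : Z P) (p : P ⟶ N) [Epi p]
    (f : M ⟶ N) : ∃ g : M ⟶ P, g ≫ p = f := by
  have hp := IsShortExact.of_epi p
  -- `Z` is resolving as the left class of (`Z`, `Y`), so the kernel of `p` lies in `Z`, which is
  -- also `X⊥`.
  exact (h.cotorsion_left.extVanishes hM ((h.hereditary_right.iff hp hN).1 hP)).exists_lift hp f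

/-- A morphism from an object of `Z` to an object of `Y` factors through any monomorphism from the
source with target in `Z`. -/
lemma exists_factor_of_mono [EnoughProjectives A] {M N I : A} (hM : Z M) (hN : Y N) (hI : Z I)
    (i : M ⟶ I) [Mono i] (f : M ⟶ N) : ∃ g : I ⟶ N, i ≫ g = f := by
  have hi := IsShortExact.of_mono i
  -- `Z` is closed under cokernels of monomorphisms as the right class of the hereditary pair (`X`,
  -- `Z`), so the cokernel of `i` is orthogonal to `Y`.
  exact (h.cotorsion_right.extVanishes
    (h.cotorsion_left.cokernel_mem h.hereditary_left hi hM hI) hN).exists_extension hi f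

/-- Projectives lie in `Z`, so the identity of `M` factors through an epimorphism from a projective,
of which `M` is then a retract. -/
lemma projective_of_mem [EnoughProjectives A] {M : A} (hX : X M) (hZ : Z M) : Projective M := by
  obtain ⟨g, hg⟩ := h.exists_factor_of_epi hX hZ (h.trivial_of_projective _) (Projective.π M) (𝟙 M)
  exact (⟨g, Projective.π M, hg⟩ : Retract M (Projective.over M)).projective

lemma injective_of_mem [EnoughProjectives A] [EnoughInjectives A] {M : A} (hZ : Z M) (hY : Y M) :
    Injective M := by
  obtain ⟨g, hg⟩ := h.exists_factor_of_mono hZ hY (h.trivial_of_injective _) (Injective.ι M) (𝟙 M)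
  exact (⟨Injective.ι M, g, hg⟩ : Retract M (Injective.under M)).injective

variable [EnoughProjectives A]

/-- In `M ⟶ E ⟶ L` with `E` in `Z` and `L` in `X`, the object `E` is an extension of objects of `X`,
hence lies in `X ∩ Z` and is projective. Morphisms to projectives extend over sequences with
cokernel in `X`, because projectives are in `Z = X⊥`. -/
lemma isFrobeniusSubcategory_left : IsFrobeniusSubcategory (isProjective A) X where
  closed := h.cotorsion_left.isClosed_left
  le M hM := h.hereditary_left.projective M hM
  left M hM := by
    obtain ⟨E, L, i, p, hip, hE, hL⟩ := h.exists_left M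
    have := hip.epi
    have hE' := h.cotorsion_left.isClosed_left.of_shortExact hip hM hL
    exact ⟨E, L, i, p, hip, h.projective_of_mem hE' hE, hL, fun P hP g =>
      have : Projective P := hP
      (h.cotorsion_left.extVanishes hL (h.trivial_of_projective P)).exists_extension hip g,
      isRelEpi_isProjective p⟩
  right M hM := by
    have hp := IsShortExact.of_epi (Projective.π M)
    exact ⟨_, _, _, _, hp, (inferInstance : Projective (Projective.over M)),
      (h.hereditary_left.iff hp hM).1 (h.cotorsion_left.of_projective _), fun P hP g =>
      have : Projective P := hP
      (h.cotorsion_left.extVanishes hM (h.trivial_of_projective P)).exists_extension hp g,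
      isRelEpi_isProjective _⟩

lemma isStableTorsionPair_left [IsCovariantlyFinite (isProjective A)] :
    IsStableTorsionPair (isProjective A) X Z := by
  refine ⟨⟨_, isPretriangulated_stable _⟩, ?_, h.isFrobeniusSubcategory_left.suspension_mem, ?_, ?_⟩
  · rintro ⟨M⟩ ⟨N⟩ hM hN f
    obtain ⟨f, rfl⟩ := (toStable (isProjective A)).map_surjective (X := M) (Y := N) f
    obtain ⟨g, hg⟩ := h.exists_factor_of_epi hM hN (h.trivial_of_projective _) (Projective.π N) f
    exact toStable_map_eq_zero (inferInstance : Projective (Projective.over N)) g _ hg.symm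
  · rintro ⟨M⟩ hM
    have : Projective (rightApproxObj (isProjective A) M) := rightApproxObj_mem (isProjective A) M
    -- The chosen right approximation is an epimorphism, since an epimorphism from a projective
    -- factors through it. So `Ω M` is the kernel of an epimorphism in the resolving class `Z`.
    obtain ⟨u, hu⟩ := rightApprox_isRelEpi (isProjective A) M
      (inferInstance : Projective (Projective.over M)) (Projective.π M)
    have : Epi (u ≫ rightApprox (isProjective A) M) := by rw [hu]; infer_instance
    have : Epi (rightApprox (isProjective A) M) := epi_of_epi u _
    exact (h.hereditary_right.iff (IsShortExact.of_epi (rightApprox (isProjective A) M)) hM).1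
      (h.trivial_of_projective _)
  · rintro ⟨M⟩
    obtain ⟨E, L, i, p, hip, hE, hL⟩ := h.exists_left M
    have := hip.epi
    have hL' := IsShortExact.of_epi (Projective.π L)
    -- With `K` the kernel of `P ⟶ L`, this is `K ⟶ M ⊞ P ⟶ E`, stably `K ⟶ M ⟶ E`, with `K` in `X`
    -- and `E` in `Z`. Its first morphism is `C`-monic because `K ⟶ P` is, as `L` is in `X`.
    obtain ⟨t, ht⟩ := hip.exists_rotate_left hL'
      (Projective.factorThru_comp (Projective.π L) p)
    have := ht.epi
    obtain ⟨a, b, c, d, h₁, h₂⟩ := ht.exists_triangles (C := isProjective A)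
      (inferInstance : Projective (Projective.over L))
      (isRelMono_lift_left _ fun P hP g =>
        have : Projective P := hP
        (h.cotorsion_left.extVanishes hL (h.trivial_of_projective P)).exists_extension hL' g)
      (isRelEpi_isProjective _)
    exact ⟨_, _, a, b, c, d, (h.hereditary_left.iff hL' hL).1 (h.cotorsion_left.of_projective _),
      hE, h₁, h₂⟩

variable [EnoughInjectives A]

lemma isFrobeniusSubcategory_right : IsFrobeniusSubcategory (isInjective A) Y where
  closed := h.cotorsion_right.isClosed_right
  le M hM := by
    have : Injective M := hM
    exact h.cotorsion_right.of_injective M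
  left M hM := by
    have hi := IsShortExact.of_mono (Injective.ι M)
    exact ⟨_, _, _, _, hi, (inferInstance : Injective (Injective.under M)),
      h.cotorsion_right.cokernel_mem h.hereditary_right hi hM (h.cotorsion_right.of_injective _),
      isRelMono_isInjective _, fun P hP g =>
      have : Injective P := hP
      (h.cotorsion_right.extVanishes (h.trivial_of_injective P) hM).exists_lift hi g⟩
  right M hM := by
    obtain ⟨K, E, i, p, hip, hK, hE⟩ := h.exists_right M
    have := hip.mono
    have hE' := h.cotorsion_right.isClosed_right.of_shortExact hip hK hM
    exact ⟨K, E, i, p, hip, h.injective_of_mem hE hE', hK, isRelMono_isInjective i, fun P hP g =>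
      have : Injective P := hP
      (h.cotorsion_right.extVanishes (h.trivial_of_injective P) hK).exists_lift hip g⟩

lemma isStableTorsionPair_right [IsContravariantlyFinite (isInjective A)] :
    IsStableTorsionPair (isInjective A) Z Y := by
  refine ⟨⟨_, isPretriangulated_stable _⟩, ?_, ?_, ?_, ?_⟩
  · rintro ⟨M⟩ ⟨N⟩ hM hN f
    obtain ⟨f, rfl⟩ := (toStable (isInjective A)).map_surjective (X := M) (Y := N) f
    obtain ⟨g, hg⟩ := h.exists_factor_of_mono hM hN (h.trivial_of_injective _) (Injective.ι M) f
    exact toStable_map_eq_zero (inferInstance : Injective (Injective.under M)) _ g hg.symm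
  · rintro ⟨M⟩ hM
    have : Injective (leftApproxObj (isInjective A) M) := leftApproxObj_mem (isInjective A) M
    exact h.cotorsion_left.cokernel_mem h.hereditary_left
      (isShortExact_cosyzygy (Injective.ι M) (inferInstance : Injective (Injective.under M))) hM
      (h.trivial_of_injective _)
  · rintro ⟨M⟩ hM
    obtain ⟨K, P, i, p, hip, hP, hK, -, -⟩ := h.isFrobeniusSubcategory_right.right M hM
    obtain ⟨l, hl⟩ := rightApprox_isRelEpi (isInjective A) M hP p
    have := hip.epi
    have : Epi (l ≫ rightApprox (isInjective A) M) := by rwa [hl]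
    have : Epi (rightApprox (isInjective A) M) := epi_of_epi l _
    -- `Y` is not assumed closed under kernels of epimorphisms. Instead, `Ω M` is a summand of an
    -- extension of an injective by `K`, both in `Y`.
    obtain ⟨t, ht⟩ := (IsShortExact.of_epi (rightApprox (isInjective A) M)).exists_rotate_left
      hip hl
    exact h.cotorsion_right.isClosed_right.of_retract ⟨biprod.inl, biprod.fst, by simp⟩
      (h.cotorsion_right.isClosed_right.of_shortExact ht hK
        (h.isFrobeniusSubcategory_right.le (rightApproxObj_mem (isInjective A) M)))
  · rintro ⟨M⟩
    obtain ⟨K, E, i, p, hip, hK, hE⟩ := h.exists_right M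
    have := hip.mono
    have hK' := IsShortExact.of_mono (Injective.ι K)
    -- With `I` an injective containing `K`, this is `E ⟶ M ⊞ I ⟶ I/K`, stably `E ⟶ M ⟶ I/K`, with
    -- `E` in `Z` and `I/K` in `Y`.
    obtain ⟨t, ht⟩ := hip.exists_rotate_right hK'
      (Injective.comp_factorThru (Injective.ι K) i)
    have := ht.mono
    obtain ⟨a, b, c, d, h₁, h₂⟩ := ht.exists_triangles (C := isInjective A)
      (inferInstance : Injective (Injective.under K)) (isRelMono_isInjective _)
      (isRelEpi_desc_right _ fun P hP g =>
        have : Injective P := hP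
        (h.cotorsion_right.extVanishes (h.trivial_of_injective P) hK).exists_lift hK' g)
    exact ⟨_, _, a, b, c, d, hE, h.cotorsion_right.cokernel_mem h.hereditary_right hK' hK
      (h.cotorsion_right.of_injective _), h₁, h₂⟩

end IsCompleteHereditaryCotorsionTriple

end Triple

/-! ### Weak factorization systems in abelian categories -/

section LiftingPair

variable {A : Type u} [Category.{v} A] [Abelian A]

/-- The cokernels of two composable monomorphisms and of their composition form a short exact
sequence. -/
lemma IsShortExact.exists_cokernel_comp {M N E L₁ L₂ Q : A} {i : M ⟶ N} {p : N ⟶ L₁} {j : N ⟶ E}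
    {q : E ⟶ L₂} {r : E ⟶ Q} (h₁ : IsShortExact i p) (h₂ : IsShortExact j q)
    (h : IsShortExact (i ≫ j) r) : ∃ (u : L₁ ⟶ Q) (v : Q ⟶ L₂), IsShortExact u v := by
  have := h₁.epi
  have := h₂.mono
  have := h₂.epi
  have := h.epi
  obtain ⟨u, hu⟩ := h₁.exists_desc (j ≫ r) (by rw [← Category.assoc, h.zero])
  obtain ⟨v, hv⟩ := h.exists_desc q (by rw [Category.assoc, h₂.zero, comp_zero])
  refine ⟨u, v, IsShortExact.of_desc ?_ ?_ ?_ ?_⟩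
  · rw [← cancel_epi p, reassoc_of% hu, hv, h₂.zero, comp_zero]
  · refine Preadditive.mono_of_cancel_zero _ fun {W} φ hφ => ?_
    obtain ⟨y, hy⟩ := h.exists_lift (pullback.snd φ p ≫ j) (by
      rw [Category.assoc, ← hu, ← reassoc_of% pullback.condition, hφ, comp_zero])
    rw [← Category.assoc, cancel_mono] at hy
    rw [← cancel_epi (pullback.fst φ p), pullback.condition, ← hy, Category.assoc, h₁.zero,
      comp_zero, comp_zero]
  · have : Epi (r ≫ v) := by rwa [hv]
    exact epi_of_epi r v
  · intro W φ hφ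
    obtain ⟨ψ, hψ⟩ := h₂.exists_desc (r ≫ φ) (by rw [← reassoc_of% hu, hφ, comp_zero])
    exact ⟨ψ, by rw [← cancel_epi r, reassoc_of% hv, hψ]⟩

/-- The monomorphisms with cokernel in a given class. -/
def monoWith (U : ObjectProperty A) : MorphismProperty A := fun _ _ f => Mono f ∧ U (cokernel f)

/-- The epimorphisms with kernel in a given class. -/
def epiWith (V : ObjectProperty A) : MorphismProperty A := fun _ _ f => Epi f ∧ V (kernel f)

/-- A pair of `Ext¹`-orthogonal classes which defines a weak factorization system. -/
structure IsLiftingPair (U V : ObjectProperty A) : Prop where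
  closed : IsClosedUnderRetractsAndExtensions U
  of_retract : ∀ ⦃M N : A⦄, Retract M N → V N → V M
  projective : ∀ (P : A) [Projective P], U P
  exists_retraction : ∀ ⦃K E M : A⦄ ⦃i : K ⟶ E⦄ ⦃p : E ⟶ M⦄, IsShortExact i p → U M → V K →
    ∃ r : E ⟶ K, i ≫ r = 𝟙 K
  exists_left : ∀ M : A, ∃ (E L : A) (i : M ⟶ E) (p : E ⟶ L), IsShortExact i p ∧ V E ∧ U L

variable {U V : ObjectProperty A}

lemma monoWith_isStableUnderRetracts (h : ∀ ⦃M N : A⦄, Retract M N → U N → U M) :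
    (monoWith U).IsStableUnderRetracts where
  of_retract r hg := ⟨(MorphismProperty.monomorphisms A).of_retract r hg.1,
    h (CategoryTheory.Retract.map r (coker A)) hg.2⟩

lemma epiWith_isStableUnderRetracts (h : ∀ ⦃M N : A⦄, Retract M N → V N → V M) :
    (epiWith V).IsStableUnderRetracts where
  of_retract r hg := ⟨(MorphismProperty.epimorphisms A).of_retract r hg.1,
    h (CategoryTheory.Retract.map r (ker A)) hg.2⟩

namespace IsLiftingPair

variable (h : IsLiftingPair U V)
include h

lemma monoWith_of_isShortExact {K E M : A} {i : K ⟶ E} {p : E ⟶ M} (hip : IsShortExact i p)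
    (hM : U M) : monoWith U i :=
  ⟨hip.mono, h.closed.of_iso hip.exists_iso_cokernel.some.symm hM⟩

lemma epiWith_of_isShortExact {K E M : A} {i : K ⟶ E} {p : E ⟶ M} (hip : IsShortExact i p)
    (hK : V K) : epiWith V p :=
  ⟨hip.epi, h.of_retract (Retract.ofIso hip.exists_iso_kernel.some.symm) hK⟩

/-- A lifting in a square from a monomorphism `0 ⟶ M ⟶ N ⟶ L ⟶ 0` to an epimorphism
`0 ⟶ K ⟶ E ⟶ F ⟶ 0`, where `Ext¹(L, K)` vanishes. -/
lemma exists_lift {M N L K E F : A} {i : M ⟶ N} {q : N ⟶ L} {k : K ⟶ E} {p : E ⟶ F}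
    (hi : IsShortExact i q) (hp : IsShortExact k p) (hL : U L) (hK : V K)
    {a : M ⟶ E} {b : N ⟶ F} (w : a ≫ p = i ≫ b) : ∃ l : N ⟶ E, i ≫ l = a ∧ l ≫ p = b := by
  have := hi.mono
  have := hi.epi
  have := hp.mono
  have := hp.epi
  let s : M ⟶ pullback p b := pullback.lift a i w
  let j : K ⟶ pullback p b := pullback.lift k 0 (by simp [hp.zero])
  let r : pullback p b ⟶ N := pullback.snd p b
  have hs : s ≫ r = i := pullback.lift_snd _ _ _
  have hj : j ≫ r = 0 := pullback.lift_snd _ _ _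
  have hj' : j ≫ pullback.fst p b = k := pullback.lift_fst _ _ _
  have hjr : IsShortExact j r := by
    refine IsShortExact.of_lift hj ?_ inferInstance fun W φ hφ => ?_
    · have : Mono (j ≫ pullback.fst p b) := by rwa [pullback.lift_fst]
      exact mono_of_mono j (pullback.fst p b)
    · obtain ⟨ψ, hψ⟩ := hp.exists_lift (φ ≫ pullback.fst p b) (by
        rw [Category.assoc, pullback.condition, reassoc_of% hφ, zero_comp])
      refine ⟨ψ, ?_⟩
      ext
      · rw [Category.assoc, hj', hψ]
      · exact (Category.assoc _ _ _).trans (by rw [hj, comp_zero, hφ])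
  have hjm := hjr.mono
  have hre := hjr.epi
  have : Mono s := by
    have : Mono (s ≫ r) := by rwa [hs]
    exact mono_of_mono s r
  have hsπ := IsShortExact.of_mono s
  set π := cokernel.π s
  obtain ⟨q', hq'⟩ := hsπ.exists_desc (r ≫ q) (by rw [reassoc_of% hs, hi.zero])
  -- The cokernel of `s` is an extension of `L` by `K`. A retraction of it yields a section of the
  -- pullback `r` which restricts to `s` on `M`, and its first component is the lift sought.
  have hq : IsShortExact (j ≫ π) q' := by
    refine IsShortExact.of_desc (by rw [Category.assoc, hq', reassoc_of% hj, zero_comp]) ?_ ?_ ?_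
    · refine Preadditive.mono_of_cancel_zero _ fun {W} φ hφ => ?_
      obtain ⟨y, hy⟩ := hsπ.exists_lift (φ ≫ j) (by simpa using hφ)
      have h0 : y ≫ i = 0 := by rw [← hs, reassoc_of% hy, hj, comp_zero]
      rw [← zero_comp (Y := M) (Z := N), cancel_mono] at h0
      rw [← cancel_mono j, ← hy, h0, zero_comp, zero_comp]
    · have : Epi (π ≫ q') := by
        rw [hq']
        exact epi_comp r q
      exact epi_of_epi π q'
    · intro W φ hφ
      obtain ⟨ψ, hψ⟩ := hjr.exists_desc (π ≫ φ) (by simpa using hφ)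
      obtain ⟨χ, rfl⟩ := hi.exists_desc ψ (by
        rw [← hs, Category.assoc, hψ, reassoc_of% hsπ.zero, zero_comp])
      exact ⟨χ, by rw [← cancel_epi π, reassoc_of% hq', hψ]⟩
  obtain ⟨ρ, hρ⟩ := h.exists_retraction hq hL hK
  obtain ⟨l, hl⟩ := hjr.exists_desc (𝟙 _ - π ≫ ρ ≫ j) (by
    simp only [Category.assoc] at hρ
    simp [reassoc_of% hρ])
  refine ⟨l ≫ pullback.fst p b, ?_, ?_⟩
  · rw [← hs, Category.assoc, reassoc_of% hl, Preadditive.sub_comp, Preadditive.comp_sub,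
      Category.assoc, reassoc_of% hsπ.zero, zero_comp, sub_zero, Category.id_comp]
    exact pullback.lift_fst _ _ _
  · have : l ≫ r = 𝟙 N := by
      rw [← cancel_epi r, reassoc_of% hl, Preadditive.sub_comp, Category.assoc, Category.assoc, hj]
      simp
    rw [Category.assoc, pullback.condition, reassoc_of% this]

lemma hasLiftingProperty {M N E F : A} {i : M ⟶ N} {p : E ⟶ F} (hi : monoWith U i)
    (hp : epiWith V p) : HasLiftingProperty i p where
  sq_hasLift {a b} sq := by
    have := hi.1
    have := hp.1
    obtain ⟨l, hl, hl'⟩ := h.exists_lift (IsShortExact.of_mono i) (IsShortExact.of_epi p) hi.2 hp.2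
      sq.w
    exact ⟨⟨⟨l, hl, hl'⟩⟩⟩

/-- Adding a projective summand, allowed since projectives are in `U`, turns `f` into an epimorphism
`M ⊞ P ⟶ N`. Pushing out its kernel along an embedding into `V` with cokernel in `U` gives the
second factor, and the cokernel of the first is an extension within `U`. -/
lemma hasFactorization [EnoughProjectives A] :
    (monoWith U).HasFactorization (epiWith V) where
  nonempty_mapFactorizationData {M N} f := by
    have : Epi (biprod.desc f (Projective.π N)) := by
      have : Epi (biprod.inr ≫ biprod.desc f (Projective.π N)) := by
        rw [biprod.inr_desc]
        infer_instance
      exact epi_of_epi biprod.inr _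
    obtain ⟨E, L, i, p, hip, hE, hL⟩ := h.exists_left (kernel (biprod.desc f (Projective.π N)))
    obtain ⟨E', a, b, q, q', hbq, haq', haq⟩ :=
      (IsShortExact.of_epi (biprod.desc f (Projective.π N))).exists_pushout hip
    have := haq'.mono
    have hc : IsShortExact (biprod.inl ≫ a) (cokernel.π (biprod.inl ≫ a)) := IsShortExact.of_mono _
    obtain ⟨u, v, huv⟩ := (IsShortExact.inl_snd M (Projective.over N)).exists_cokernel_comp haq' hc
    exact ⟨⟨E', biprod.inl ≫ a, q, by rw [Category.assoc, haq, biprod.inl_desc], ⟨hc.mono,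
      h.closed.of_shortExact huv (h.projective _) hL⟩, h.epiWith_of_isShortExact hbq hE⟩⟩

lemma isWeakFactorizationSystem [EnoughProjectives A] :
    (monoWith U).IsWeakFactorizationSystem (epiWith V) := by
  have := h.hasFactorization
  have := monoWith_isStableUnderRetracts h.closed.of_retract
  have := epiWith_isStableUnderRetracts h.of_retract
  exact MorphismProperty.IsWeakFactorizationSystem.mk' _ _ fun i p => h.hasLiftingProperty

end IsLiftingPair

/-- A factorization argument which determines the trivial cofibrations. -/
lemma monoWith_inf_le {U U' V V' : ObjectProperty A} {W : MorphismProperty A}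
    [W.HasTwoOutOfThreeProperty] [(monoWith U).IsWeakFactorizationSystem (epiWith V')]
    [(monoWith U').IsWeakFactorizationSystem (epiWith V)] (h : monoWith U' ≤ W)
    (h' : epiWith V ⊓ W ≤ epiWith V') : monoWith U ⊓ W ≤ monoWith U' := by
  rintro M N f ⟨hf, hf'⟩
  -- Retract argument: the second factor is in `W` by two-out-of-three, hence in `epiWith V'`. So
  -- `f` lifts against it and is a retract of the first factor.
  have F := MorphismProperty.factorizationData (monoWith U') (epiWith V) f
  have hp : epiWith V' F.p := h' _ ⟨F.hp, W.of_precomp F.i F.p (h _ F.hi) (by rwa [F.fac])⟩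
  have := MorphismProperty.hasLiftingProperty_of_wfs f F.p hf hp
  have := MorphismProperty.llp_eq_of_wfs (monoWith U') (epiWith V)
  rw [← this]
  exact MorphismProperty.of_retract (RetractArrow.ofLeftLiftingProperty F.fac) (this.symm ▸ F.hi)

/-- A factorization argument which determines the trivial fibrations. -/
lemma epiWith_inf_le {U U' V V' : ObjectProperty A} {W : MorphismProperty A}
    [W.HasTwoOutOfThreeProperty] [(monoWith U).IsWeakFactorizationSystem (epiWith V')]
    [(monoWith U').IsWeakFactorizationSystem (epiWith V)] (h : epiWith V' ≤ W)
    (h' : monoWith U ⊓ W ≤ monoWith U') : epiWith V ⊓ W ≤ epiWith V' := by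
  rintro M N f ⟨hf, hf'⟩
  have F := MorphismProperty.factorizationData (monoWith U) (epiWith V') f
  have hi : monoWith U' F.i := h' _ ⟨F.hi, W.of_postcomp F.i F.p (h _ F.hp) (by rwa [F.fac])⟩
  have := MorphismProperty.hasLiftingProperty_of_wfs F.i f hi hf
  have := MorphismProperty.rlp_eq_of_wfs (monoWith U) (epiWith V')
  rw [← this]
  exact MorphismProperty.of_retract (RetractArrow.ofRightLiftingProperty F.fac) (this.symm ▸ F.hp)

/-- A model structure on an abelian category with prescribed weak equivalences. -/
lemma exists_modelCategory (Cof Triv Fib : ObjectProperty A) (W : MorphismProperty A)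
    [W.HasTwoOutOfThreeProperty]
    [(monoWith Cof).IsWeakFactorizationSystem (epiWith (Fib ⊓ Triv))]
    [(monoWith (Cof ⊓ Triv)).IsWeakFactorizationSystem (epiWith Fib)]
    (h₁ : monoWith Cof ⊓ W = monoWith (Cof ⊓ Triv)) (h₂ : epiWith Fib ⊓ W = epiWith (Fib ⊓ Triv)) :
    ∃ M : ModelCategory A, IsAbelianModelStructure M Cof Triv Fib ∧ weakEquivalences A = W := by
  let _ : CategoryWithCofibrations A := ⟨monoWith Cof⟩
  let _ : CategoryWithFibrations A := ⟨epiWith Fib⟩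
  let _ : CategoryWithWeakEquivalences A := ⟨W⟩
  have e₁ : trivialCofibrations A = monoWith (Cof ⊓ Triv) := h₁
  have e₂ : trivialFibrations A = epiWith (Fib ⊓ Triv) := h₂
  have : (weakEquivalences A).HasTwoOutOfThreeProperty :=
    inferInstanceAs W.HasTwoOutOfThreeProperty
  have : (cofibrations A).IsWeakFactorizationSystem (trivialFibrations A) := by
    rw [e₂]
    exact inferInstanceAs ((monoWith Cof).IsWeakFactorizationSystem (epiWith (Fib ⊓ Triv)))
  have : (trivialCofibrations A).IsWeakFactorizationSystem (fibrations A) := by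
    rw [e₁]
    exact inferInstanceAs ((monoWith (Cof ⊓ Triv)).IsWeakFactorizationSystem (epiWith Fib))
  refine ⟨ModelCategory.mk' A, ⟨fun f => Iff.rfl, fun f => Iff.rfl,
    fun {M N} f => ⟨fun hf => ?_, ?_⟩⟩,
    rfl⟩
  · have F := MorphismProperty.factorizationData (monoWith (Cof ⊓ Triv)) (epiWith Fib) f
    have hi : (monoWith Cof ⊓ W) F.i := by
      rw [h₁]
      exact F.hi
    have hp : epiWith (Fib ⊓ Triv) F.p := by
      rw [← h₂]
      exact ⟨F.hp, W.of_precomp F.i F.p hi.2 (by rw [F.fac]; exact hf)⟩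
    exact ⟨F.Z, F.i, F.p, F.fac, F.hi, hp⟩
  · rintro ⟨E, i, p, rfl, hi, hp⟩
    have hi' : (monoWith Cof ⊓ W) i := by
      rw [h₁]
      exact hi
    have hp' : (epiWith Fib ⊓ W) p := by
      rw [h₂]
      exact hp
    exact W.comp_mem i p hi'.2 hp'.2

end LiftingPair

/-! ### Weak equivalences detected by stable categories -/

section StableEquivalences

variable {A : Type u} [Category.{v} A] [Abelian A] (C D : ObjectProperty A)
  [IsAdditiveSubcategory C]

/-- The morphisms `M ⟶ N` which induce bijections `Hom(W, M) ≃ Hom(W, N)` in `A/C` for all `W`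
in `D`. -/
abbrev stableEquivalences : MorphismProperty A :=
  (stableSubcategory C D).isColocal.inverseImage (toStable C)

/-- The morphisms `M ⟶ N` which induce bijections `Hom(N, V) ≃ Hom(M, V)` in `A/C` for all `V`
in `D`. -/
abbrev stableCoequivalences : MorphismProperty A :=
  (stableSubcategory C D).isLocal.inverseImage (toStable C)

variable {C}

/-- A split monomorphism with cokernel in `C` is a stable isomorphism. -/
lemma isIso_toStable_map_of_retraction {K E M : A} {i : K ⟶ E} {p : E ⟶ M}
    (h : IsShortExact i p) (hM : C M) {r : E ⟶ K} (hr : i ≫ r = 𝟙 K) :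
    IsIso ((toStable C).map i) := by
  obtain ⟨s, hs⟩ := h.exists_desc (𝟙 E - r ≫ i) (by simp [reassoc_of% hr])
  refine ⟨(toStable C).map r, ?_, ?_⟩
  · rw [← Functor.map_comp, hr, CategoryTheory.Functor.map_id]
  · rw [← Functor.map_comp, ← CategoryTheory.Functor.map_id]
    exact toStable_map_eq M hM (-p) s (by simp [hs])

/-- A split epimorphism with kernel in `C` is a stable isomorphism. -/
lemma isIso_toStable_map_of_section {K E M : A} {i : K ⟶ E} {p : E ⟶ M}
    (h : IsShortExact i p) (hK : C K) {s : M ⟶ E} (hs : s ≫ p = 𝟙 M) :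
    IsIso ((toStable C).map p) := by
  obtain ⟨r, hr⟩ := h.exists_lift (𝟙 E - p ≫ s) (by simp [hs])
  refine ⟨(toStable C).map s, ?_, ?_⟩
  · rw [← Functor.map_comp, ← CategoryTheory.Functor.map_id]
    exact toStable_map_eq K hK (-r) i (by simp [hr])
  · rw [← Functor.map_comp, hs, CategoryTheory.Functor.map_id]

end StableEquivalences

/-! ### The model structures of a cotorsion triple -/

section TripleModel

variable {A : Type u} [Category.{v} A] [Abelian A]

namespace IsCompleteHereditaryCotorsionTriple

variable [HasExt.{w} A] {X Z Y : ObjectProperty A}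
  (h : IsCompleteHereditaryCotorsionTriple.{w} X Z Y)
include h

/-- Four such pairs are used: (`X`, `Z`) and (projectives, all objects) for the projective
structure, (`Z`, `Y`) and (all objects, injectives) for the injective one. -/
lemma isLiftingPair_left : IsLiftingPair X Z where
  closed := h.cotorsion_left.isClosed_left
  of_retract := h.cotorsion_left.isClosed_right.of_retract
  projective := h.cotorsion_left.of_projective
  exists_retraction _ _ _ _ _ hip hM hK :=
    (h.cotorsion_left.extVanishes hM hK).exists_extension hip (𝟙 _)
  exists_left := h.exists_left

lemma isLiftingPair_right : IsLiftingPair Z Y where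
  closed := h.cotorsion_right.isClosed_left
  of_retract := h.cotorsion_right.isClosed_right.of_retract
  projective := h.cotorsion_right.of_projective
  exists_retraction _ _ _ _ _ hip hM hK :=
    (h.cotorsion_right.extVanishes hM hK).exists_extension hip (𝟙 _)
  exists_left M := by
    obtain ⟨E, L, i, p, zero, hS, hE, hL⟩ := h.complete_right.left_approx M
    exact ⟨E, L, i, p, ⟨zero, hS⟩, hE, hL⟩

end IsCompleteHereditaryCotorsionTriple

lemma isLiftingPair_isProjective : IsLiftingPair (isProjective A) ⊤ where
  closed :=
    { of_retract := fun M N r hN =>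
        have : Projective N := hN
        r.projective
      of_shortExact := fun K E M i p hip hK hM => by
        have : Projective K := hK
        have : Projective M := hM
        exact Projective.of_iso hip.choose_spec.splittingOfProjective.isoBinaryBiproduct.symm
          (inferInstance : Projective (K ⊞ M)) }
  of_retract _ _ _ _ := trivial
  projective P hP := hP
  exists_retraction K E M i p hip hM _ := by
    have : Projective M := hM
    exact ⟨_, hip.choose_spec.splittingOfProjective.f_r⟩
  exists_left M := ⟨M, 0, 𝟙 M, 0, IsShortExact.of_lift (by simp) inferInstance
    ((isZero_zero A).epi _) fun W φ _ => ⟨φ, by simp⟩, trivial,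
    (inferInstance : Projective (0 : A))⟩

lemma isLiftingPair_isInjective [EnoughInjectives A] : IsLiftingPair ⊤ (isInjective A) where
  closed := ⟨fun _ _ _ _ => trivial, fun _ _ _ _ _ _ _ _ => trivial⟩
  of_retract M N r hN :=
    have : Injective N := hN
    r.injective
  projective _ _ := trivial
  exists_retraction K E M i p hip _ hK := by
    have : Injective K := hK
    exact ⟨_, hip.choose_spec.splittingOfInjective.f_r⟩
  exists_left M := ⟨_, _, _, _, IsShortExact.of_mono (Injective.ι M),
    (inferInstance : Injective (Injective.under M)), trivial⟩

namespace IsCompleteHereditaryCotorsionTriple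

variable [HasExt.{w} A] {X Z Y : ObjectProperty A}
  (h : IsCompleteHereditaryCotorsionTriple.{w} X Z Y) [EnoughProjectives A]
include h

lemma inf_left : X ⊓ Z = isProjective A := by
  ext M
  refine ⟨fun hM => h.projective_of_mem hM.1 hM.2, fun hM => ?_⟩
  have : Projective M := hM
  exact ⟨h.cotorsion_left.of_projective M, h.trivial_of_projective M⟩

lemma inf_right [EnoughInjectives A] : Y ⊓ Z = isInjective A := by
  ext M
  refine ⟨fun hM => h.injective_of_mem hM.2 hM.1, fun hM => ?_⟩
  have : Injective M := hM
  exact ⟨h.cotorsion_right.of_injective M, h.trivial_of_injective M⟩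

/-- If the kernel is in `Z`, vanishing of `Ext¹` lifts morphisms from `X`, and a morphism from `X`
to the kernel is stably zero. For the converse, `Ext¹(W, ker p)` is tested on the syzygy of `W`:
stable injectivity for the syzygy and stable surjectivity for `W` together produce the extension. -/
lemma epiWith_inf_stableEquivalences :
    epiWith ⊤ ⊓ stableEquivalences (isProjective A) X = epiWith Z := by
  ext M N p
  constructor
  · rintro ⟨⟨hp, -⟩, hp' : (stableSubcategory (isProjective A) X).isColocal _⟩
    refine ⟨hp, (h.cotorsion_left.right_iff _).2 fun W hW => ?_⟩
    have hk := IsShortExact.of_epi p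
    set k := kernel.ι p
    have hk' := hk.mono
    have hP := IsShortExact.of_epi (Projective.π W)
    have hΩ : X (kernel (Projective.π W)) :=
      (h.hereditary_left.iff hP hW).1 (h.cotorsion_left.of_projective _)
    refine extVanishes_of_exists_extension hP fun φ => ?_
    -- `φ ≫ k` dies after composition with `p`, so stable injectivity makes it factor through a
    -- projective `Q`. As `Q` is in `Z`, the factorization extends over the projective covering `W`.
    have h0 : (toStable (isProjective A)).map (φ ≫ k) = 0 := (hp' ((toStable _).obj _) hΩ).1 (by
      dsimp only
      rw [← Functor.map_comp, Category.assoc, hk.zero, comp_zero, Functor.map_zero, zero_comp])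
    obtain ⟨Q, hQ, a, b, hab⟩ := exists_factorization_of_toStable_map_eq_zero h0
    have : Projective Q := hQ
    obtain ⟨a, rfl⟩ := (h.cotorsion_left.extVanishes hW
      (h.trivial_of_projective Q)).exists_extension hP a
    obtain ⟨θ, hθ⟩ := hP.exists_desc ((a ≫ b) ≫ p) (by
      rw [← Category.assoc, ← Category.assoc, ← hab, Category.assoc, hk.zero, comp_zero])
    -- The extension induces `θ : W ⟶ N`, the obstruction to landing in the kernel of `p`. Lifting
    -- `θ` to `χ'` and subtracting it removes the obstruction without changing the restriction to
    -- the syzygy.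
    obtain ⟨χ, hχ⟩ := (hp' ((toStable _).obj _) hW).2 ((toStable (isProjective A)).map θ)
    obtain ⟨χ, rfl⟩ := (toStable (isProjective A)).map_surjective χ
    dsimp only at hχ
    rw [← Functor.map_comp] at hχ
    obtain ⟨χ', -, hχ'⟩ := exists_comp_eq_of_isRelEpi (isRelEpi_isProjective p) (b := χ)
      (c := 𝟙 _) (f := θ) (by rw [hχ, Category.comp_id])
    rw [Category.comp_id] at hχ'
    obtain ⟨ψ, hψ⟩ := hk.exists_lift (a ≫ b - Projective.π W ≫ χ') (by
      rw [Preadditive.sub_comp, Category.assoc _ χ', hχ', hθ, sub_self])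
    refine ⟨ψ, ?_⟩
    rw [← cancel_mono k, Category.assoc, hψ, Preadditive.comp_sub, reassoc_of% hP.zero, zero_comp,
      sub_zero, hab, Category.assoc]
  · rintro ⟨hp, hK⟩
    refine ⟨⟨hp, trivial⟩, ?_⟩
    rintro ⟨W⟩ hW
    refine ⟨?_, fun g => ?_⟩
    · intro g g' hg
      obtain ⟨g, rfl⟩ := (toStable (isProjective A)).map_surjective (X := W) (Y := _) g
      obtain ⟨g', rfl⟩ := (toStable (isProjective A)).map_surjective (X := W) (Y := _) g'
      dsimp only at hg
      rw [← Functor.map_comp, ← Functor.map_comp] at hg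
      obtain ⟨g₁, hg₁, hg₁'⟩ := exists_comp_eq_of_isRelEpi (isRelEpi_isProjective p) (b := g)
        (c := 𝟙 _) (f := g' ≫ p) (by rw [hg, Category.comp_id])
      obtain ⟨ψ, hψ⟩ := (IsShortExact.of_epi p).exists_lift (g₁ - g') (by
        rw [Preadditive.sub_comp, hg₁', Category.comp_id, sub_self])
      obtain ⟨χ, rfl⟩ := h.exists_factor_of_epi hW hK (h.trivial_of_projective _)
        (Projective.π _) ψ
      rw [← hg₁]
      exact toStable_map_eq _ (inferInstance : Projective (Projective.over _)) χ
        (Projective.π _ ≫ kernel.ι p) (by rw [← hψ, Category.assoc])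
    · obtain ⟨g, rfl⟩ := (toStable (isProjective A)).map_surjective (X := W) (Y := _) g
      obtain ⟨ψ, rfl⟩ := (h.cotorsion_left.extVanishes hW hK).exists_lift
        (IsShortExact.of_epi p) g
      exact ⟨(toStable (isProjective A)).map ψ, (Functor.map_comp _ _ _).symm⟩

/-- Dual argument, with `Ext¹(coker i, V)` tested on the cokernel of an embedding of `V` into an
injective. -/
lemma monoWith_inf_stableCoequivalences [EnoughInjectives A] :
    monoWith ⊤ ⊓ stableCoequivalences (isInjective A) Y = monoWith Z := by
  ext M N i
  constructor
  · rintro ⟨⟨hi, -⟩, hi' : (stableSubcategory (isInjective A) Y).isLocal _⟩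
    refine ⟨hi, (h.cotorsion_right.left_iff _).2 fun V hV => ?_⟩
    have hk := IsShortExact.of_mono i
    set k := cokernel.π i
    have hk' := hk.epi
    have hI := IsShortExact.of_mono (Injective.ι V)
    have hC : Y (cokernel (Injective.ι V)) :=
      h.cotorsion_right.cokernel_mem h.hereditary_right hI hV (h.cotorsion_right.of_injective _)
    refine extVanishes_of_exists_lift hI fun φ => ?_
    have h0 : (toStable (isInjective A)).map (k ≫ φ) = 0 := (hi' ((toStable _).obj _) hC).1 (by
      dsimp only
      rw [← Functor.map_comp, reassoc_of% hk.zero, zero_comp, Functor.map_zero, comp_zero])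
    obtain ⟨Q, hQ, a, b, hab⟩ := exists_factorization_of_toStable_map_eq_zero h0
    have : Injective Q := hQ
    obtain ⟨b, rfl⟩ := (h.cotorsion_right.extVanishes
      (h.trivial_of_injective Q) hV).exists_lift hI b
    obtain ⟨θ, hθ⟩ := hI.exists_lift (i ≫ a ≫ b) (by
      rw [Category.assoc, Category.assoc, ← hab, reassoc_of% hk.zero, zero_comp])
    obtain ⟨χ, hχ⟩ := (hi' ((toStable _).obj _) hV).2 ((toStable (isInjective A)).map θ)
    obtain ⟨χ, rfl⟩ := (toStable (isInjective A)).map_surjective χ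
    dsimp only at hχ
    rw [← Functor.map_comp] at hχ
    obtain ⟨χ', -, hχ'⟩ := exists_comp_eq_of_isRelMono (isRelMono_isInjective i) (b := χ)
      (a := 𝟙 _) (f' := θ) (by rw [hχ, Category.id_comp])
    rw [Category.id_comp] at hχ'
    obtain ⟨ψ, hψ⟩ := hk.exists_desc (a ≫ b - χ' ≫ Injective.ι V) (by
      rw [Preadditive.comp_sub, reassoc_of% hχ', hθ, sub_self])
    refine ⟨ψ, ?_⟩
    rw [← cancel_epi k, reassoc_of% hψ, Preadditive.sub_comp, Category.assoc,
      Category.assoc χ', hI.zero, comp_zero,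
      sub_zero, hab]
  · rintro ⟨hi, hK⟩
    refine ⟨⟨hi, trivial⟩, ?_⟩
    rintro ⟨V⟩ hV
    refine ⟨?_, fun g => ?_⟩
    · intro g g' hg
      obtain ⟨g, rfl⟩ := (toStable (isInjective A)).map_surjective (X := _) (Y := V) g
      obtain ⟨g', rfl⟩ := (toStable (isInjective A)).map_surjective (X := _) (Y := V) g'
      dsimp only at hg
      rw [← Functor.map_comp, ← Functor.map_comp] at hg
      obtain ⟨g₁, hg₁, hg₁'⟩ := exists_comp_eq_of_isRelMono (isRelMono_isInjective i) (b := g)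
        (a := 𝟙 _) (f' := i ≫ g') (by rw [hg, Category.id_comp])
      obtain ⟨ψ, hψ⟩ := (IsShortExact.of_mono i).exists_desc (g₁ - g') (by
        rw [Preadditive.comp_sub, hg₁', Category.id_comp, sub_self])
      obtain ⟨χ, rfl⟩ := h.exists_factor_of_mono hK hV (h.trivial_of_injective _)
        (Injective.ι _) ψ
      rw [← hg₁]
      exact toStable_map_eq _ (inferInstance : Injective (Injective.under _))
        (cokernel.π i ≫ Injective.ι _) χ (by rw [← hψ, Category.assoc])
    · obtain ⟨g, rfl⟩ := (toStable (isInjective A)).map_surjective (X := _) (Y := V) g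
      obtain ⟨ψ, rfl⟩ := (h.cotorsion_right.extVanishes hK hV).exists_extension
        (IsShortExact.of_mono i) g
      exact ⟨(toStable (isInjective A)).map ψ, (Functor.map_comp _ _ _).symm⟩

/-- The projective model structure. -/
theorem exists_projectiveModelStructure :
    ∃ M : ModelCategory A, IsAbelianModelStructure M X Z ⊤ ∧
      weakEquivalences A = stableEquivalences (isProjective A) X := by
  have e := h.epiWith_inf_stableEquivalences
  have i₁ := h.isLiftingPair_left.isWeakFactorizationSystem
  have i₂ := (isLiftingPair_isProjective (A := A)).isWeakFactorizationSystem
  -- Such monomorphisms split with projective cokernel, so they are already stable isomorphisms.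
  have hW : monoWith (isProjective A) ≤ stableEquivalences (isProjective A) X := by
    rintro M N f ⟨hf, hf'⟩
    obtain ⟨r, hr⟩ := isLiftingPair_isProjective.exists_retraction (IsShortExact.of_mono f) hf'
      trivial
    have := isIso_toStable_map_of_retraction (IsShortExact.of_mono f) hf' hr
    exact ObjectProperty.isColocal_of_isIso _ _
  have e' : monoWith X ⊓ stableEquivalences (isProjective A) X = monoWith (isProjective A) :=
    le_antisymm (monoWith_inf_le hW e.le) (le_inf (fun M N f hf =>
      ⟨hf.1, have : Projective (cokernel f) := hf.2; h.cotorsion_left.of_projective _⟩) hW)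
  have e₁ := h.inf_left
  have : (monoWith X).IsWeakFactorizationSystem (epiWith (⊤ ⊓ Z)) := by rwa [top_inf_eq]
  have : (monoWith (X ⊓ Z)).IsWeakFactorizationSystem (epiWith ⊤) := by rwa [e₁]
  exact exists_modelCategory X Z ⊤ _ (by rw [e', e₁]) (by rw [e, top_inf_eq])

/-- The injective model structure. -/
theorem exists_injectiveModelStructure [EnoughInjectives A] :
    ∃ M : ModelCategory A, IsAbelianModelStructure M ⊤ Z Y ∧
      weakEquivalences A = stableCoequivalences (isInjective A) Y := by
  have e := h.monoWith_inf_stableCoequivalences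
  have i₁ := h.isLiftingPair_right.isWeakFactorizationSystem
  have i₂ := (isLiftingPair_isInjective (A := A)).isWeakFactorizationSystem
  have hW : epiWith (isInjective A) ≤ stableCoequivalences (isInjective A) Y := by
    rintro M N f ⟨hf, hf'⟩
    have : Injective (kernel f) := hf'
    have := isIso_toStable_map_of_section (IsShortExact.of_epi f) hf'
      (IsShortExact.of_epi f).choose_spec.splittingOfInjective.s_g
    exact ObjectProperty.isLocal_of_isIso _ _
  have e' : epiWith Y ⊓ stableCoequivalences (isInjective A) Y = epiWith (isInjective A) :=
    le_antisymm (epiWith_inf_le hW e.le) (le_inf (fun M N f hf =>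
      ⟨hf.1, have : Injective (kernel f) := hf.2; h.cotorsion_right.of_injective _⟩) hW)
  have e₁ := h.inf_right
  have : (monoWith (⊤ ⊓ Z)).IsWeakFactorizationSystem (epiWith Y) := by rwa [top_inf_eq]
  have : (monoWith ⊤).IsWeakFactorizationSystem (epiWith (Y ⊓ Z)) := by rwa [e₁]
  exact exists_modelCategory ⊤ Z Y _ (by rw [e, top_inf_eq]) (by rw [e', e₁])

end IsCompleteHereditaryCotorsionTriple

end TripleModel

/-! ### Stability of the model structures -/

section Localization

variable {T : Type u} [Category.{v} T] {P : ObjectProperty T}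

/-- A colocal morphism `M' ⟶ M` with `M'` in `P` represents the morphisms from `P` to `M`;
representability for each `M` is enough for a right adjoint. -/
lemma isLeftAdjoint_ι (hP : ∀ M, ∃ (M' : T) (f : M' ⟶ M), P M' ∧ P.isColocal f) :
    P.ι.IsLeftAdjoint := by
  refine Functor.isLeftAdjoint_of_rightAdjointObjIsDefined_eq_top (top_unique fun M _ => ?_)
  obtain ⟨M', f, hM', hf⟩ := hP M
  exact ⟨⟨M', hM'⟩, ⟨{
    homEquiv := fun {W} => P.fullyFaithfulι.homEquiv.trans (hf.homEquiv _ W.property)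
    homEquiv_comp := fun g g' => Category.assoc _ _ _ }⟩⟩

lemma isRightAdjoint_ι (hP : ∀ M, ∃ (M' : T) (f : M ⟶ M'), P M' ∧ P.isLocal f) :
    P.ι.IsRightAdjoint := by
  refine Functor.isRightAdjoint_of_leftAdjointObjIsDefined_eq_top (top_unique fun M _ => ?_)
  obtain ⟨M', f, hM', hf⟩ := hP M
  exact ⟨⟨M', hM'⟩, ⟨{
    homEquiv := fun {W} => P.fullyFaithfulι.homEquiv.trans (hf.homEquiv _ W.property)
    homEquiv_comp := fun g g' => (Category.assoc _ _ _).symm }⟩⟩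

lemma range_ι_obj : (· ∈ Set.range P.ι.obj) = P := by
  ext M
  exact ⟨by rintro ⟨M, rfl⟩; exact M.property, fun hM => ⟨⟨M, hM⟩, rfl⟩⟩

/-- Localizing along a full and essentially surjective localization functor. -/
lemma isLocalization_comp {A : Type u} [Category.{v} A] (F : A ⥤ T) [F.Full] [F.EssSurj]
    [F.IsLocalization ((MorphismProperty.isomorphisms T).inverseImage F)]
    {D : Type u} [Category.{v} D] (G : T ⥤ D) (W : MorphismProperty T) [W.RespectsIso]
    [W.ContainsIdentities] [G.IsLocalization W] :
    (F ⋙ G).IsLocalization (W.inverseImage F) := by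
  refine Functor.IsLocalization.comp F G ((MorphismProperty.isomorphisms T).inverseImage F) W _
    (fun M N f hf => Localization.inverts G W _ hf) (fun M N f (hf : IsIso (F.map f)) => ?_)
    (fun M N f hf => ?_)
  · exact MorphismProperty.of_isIso W (F.map f)
  · let e : Arrow.mk (F.map (F.preimage ((F.objObjPreimageIso M).hom ≫ f ≫
        (F.objObjPreimageIso N).inv))) ≅ Arrow.mk f :=
      Arrow.isoMk (F.objObjPreimageIso M) (F.objObjPreimageIso N) (by simp)
    exact ⟨_, _, _, (W.arrow_mk_iso_iff e).2 hf, ⟨e⟩⟩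

variable {A : Type u} [Category.{v} A] [Abelian A] (C : ObjectProperty A)
  [IsAdditiveSubcategory C]

/-- If `f₀ - f₁` factors through `P` in `C`, then `X ⊞ P` is a cylinder on which the two are
homotopic, and its projection to `X` is a stable isomorphism. Thus `A/C` is obtained from `A` by
inverting the stable isomorphisms. -/
instance : (toStable C).IsLocalization
    ((MorphismProperty.isomorphisms _).inverseImage (toStable C)) := by
  refine Functor.isLocalization_of_essSurj_of_full_of_exists_cylinders _ _ (fun _ _ _ h => h)
    fun X Y f₀ f₁ h => ?_
  obtain ⟨P, hP, a, b, hab⟩ := (toStable_map_eq_iff f₀ f₁).1 h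
  refine ⟨{ I := X ⊞ P, i₀ := biprod.lift (𝟙 X) a, i₁ := biprod.inl, π := biprod.fst },
    { h := biprod.desc f₁ b, h₀ := ?_, h₁ := by simp }, ?_⟩
  · simp [← hab]
  · exact (stableBiprodIso X hP).isIso_hom

end Localization

/-- Localizations are unique up to equivalence, so the suspension may be computed in any convenient
model `D` of the homotopy category and conjugated back. -/
lemma isStableModelCategory_of_isLocalization {A : Type u} [Category.{v} A] [HasZeroMorphisms A]
    [HasZeroObject A] [HasCokernels A] [ModelCategory A] {D : Type u} [Category.{v} D]
    (L : A ⥤ D) [L.IsLocalization (weakEquivalences A)] (S : D ⥤ D) [S.IsEquivalence]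
    (e : ((isCone A).ι ⋙ Arrow.leftFunc) ⋙ L ⋙ S ≅ ((isCone A).ι ⋙ coker A) ⋙ L) :
    IsStableModelCategory A := by
  let E := Localization.uniq (weakEquivalences A).Q L (weakEquivalences A)
  let e₁ : (weakEquivalences A).Q ⋙ E.functor ≅ L := Localization.compUniqFunctor _ _ _
  let e₂ : L ⋙ E.inverse ≅ (weakEquivalences A).Q := Localization.compUniqInverse _ _ _
  refine ⟨E.functor ⋙ S ⋙ E.inverse, ⟨?_⟩, inferInstance⟩
  exact Functor.isoWhiskerLeft ((isCone A).ι ⋙ Arrow.leftFunc)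
      (Functor.isoWhiskerRight e₁ (S ⋙ E.inverse)) ≪≫
    Functor.isoWhiskerRight e E.inverse ≪≫ Functor.isoWhiskerLeft ((isCone A).ι ⋙ coker A) e₂

/-! ### Comparing cokernels of cones with the stable suspension -/

section Suspension

variable {A : Type u} [Category.{v} A] [Abelian A] {C : ObjectProperty A}
  [IsAdditiveSubcategory C] [IsCovariantlyFinite C]

/-- The morphism from the cokernel of a relative monomorphism `M ⟶ N` to `Σ M`. -/
def connecting {M N : A} (i : M ⟶ N) (hi : IsRelMono C i) : cokernel i ⟶ cosyzygyObj C M :=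
  (exists_isStandardRightTriangle_of_isRelMono C i hi).choose

lemma connecting_spec {M N : A} (i : M ⟶ N) (hi : IsRelMono C i) :
    IsStandardRightTriangle C i (cokernel.π i) (connecting i hi) :=
  (exists_isStandardRightTriangle_of_isRelMono C i hi).choose_spec

/-- The connecting morphisms are natural in the stable category. -/
lemma connecting_naturality {M N M' N' : A} {i : M ⟶ N} {i' : M' ⟶ N'} (hi : IsRelMono C i)
    (hi' : IsRelMono C i') (a : M ⟶ M') (b : N ⟶ N') (w : i ≫ b = a ≫ i')
    (c : cokernel i ⟶ cokernel i') (hc : cokernel.π i ≫ c = b ≫ cokernel.π i') :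
    (toStable C).map c ≫ toSusp C (connecting i' hi') =
      toSusp C (connecting i hi) ≫ (cosyzygy C).map ((toStable C).map a) := by
  obtain ⟨k, t, ht, hk⟩ := exists_isCosyzygyMap C a
  rw [toSusp_comp_cosyzygy_map ⟨t, ht, hk⟩, toStable_map_comp_toSusp]
  obtain ⟨l, hl, hl'⟩ := (connecting_spec i hi).exists_extension
  obtain ⟨m, hm, hm'⟩ := (connecting_spec i' hi').exists_extension
  have h0 : i ≫ (b ≫ m - l ≫ t) = 0 := by
    rw [Preadditive.comp_sub, reassoc_of% w, hm, reassoc_of% hl, ht, sub_self]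
  refine toSusp_eq (leftApproxObj_mem C M') (cokernel.desc i _ h0) (cosyzygyπ C M') ?_
  rw [← cancel_epi (cokernel.π i), cokernel.π_desc_assoc, Preadditive.comp_sub, reassoc_of% hc,
    hm', reassoc_of% hl', hk, Preadditive.sub_comp, Category.assoc, Category.assoc]

/-- The connecting morphisms, as a natural transformation on a full subcategory of relative
monomorphisms. -/
def connectingNatTrans (R : ObjectProperty (Arrow A)) (hR : ∀ i, R i → IsRelMono C i.hom) :
    (R.ι ⋙ coker A) ⋙ toStable C ⟶ (R.ι ⋙ Arrow.leftFunc) ⋙ toStable C ⋙ cosyzygy C where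
  app i := toSusp C (connecting i.obj.hom (hR _ i.property))
  naturality i j f := connecting_naturality (hR _ i.property) (hR _ j.property) f.hom.left
    f.hom.right f.hom.w.symm _ (cokernel.π_desc _ _ _)

end Suspension

/-! ### Criteria for stability of a model category -/

section StableModel

variable {T : Type u} [Category.{v} T] {P : ObjectProperty T} {Si Om : T ⥤ T}

/-- Adjunction turns precomposition with `Si.map f` into precomposition with `f` on morphisms to `Om
V`, which is again in `P`. -/
lemma isLocal_map_of_adjunction (adj : Si ⊣ Om) (hP : ∀ V, P V → P (Om.obj V)) {M N : T}
    (f : M ⟶ N) (hf : P.isLocal f) : P.isLocal (Si.map f) := by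
  intro V hV
  have h : (fun g : Si.obj N ⟶ V => Si.map f ≫ g) =
      (adj.homEquiv M V).symm ∘ (fun g => f ≫ g) ∘ adj.homEquiv N V := by
    ext g
    simp [← adj.homEquiv_naturality_left]
  rw [h]
  exact (adj.homEquiv M V).symm.bijective.comp ((hf _ (hP V hV)).comp (adj.homEquiv N V).bijective)

/-- A morphism `E ⟶ V` kills `g` because morphisms from `N` to `V` vanish, so it factors through
`h`. Two such factorizations differ by a morphism through `Si N`, and morphisms `Si N ⟶ V` vanish as
they correspond to morphisms `N ⟶ Om V`. -/
lemma isLocal_of_rightTriangle [Preadditive T] [HasZeroObject T] {Nab : Set (RightTriangle Si)}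
    (H : IsPreRightTriangulated Si Nab) (adj : Si ⊣ Om) (hP : ∀ V, P V → P (Om.obj V))
    {M N E : T} {f : M ⟶ N} {g : N ⟶ E} {h : E ⟶ Si.obj M} (hT : RightTriangle.mk f g h ∈ Nab)
    (hN : ∀ V, P V → ∀ φ : N ⟶ V, φ = 0) : P.isLocal h := by
  intro V hV
  refine ⟨fun a b hab => ?_, fun φ => H.exists_desc₃ hT φ (hN V hV _)⟩
  obtain ⟨ψ, hψ⟩ := H.exists_desc₃ (H.rotate _ _ _ hT) (a - b) (by
    rw [Preadditive.comp_sub, sub_eq_zero]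
    exact hab)
  obtain rfl : ψ = 0 := (adj.homEquiv _ _).injective
    ((hN _ (hP V hV) _).trans (hN _ (hP V hV) _).symm)
  rw [comp_zero] at hψ
  exact sub_eq_zero.1 hψ.symm

variable {A : Type u} [Category.{v} A] [Abelian A] {C : ObjectProperty A}
  [IsAdditiveSubcategory C] [IsCovariantlyFinite C]

/-- The connecting morphism of a relative monomorphism `M ⟶ P` with `P` in `C` is a stable
isomorphism. -/
lemma isIso_toSusp_connecting {M N : A} (i : M ⟶ N) [Mono i] (hi : IsRelMono C i) (hN : C N) :
    IsIso (toSusp C (connecting i hi)) := by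
  obtain ⟨l, hl, hl'⟩ := (connecting_spec i hi).exists_extension
  obtain ⟨m, hm⟩ := leftApprox_isRelMono C M hN i
  have h := IsShortExact.of_mono i
  have h' := isShortExact_cosyzygy (C := C) i hN
  have := h.epi
  obtain ⟨s, hs⟩ := h'.exists_desc (m ≫ cokernel.π i) (by rw [reassoc_of% hm, h.zero])
  obtain ⟨x, hx⟩ := h.exists_desc (l ≫ m - 𝟙 _) (by simp [reassoc_of% hl, hm])
  obtain ⟨y, hy⟩ := h'.exists_desc (m ≫ l - 𝟙 _) (by simp [reassoc_of% hm, hl])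
  refine ⟨(toStable C).map s, ?_, ?_⟩
  · refine ((toStable C).map_comp _ _).symm.trans ?_
    rw [← CategoryTheory.Functor.map_id]
    refine toStable_map_eq _ hN x (cokernel.π i) ?_
    rw [← cancel_epi (cokernel.π i), reassoc_of% hx, Preadditive.comp_sub, reassoc_of% hl', hs]
    simp
  · refine ((toStable C).map_comp _ _).symm.trans ?_
    refine Eq.trans ?_ (CategoryTheory.Functor.map_id (toStable C) (cosyzygyObj C M))
    refine toStable_map_eq _ (leftApproxObj_mem C M) y (cosyzygyπ C M) ?_
    rw [← cancel_epi (cosyzygyπ C M), reassoc_of% hy, Preadditive.comp_sub, reassoc_of% hs, hl']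
    simp

section

variable {D : ObjectProperty A} [ModelCategory A]

/-- An abelian model category is stable if its weak equivalences are detected by morphisms from
a coreflective Frobenius subcategory of the stable category, which contains the cofibrant
objects. -/
lemma isStableModelCategory_of_stableEquivalences
    (hW : weakEquivalences A = stableEquivalences C D)
    (hD : IsFrobeniusSubcategory C D)
    (hP : ∀ M : A, ∃ (M' : A) (f : M' ⟶ M), D M' ∧ stableEquivalences C D f)
    (h : ∀ i, isCone A i → Mono i.hom ∧ IsRelMono C i.hom ∧ D i.left ∧ C i.right) :
    IsStableModelCategory A := by
  let P := stableSubcategory C D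
  have : P.ι.IsLeftAdjoint := isLeftAdjoint_ι fun M => by
    obtain ⟨M', f, hM', hf⟩ := hP M.as
    exact ⟨_, (toStable C).map f, hM', hf⟩
  let adj := Adjunction.ofIsLeftAdjoint P.ι
  let G := P.ι.rightAdjoint
  have : G.IsLocalization P.isColocal := by
    have := ObjectProperty.isLocalization_isColocal adj
    rwa [range_ι_obj] at this
  have : (toStable C ⋙ G).IsLocalization (weakEquivalences A) := by
    rw [hW]
    exact isLocalization_comp (toStable C) G P.isColocal
  let S := restrictFunctor P (cosyzygy C) hD.suspension_mem
  have : S.IsEquivalence := hD.isEquivalence_restrictFunctor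
  have counit (F : (isCone A).FullSubcategory ⥤ StableCategory C) (hF : ∀ i, P (F.obj i)) :
      IsIso (Functor.whiskerLeft F adj.counit) := by
    have (i : (isCone A).FullSubcategory) :
        IsIso ((Functor.whiskerLeft F adj.counit).app i) := by
      have h₁ := ObjectProperty.isColocal_adj_counit_app adj (F.obj i)
      rw [range_ι_obj] at h₁
      exact (P.isColocal_iff_isIso _ (P.prop_ι_obj _) (hF i)).1 h₁
    exact NatIso.isIso_of_isIso_app _
  let F := ((isCone A).ι ⋙ Arrow.leftFunc) ⋙ toStable C
  let K := ((isCone A).ι ⋙ coker A) ⋙ toStable C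
  have : IsIso (connectingNatTrans (isCone A) fun i hi => (h i hi).2.1) := by
    have (i : (isCone A).FullSubcategory) :
        IsIso ((connectingNatTrans (isCone A) fun i hi => (h i hi).2.1).app i) := by
      have := (h _ i.property).1
      exact isIso_toSusp_connecting i.obj.hom _ (h _ i.property).2.2.2
    exact NatIso.isIso_of_isIso_app _
  let δ : K ≅ F ⋙ cosyzygy C := asIso (connectingNatTrans (isCone A) fun i hi => (h i hi).2.1)
  have hF (i : (isCone A).FullSubcategory) : P (F.obj i) := (h _ i.property).2.2.1
  have hK (i : (isCone A).FullSubcategory) : P (K.obj i) := by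
    have := (h _ i.property).1
    exact hD.mem_of_isRelMono (IsShortExact.of_mono i.obj.hom) (h _ i.property).2.1
      (h _ i.property).2.2.1 (hD.le (h _ i.property).2.2.2)
  have := counit F hF
  have := counit K hK
  let e₁ : F ⋙ G ⋙ P.ι ≅ F := asIso (Functor.whiskerLeft F adj.counit)
  let e₂ : K ⋙ G ⋙ P.ι ≅ K := asIso (Functor.whiskerLeft K adj.counit)
  refine isStableModelCategory_of_isLocalization (toStable C ⋙ G) S ?_
  -- Sources and cokernels of cones both lie in `D`, so coreflection does nothing to them, and the
  -- connecting isomorphism identifies `Σ` of the source with the cokernel.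
  exact Functor.fullyFaithfulCancelRight (F := F ⋙ G ⋙ S) (G := K ⋙ G) P.ι
    (Functor.isoWhiskerRight e₁ (cosyzygy C) ≪≫ δ.symm ≪≫ e₂.symm)

/-- An abelian model category is stable if its weak equivalences are detected by morphisms to
a reflective Frobenius subcategory of the stable category, which is closed under `Ω`. -/
lemma isStableModelCategory_of_stableCoequivalences [IsContravariantlyFinite C]
    (hW : weakEquivalences A = stableCoequivalences C D)
    (hD : IsFrobeniusSubcategory C D)
    (hP : ∀ M : A, ∃ (M' : A) (f : M ⟶ M'), D M' ∧ stableCoequivalences C D f)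
    (hΩ : ∀ V, stableSubcategory C D V → stableSubcategory C D ((syzygy C).obj V))
    (h : ∀ i, isCone A i → IsRelMono C i.hom) :
    IsStableModelCategory A := by
  let P := stableSubcategory C D
  have : P.ι.IsRightAdjoint := isRightAdjoint_ι fun M => by
    obtain ⟨M', f, hM', hf⟩ := hP M.as
    exact ⟨_, (toStable C).map f, hM', hf⟩
  let adj := Adjunction.ofIsRightAdjoint P.ι
  let G := P.ι.leftAdjoint
  have hG : G.IsLocalization P.isLocal := by
    have := ObjectProperty.isLocalization_isLocal adj
    rwa [range_ι_obj] at this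
  have : (toStable C ⋙ G).IsLocalization (weakEquivalences A) := by
    rw [hW]
    exact isLocalization_comp (toStable C) G P.isLocal
  let S := restrictFunctor P (cosyzygy C) hD.suspension_mem
  have : S.IsEquivalence := hD.isEquivalence_restrictFunctor
  let F := ((isCone A).ι ⋙ Arrow.leftFunc) ⋙ toStable C
  let K := ((isCone A).ι ⋙ coker A) ⋙ toStable C
  have : IsIso (Functor.whiskerRight (connectingNatTrans (isCone A) h) G) := by
    have (i : (isCone A).FullSubcategory) :
        IsIso ((Functor.whiskerRight (connectingNatTrans (isCone A) h) G).app i) := by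
      refine Localization.inverts G P.isLocal _ ?_
      -- The target of the cone is only weakly contractible, so the connecting morphism need not be
      -- a stable isomorphism. It is local because stable morphisms from that target to `D` vanish.
      refine isLocal_of_rightTriangle
        (stableRightTriangles_isRightTriangulated C).isPreRightTriangulated (stableAdjunction C)
        hΩ (connecting_spec i.obj.hom _).mem fun V hV φ => ?_
      have h₁ : weakEquivalences A (0 : i.obj.right ⟶ 0) := i.property.2.2.mem
      rw [hW] at h₁
      obtain ⟨ψ, rfl⟩ := (h₁ V hV).2 φ
      rw [Functor.map_zero]
      exact zero_comp
    exact NatIso.isIso_of_isIso_app _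
  let δ : K ⋙ G ≅ F ⋙ cosyzygy C ⋙ G :=
    asIso (Functor.whiskerRight (connectingNatTrans (isCone A) h) G)
  -- The unit of the reflection is local, and `Σ` preserves local morphisms since `Ω` preserves `D`.
  -- Hence reflecting an object before suspending does not change its suspension in the
  -- localization.
  have : IsIso (Functor.whiskerRight adj.unit (cosyzygy C ⋙ G)) := by
    have (M : StableCategory C) :
        IsIso ((Functor.whiskerRight adj.unit (cosyzygy C ⋙ G)).app M) := by
      refine Localization.inverts G P.isLocal _
        (isLocal_map_of_adjunction (stableAdjunction C) hΩ _ ?_)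
      have h₁ := ObjectProperty.isLocal_adj_unit_app adj M
      rwa [range_ι_obj] at h₁
    exact NatIso.isIso_of_isIso_app _
  let η : cosyzygy C ⋙ G ≅ (G ⋙ P.ι) ⋙ cosyzygy C ⋙ G :=
    asIso (Functor.whiskerRight adj.unit (cosyzygy C ⋙ G))
  refine isStableModelCategory_of_isLocalization (toStable C ⋙ G) S ?_
  exact (δ ≪≫ Functor.isoWhiskerLeft F (η ≪≫ Functor.isoWhiskerLeft (G ⋙ S)
    (asIso adj.counit))).symm

end

end StableModel

/-! ### Stability of the two model structures of a cotorsion triple -/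

section TripleStable

variable {A : Type u} [Category.{v} A] [Abelian A]

namespace IsCompleteHereditaryCotorsionTriple

variable [HasExt.{w} A] {X Z Y : ObjectProperty A}
  (h : IsCompleteHereditaryCotorsionTriple.{w} X Z Y) [EnoughProjectives A]
include h

theorem hasStableAbelianModelStructure_left [IsCovariantlyFinite (isProjective A)] :
    HasStableAbelianModelStructure A X Z ⊤ := by
  obtain ⟨M, hM, hW⟩ := h.exists_projectiveModelStructure
  have hZ := h.epiWith_inf_stableEquivalences
  refine ⟨M, hM, isStableModelCategory_of_stableEquivalences hW h.isFrobeniusSubcategory_left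
    (fun M => ?_) fun i hi => ?_⟩
  · obtain ⟨K, E, i, p, zero, hS, hK, hE⟩ := h.complete_left.right_approx M
    exact ⟨E, p, hE, (hZ.ge p (h.isLiftingPair_left.epiWith_of_isShortExact
      ⟨zero, hS⟩ hK)).2⟩
  · obtain ⟨h₁, h₂, h₃⟩ := hi
    obtain ⟨hi, hi'⟩ := (hM.cofibrations_iff _).1 h₂.mem
    have hi₀ := IsShortExact.of_mono i.hom
    -- Cofibrancy is a condition on the morphism from the initial object, whose cokernel is the
    -- object itself.
    have hX : X i.left := h.cotorsion_left.isClosed_left.of_iso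
      (cokernelIsoOfEq (initialIsInitial.hom_ext (initial.to i.left) 0) ≪≫
        cokernelZeroIsoTarget) ((hM.cofibrations_iff _).1 h₁.mem).2
    -- The weak equivalence to `0` is an epimorphism whose kernel is the whole object, so that
    -- object is in `Z`. It is also an extension of objects of `X`, hence projective, and the cone
    -- is a left approximation.
    have hZ' : Z i.right := h.cotorsion_left.isClosed_right.of_iso kernelZeroIsoSource
      (hZ.le (0 : i.right ⟶ 0) ⟨⟨(isZero_zero A).epi _, trivial⟩, hW ▸ h₃.mem⟩).2
    have hX' := h.cotorsion_left.isClosed_left.of_shortExact hi₀ hX hi'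
    exact ⟨hi, fun P hP g =>
      have : Projective P := hP
      (h.cotorsion_left.extVanishes hi' (h.trivial_of_projective P)).exists_extension hi₀ g,
      hX, h.projective_of_mem hX' hZ'⟩

/-- All objects are cofibrant here and a cone need not be injective, so the criterion is the one
that compares cokernels with `Σ` only after reflection to `Y/I`. Closure of `Y/I` under `Ω` comes
from the torsion pair. -/
theorem hasStableAbelianModelStructure_right [EnoughInjectives A]
    [IsContravariantlyFinite (isInjective A)] : HasStableAbelianModelStructure A ⊤ Z Y := by
  obtain ⟨M, hM, hW⟩ := h.exists_injectiveModelStructure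
  have hZ := h.monoWith_inf_stableCoequivalences
  refine ⟨M, hM, isStableModelCategory_of_stableCoequivalences hW h.isFrobeniusSubcategory_right
    (fun M => ?_) h.isStableTorsionPair_right.2.loop_mem fun i hi => ?_⟩
  · obtain ⟨E, L, i, p, zero, hS, hE, hL⟩ := h.complete_right.left_approx M
    exact ⟨E, i, hE, (hZ.ge i (h.isLiftingPair_right.monoWith_of_isShortExact
      ⟨zero, hS⟩ hL)).2⟩
  · have := ((hM.cofibrations_iff _).1 hi.2.1.mem).1
    exact isRelMono_isInjective i.hom

end IsCompleteHereditaryCotorsionTriple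

end TripleStable

end CotorsionTriples

end

theorem proposition3p5 {A : Type u} [Category.{v} A] [Abelian A] [HasExt.{w} A]
    [EnoughProjectives A] [EnoughInjectives A] [HasLimits A] [HasColimits A]
    (X Z Y : ObjectProperty A)
    (hXZY : CotorsionTriples.IsCompleteHereditaryCotorsionTriple.{w} X Z Y)
    [CotorsionTriples.IsCovariantlyFinite (isProjective A)]
    [CotorsionTriples.IsContravariantlyFinite (isInjective A)] :
    (CotorsionTriples.IsStableTriangulated (isProjective A) X ∧
      CotorsionTriples.IsStableTriangulated (isInjective A) Y ∧
      CotorsionTriples.HasStableAbelianModelStructure A X Z ⊤ ∧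
      CotorsionTriples.HasStableAbelianModelStructure A ⊤ Z Y) ∧
    (CotorsionTriples.IsStableTorsionPair (isProjective A) X Z ∧
      CotorsionTriples.IsStableTorsionPair (isInjective A) Z Y) := by
  exact ⟨⟨hXZY.isFrobeniusSubcategory_left.isStableTriangulated,
    hXZY.isFrobeniusSubcategory_right.isStableTriangulated,
    hXZY.hasStableAbelianModelStructure_left, hXZY.hasStableAbelianModelStructure_right⟩,
    hXZY.isStableTorsionPair_left, hXZY.isStableTorsionPair_right⟩
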